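/- Let $\{(\varphi(t),X(t)):t\ge 0\}$ be a Markovian stochastic fluid model: $\varphi$ is an irreducible continuous-time Markov chain on $\mathcal S=\{1,\dots,n\}$ with generator $\mathbf T$ and stationary distribution $\boldsymbol\xi$, and the level $X(t)\ge 0$ changes at rate $c_i\in\mathbb R$ when $\varphi(t)=i$ and $X(t)>0$, and at rate $\max\{0,c_i\}$ when $\varphi(t)=i$ and $X(t)=0$. Let $\mathcal S_1=\{i:c_i>0\}$, $\mathcal S_2=\{i:c_i<0\}$, $\mathcal S_0=\{i:c_i=0\}$, and partition $\mathbf T$ into blocks $\mathbf T_{ab}$ ($a,b\in\{1,2,0\}$) accordingly. Assume that the model is stable, $\sum_i c_i\xi_i<0$, and that $\mathcal S_1\neq\varnothing$. Let $\mathbf C_1=\mathrm{diag}(c_i)_{i\in\mathcal S_1}$, $\mathbf C_2=\mathrm{diag}(|c_i|)_{i\in\mathcal S_2}$ and, for real $s$ and $a,b\in\{1,2\}$, let $\delta_{ab}$ be the Kronecker delta and $$\mathbf Q_{ab}(s)=\mathbf C_a^{-1}\bigl(\mathbf T_{ab}-\delta_{ab}\,s\mathbf I-\mathbf T_{a0}(\mathbf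 T_{00}-s\mathbf I)^{-1}\mathbf T_{0b}\bigr),\qquad \mathbf A_{ab}(s)=-\tfrac{d}{ds}\mathbf Q_{ab}(s)=\mathbf C_a^{-1}\bigl(\delta_{ab}\mathbf I+\mathbf T_{a0}(\mathbf T_{00}-s\mathbf I)^{-2}\mathbf T_{0b}\bigr),$$ where the terms containing $\mathbf T_{00}$ are absent if $\mathcal S_0=\varnothing$. With $\theta(0)=\inf\{t>0:X(t)=0\}$ let, for $i\in\mathcal S_1$, $j\in\mathcal S_2$, $$[\mathbf\Psi(s)]_{ij}=E\bigl(e^{-s\theta(0)}\mathbf 1\{\theta(0)<\infty,\ \varphi(\theta(0))=j\}\,\big|\,\varphi(0)=i,\ X(0)=0\bigr)\in[0,\infty].$$ Write $\mathbf\Psi(s)<\infty$ if all entries are finite, and $\mathbf\Psi(s)=\infty$ otherwise. Let $$s^*=\max\{s\le 0:\ \mathbf\Psi(s)<\infty,\ \mathbf\Psi(z)=\infty\text{ for all }z<s\}.$$ Where $\mathbf\Psi(s)<\infty$ and $\mathbf T_{00}-s\mathbf I$ is invertible, put $\mathbf K(s)=\mathbf Q_{11}(s)+\mathbf\Psi(s)\mathbf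 Q_{21}(s)$, $\mathbf D(s)=\mathbf Q_{22}(s)+\mathbf Q_{21}(s)\mathbf\Psi(s)$ and $$\mathbf U(s)=\mathbf A_{12}(s)+\mathbf A_{11}(s)\mathbf\Psi(s)+\mathbf\Psi(s)\mathbf A_{22}(s)+\mathbf\Psi(s)\mathbf A_{21}(s)\mathbf\Psi(s).$$ Then the maximum $s^*$ exists. For every $s>s^*$, $\mathbf\Psi(s)<\infty$, the matrix $\mathbf T_{00}-s\mathbf I$ is invertible, the derivative $\mathbf\Phi(s)=\frac{d}{ds}\mathbf\Psi(s)$ exists, and $\mathbf X=\mathbf\Phi(s)$ is the unique real $\mathcal S_1\times\mathcal S_2$ matrix with $$\mathbf K(s)\mathbf X+\mathbf X\mathbf D(s)=\mathbf U(s).$$ Furthermore, every entry of $\mathbf\Phi(s)$ tends to $-\infty$ as $s\downarrow s^*$. -/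

import Mathlib

open scoped ENNReal Topology

/-- The data of a Markovian stochastic fluid model with phase space `Fin n`: the infinitesimal
generator `T` of the phase process and the rate `c i` of change of the level in phase `i`. -/
structure FluidModel (n : ℕ) where
  T : Matrix (Fin n) (Fin n) ℝ
  c : Fin n → ℝ
  offDiag_nonneg : ∀ i j, i ≠ j → 0 ≤ T i j
  row_sum : ∀ i, ∑ j, T i j = 0

namespace FluidModel

variable {n : ℕ}

/-- Irreducibility: any phase can be reached from any other one along transitions of positive
rate. -/
def Irreducible (M : FluidModel n) : Prop :=
  ∀ i j, Relation.ReflTransGen (fun a b => a ≠ b ∧ 0 < M.T a b) i j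

/-- `ξ` is a stationary distribution of the phase process. -/
def IsStationary (M : FluidModel n) (ξ : Fin n → ℝ) : Prop :=
  (∀ i, 0 ≤ ξ i) ∧ ∑ i, ξ i = 1 ∧ Matrix.vecMul ξ M.T = 0

/-! ### The phase process

The continuous-time Markov chain with generator `T` is constructed from its jump chain and its
holding times. -/

/-- Transition probabilities of the jump chain. An absorbing phase is treated as one that jumps to
itself at rate `1`. -/
noncomputable def jumpProb (M : FluidModel n) (i j : Fin n) : ℝ :=
  if M.T i i = 0 then (if j = i then 1 else 0)
  else (if j = i then 0 else M.T i j / (-M.T i i))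

/-- Rate of the exponential holding time in phase `i`. -/
noncomputable def holdRate (M : FluidModel n) (i : Fin n) : ℝ :=
  if M.T i i = 0 then 1 else -M.T i i

theorem diag_eq (M : FluidModel n) (i : Fin n) :
    ∑ j ∈ Finset.univ.erase i, M.T i j = -M.T i i := by
  have h := M.row_sum i
  rw [← Finset.add_sum_erase _ _ (Finset.mem_univ i)] at h
  linarith

theorem neg_diag_nonneg (M : FluidModel n) (i : Fin n) : 0 ≤ -M.T i i := by
  rw [← M.diag_eq i]
  exact Finset.sum_nonneg fun j hj => M.offDiag_nonneg i j (Finset.ne_of_mem_erase hj).symm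

theorem holdRate_pos (M : FluidModel n) (i : Fin n) : 0 < M.holdRate i := by
  unfold holdRate
  split_ifs with h
  · exact one_pos
  · exact lt_of_le_of_ne (M.neg_diag_nonneg i) (fun h' => h (by linarith))

theorem jumpProb_nonneg (M : FluidModel n) (i j : Fin n) : 0 ≤ M.jumpProb i j := by
  unfold jumpProb
  split_ifs with h1 h2 h2
  · exact zero_le_one
  · exact le_rfl
  · exact le_rfl
  · exact div_nonneg (M.offDiag_nonneg i j (fun h => h2 h.symm)) (M.neg_diag_nonneg i)

theorem jumpProb_sum (M : FluidModel n) (i : Fin n) : ∑ j, M.jumpProb i j = 1 := by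
  unfold jumpProb
  by_cases h : M.T i i = 0
  · simp [h]
  · simp only [h, if_false]
    rw [← Finset.add_sum_erase _ _ (Finset.mem_univ i), if_pos rfl, zero_add,
      Finset.sum_congr rfl (g := fun j => M.T i j / (-M.T i i))
        (fun j hj => if_neg (Finset.ne_of_mem_erase hj)),
      ← Finset.sum_div, M.diag_eq i]
    exact div_self (fun h' => h (by linarith))

/-- Law of the next phase visited after phase `i`. -/
noncomputable def jumpPMF (M : FluidModel n) (i : Fin n) : PMF (Fin n) :=
  PMF.ofFintype (fun j => ENNReal.ofReal (M.jumpProb i j)) (by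
    rw [← ENNReal.ofReal_sum_of_nonneg (fun j _ => M.jumpProb_nonneg i j), M.jumpProb_sum,
      ENNReal.ofReal_one])

/-- Joint law of the next phase and the (independent) exponential holding time in phase `i`. -/
noncomputable def stepLaw (M : FluidModel n) (i : Fin n) : MeasureTheory.Measure (Fin n × ℝ) :=
  (M.jumpPMF i).toMeasure.prod (ProbabilityTheory.expMeasure (M.holdRate i))

instance (M : FluidModel n) (i : Fin n) : MeasureTheory.IsProbabilityMeasure (M.stepLaw i) := by
  have := ProbabilityTheory.isProbabilityMeasure_expMeasure (M.holdRate_pos i)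
  unfold stepLaw
  infer_instance

/-- A sample point assigns to every step number `k` and every phase `i` a pair
(next phase, holding time), to be used if the `k`-th phase visited is `i`. -/
abbrev Sample (n : ℕ) := ℕ → Fin n → Fin n × ℝ

/-- All the pairs are independent, and the one for step `k` and phase `i` has law `stepLaw i`.
Hence, given the jump chain and the holding times before step `k`, the `k`-th holding time and
the next phase are independent, exponential with rate `holdRate i` and distributed as
`jumpProb i`, where `i` is the `k`-th phase visited. -/
noncomputable def prob (M : FluidModel n) : MeasureTheory.Measure (Sample n) :=
  MeasureTheory.Measure.infinitePi fun _ : ℕ => MeasureTheory.Measure.pi fun i => M.stepLaw i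

instance (M : FluidModel n) : MeasureTheory.IsProbabilityMeasure M.prob := by
  unfold prob
  infer_instance

/-- The jump chain started in phase `i`. -/
def chain (i : Fin n) (ω : Sample n) : ℕ → Fin n
  | 0 => i
  | k + 1 => (ω k (chain i ω k)).1

/-- The holding time in the `k`-th phase visited. -/
def hold (i : Fin n) (ω : Sample n) (k : ℕ) : ℝ := (ω k (chain i ω k)).2

/-- The time of the `k`-th jump. -/
noncomputable def jumpTime (i : Fin n) (ω : Sample n) (k : ℕ) : ℝ :=
  ∑ l ∈ Finset.range k, hold i ω l

/-- The number of jumps up to time `t`, that is, the `k` with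
`jumpTime k ≤ t < jumpTime (k + 1)`. -/
noncomputable def jumpCount (i : Fin n) (ω : Sample n) (t : ℝ) : ℕ :=
  sInf {k | t < jumpTime i ω (k + 1)}

/-- The phase process `φ(t)` started in phase `i`. -/
noncomputable def phase (i : Fin n) (ω : Sample n) (t : ℝ) : Fin n :=
  chain i ω (jumpCount i ω t)

/-! ### The level process -/

/-- The level at the `k`-th jump, for the process started in phase `i` and level `x`. -/
noncomputable def levelAtJump (M : FluidModel n) (i : Fin n) (x : ℝ) (ω : Sample n) : ℕ → ℝ
  | 0 => x
  | k + 1 => max 0 (levelAtJump M i x ω k + M.c (chain i ω k) * hold i ω k)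

/-- The level process `X(t)` started in phase `i` and level `x ≥ 0`: during a stay in a phase `j`
it moves at rate `c j`, except that it stays at level `0` once there if `c j ≤ 0`. -/
noncomputable def level (M : FluidModel n) (i : Fin n) (x : ℝ) (ω : Sample n) (t : ℝ) : ℝ :=
  max 0 (M.levelAtJump i x ω (jumpCount i ω t) +
    M.c (phase i ω t) * (t - jumpTime i ω (jumpCount i ω t)))

/-- The positive times at which the level, started from `0` in phase `i`, equals `0`. -/
def zeroTimes (M : FluidModel n) (i : Fin n) (ω : Sample n) : Set ℝ :=
  {t | 0 < t ∧ M.level i 0 ω t = 0}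

/-- The first return time `θ(0) = inf {t > 0 : X(t) = 0}`; it is finite (and given by this
infimum of reals) exactly if `zeroTimes` is non-empty. -/
noncomputable def returnTime (M : FluidModel n) (i : Fin n) (ω : Sample n) : ℝ :=
  sInf (M.zeroTimes i ω)

/-! ### Partition of the phases, and the matrices of the model -/

/-- The phases with positive rate. -/
abbrev Up (M : FluidModel n) := {i : Fin n // 0 < M.c i}

/-- The phases with negative rate. -/
abbrev Down (M : FluidModel n) := {i : Fin n // M.c i < 0}

/-- The phases with rate zero. -/
abbrev Flat (M : FluidModel n) := {i : Fin n // M.c i = 0}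

/-- The block of `T` with rows and columns from two classes of phases. -/
def block (M : FluidModel n) (p q : Fin n → Prop) :
    Matrix {i // p i} {j // q j} ℝ :=
  M.T.submatrix Subtype.val Subtype.val

abbrev T11 (M : FluidModel n) : Matrix M.Up M.Up ℝ := M.block _ _
abbrev T12 (M : FluidModel n) : Matrix M.Up M.Down ℝ := M.block _ _
abbrev T10 (M : FluidModel n) : Matrix M.Up M.Flat ℝ := M.block _ _
abbrev T21 (M : FluidModel n) : Matrix M.Down M.Up ℝ := M.block _ _
abbrev T22 (M : FluidModel n) : Matrix M.Down M.Down ℝ := M.block _ _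
abbrev T20 (M : FluidModel n) : Matrix M.Down M.Flat ℝ := M.block _ _
abbrev T01 (M : FluidModel n) : Matrix M.Flat M.Up ℝ := M.block _ _
abbrev T02 (M : FluidModel n) : Matrix M.Flat M.Down ℝ := M.block _ _
abbrev T00 (M : FluidModel n) : Matrix M.Flat M.Flat ℝ := M.block _ _

noncomputable def C1 (M : FluidModel n) : Matrix M.Up M.Up ℝ :=
  Matrix.diagonal fun i => M.c i

noncomputable def C2 (M : FluidModel n) : Matrix M.Down M.Down ℝ :=
  Matrix.diagonal fun i => |M.c i|

/-- `T₀₀ - s I`. -/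
noncomputable def R (M : FluidModel n) (s : ℝ) : Matrix M.Flat M.Flat ℝ :=
  M.T00 - s • (1 : Matrix M.Flat M.Flat ℝ)

noncomputable def Q11 (M : FluidModel n) (s : ℝ) : Matrix M.Up M.Up ℝ :=
  M.C1⁻¹ * (M.T11 - s • (1 : Matrix M.Up M.Up ℝ) - M.T10 * (M.R s)⁻¹ * M.T01)

noncomputable def Q12 (M : FluidModel n) (s : ℝ) : Matrix M.Up M.Down ℝ :=
  M.C1⁻¹ * (M.T12 - M.T10 * (M.R s)⁻¹ * M.T02)

noncomputable def Q21 (M : FluidModel n) (s : ℝ) : Matrix M.Down M.Up ℝ :=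
  M.C2⁻¹ * (M.T21 - M.T20 * (M.R s)⁻¹ * M.T01)

noncomputable def Q22 (M : FluidModel n) (s : ℝ) : Matrix M.Down M.Down ℝ :=
  M.C2⁻¹ * (M.T22 - s • (1 : Matrix M.Down M.Down ℝ) - M.T20 * (M.R s)⁻¹ * M.T02)

/-- `A₁₁ = - dQ₁₁/ds`, and likewise for the other blocks. -/
noncomputable def A11 (M : FluidModel n) (s : ℝ) : Matrix M.Up M.Up ℝ :=
  M.C1⁻¹ * (1 + M.T10 * (M.R s)⁻¹ ^ 2 * M.T01)

noncomputable def A12 (M : FluidModel n) (s : ℝ) : Matrix M.Up M.Down ℝ :=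
  M.C1⁻¹ * (M.T10 * (M.R s)⁻¹ ^ 2 * M.T02)

noncomputable def A21 (M : FluidModel n) (s : ℝ) : Matrix M.Down M.Up ℝ :=
  M.C2⁻¹ * (M.T20 * (M.R s)⁻¹ ^ 2 * M.T01)

noncomputable def A22 (M : FluidModel n) (s : ℝ) : Matrix M.Down M.Down ℝ :=
  M.C2⁻¹ * (1 + M.T20 * (M.R s)⁻¹ ^ 2 * M.T02)

open Classical in
/-- The `[0,∞]`-valued expectation
`E(exp(-s θ(0)) 1{θ(0) < ∞, φ(θ(0)) = j} | φ(0) = i, X(0) = 0)`. -/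
noncomputable def psiENN (M : FluidModel n) (s : ℝ) (i : M.Up) (j : M.Down) : ℝ≥0∞ :=
  ∫⁻ ω, (if (M.zeroTimes i ω).Nonempty ∧ phase i.1 ω (M.returnTime i ω) = j.1
    then ENNReal.ofReal (Real.exp (-s * M.returnTime i ω)) else 0) ∂M.prob

/-- `Ψ(s) < ∞`. -/
def PsiFinite (M : FluidModel n) (s : ℝ) : Prop :=
  ∀ i j, M.psiENN s i j < ∞

/-- The real matrix `Ψ(s)`, for the `s` with `Ψ(s) < ∞`. -/
noncomputable def Psi (M : FluidModel n) (s : ℝ) : Matrix M.Up M.Down ℝ :=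
  Matrix.of fun i j => (M.psiENN s i j).toReal

/-- The set of which the singularity `s*` is the maximum. -/
def singSet (M : FluidModel n) : Set ℝ :=
  {s | s ≤ 0 ∧ M.PsiFinite s ∧ ∀ z < s, ¬ M.PsiFinite z}

/-- The singularity `s*`. -/
noncomputable def sStar (M : FluidModel n) : ℝ := sSup M.singSet

noncomputable def K (M : FluidModel n) (s : ℝ) : Matrix M.Up M.Up ℝ :=
  M.Q11 s + M.Psi s * M.Q21 s

noncomputable def D (M : FluidModel n) (s : ℝ) : Matrix M.Down M.Down ℝ :=
  M.Q22 s + M.Q21 s * M.Psi s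

noncomputable def U (M : FluidModel n) (s : ℝ) : Matrix M.Up M.Down ℝ :=
  M.A12 s + M.A11 s * M.Psi s + M.Psi s * M.A22 s + M.Psi s * M.A21 s * M.Psi s

/-- `Φ(s) = dΨ(s)/ds`, entry by entry. -/
noncomputable def Phi (M : FluidModel n) (s : ℝ) : Matrix M.Up M.Down ℝ :=
  Matrix.of fun i j => deriv (fun z => M.Psi z i j) s

end FluidModel

/-!
The argument works with all pairs of phases at once, before the phases of rate zero are eliminated.
Let `F s k x j = E(exp(-s τ); φ(τ) = j)`, where `τ` is the time at which the level, started from `x`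
in phase `k`, first passes zero. Up to a null event the return time is such a passage time
(`psiENN_eq_F`), so that `Ψ(s)` is a block of the matrix `W s` of the `F s k 0 j`. First-step
analysis and the semigroup property in `x` (`F_add`) give, by differentiation at `x = 0`, the matrix
equation `(T - s I) W + C W G = 0`, where `G = downGen s W` is the generator of the semigroup
(`residual_W`). Conversely, a nonnegative supersolution `A` of this equation with the rows of the
identity in the phases of negative rate forces finiteness at `s`, since `A exp(x G)` then dominates
`F s` (`passFinite_of_residual_nonpos`).

By irreducibility, one finite entry of `Ψ(s)` makes `F s` finite altogether. The matrix equation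
bounds the diagonal of `G` above. This bounds the `s` with `Ψ(s) < ∞` below, and keeps the
transforms after a jump from a phase of negative rate bounded as `s` decreases to the infimum of
these `s`; with Fatou's lemma, the infimum is attained (`exists_sing`).

To the right of `s*` the transforms are differentiable, with `V = -W' ≥ 0`, and so is the equation
(`deriv_equation`). Its rows of rate zero say that `T₀₀ - s I` maps the nonnegative row sums of `V`
to a negative vector. A matrix with nonnegative off-diagonal entries and this property is the negative
of a nonsingular M-matrix (`Matrix.nonneg_of_quasipositive`), which gives invertibility and
`-(T₀₀ - s I)⁻¹ ≥ 0`. Elimination of the phases of rate zero then yields `K Φ + Φ D = U`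
(`K_mul_V`), and the same criterion applies to the Sylvester operator `X ↦ K X + X D`: it is
quasi-positive and maps `-Φ ≥ 0` to `-U < 0`, hence is injective (`sylvester_injective`).

Finally, the entries of `V` increase as `s` decreases. If one entry of `Φ` stayed bounded near `s*`,
then by irreducibility and the differentiated equation all of them would (`BddV.all`), and for some
`ε` that does not depend on `s` the matrix `W s + ε V s` would be a supersolution at `s - ε ^ 2`, a
point to the left of `s*` if `s` is close to `s*` (`passFinite_of_bddV`). This contradicts the
definition of `s*`.
-/

namespace FluidModel
variable {n : ℕ}
open MeasureTheory ProbabilityTheory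

/-! ### First-step decomposition of the phase process -/

/-- The sample point that is seen from the first jump on. -/
def shift (ω : Sample n) : Sample n := fun k => ω (k + 1)

theorem measurable_shift : Measurable (shift : Sample n → Sample n) :=
  measurable_pi_lambda _ fun k => measurable_pi_apply (k + 1)

/-- Rate of the transitions from phase `i` to another phase `l`. -/
def rate (M : FluidModel n) (i l : Fin n) : ℝ := if l = i then 0 else M.T i l

theorem rate_nonneg (M : FluidModel n) (i l : Fin n) : 0 ≤ M.rate i l := by
  unfold rate
  split_ifs with h
  · exact le_rfl
  · exact M.offDiag_nonneg i l fun h' => h h'.symm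

theorem rate_of_ne (M : FluidModel n) {i l : Fin n} (h : i ≠ l) : M.rate i l = M.T i l :=
  if_neg h.symm

theorem sum_T_mul (M : FluidModel n) (i : Fin n) (f : Fin n → ℝ) :
    ∑ l, M.T i l * f l = M.T i i * f i + ∑ l, M.rate i l * f l := by
  rw [← Finset.add_sum_erase _ _ (Finset.mem_univ i),
    ← Finset.add_sum_erase Finset.univ (fun l => M.rate i l * f l) (Finset.mem_univ i)]
  have h : M.rate i i = 0 := if_pos rfl
  rw [h, zero_mul, zero_add]
  congr 1
  refine Finset.sum_congr rfl fun l hl => ?_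
  rw [M.rate_of_ne (Finset.ne_of_mem_erase hl).symm]

theorem measurable_cons : Measurable fun p : (Fin n → Fin n × ℝ) × Sample n =>
    (fun k => Nat.casesOn k p.1 p.2 : Sample n) := by
  refine measurable_pi_lambda _ fun k => ?_
  cases k with
  | zero => exact measurable_fst
  | succ k => exact (measurable_pi_apply k).comp measurable_snd

/-- The first coordinate of a sample point is independent of the remaining ones, which have the
law of the whole sample point. -/
theorem map_cons_prob (M : FluidModel n) :
    (((Measure.pi fun i => M.stepLaw i).prod M.prob).map
      fun p : (Fin n → Fin n × ℝ) × Sample n => (fun k => Nat.casesOn k p.1 p.2 : Sample n))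
      = M.prob := by
  refine Measure.eq_infinitePi (fun _ : ℕ => Measure.pi fun i => M.stepLaw i) fun s t ht => ?_
  classical
  -- a cylinder over the finite set `s` is one over an initial segment of `ℕ`
  set t' : ℕ → Set (Fin n → Fin n × ℝ) := fun k => if k ∈ s then t k else Set.univ with ht'
  have ht'm : ∀ k, MeasurableSet (t' k) := fun k => by
    by_cases h : k ∈ s <;> simp [ht', h, ht k]
  obtain ⟨N, hN⟩ : ∃ N, ∀ k ∈ s, k < N + 1 :=
    ⟨s.sup id, fun k hk => Nat.lt_succ_of_le (Finset.le_sup (f := id) hk)⟩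
  have hpi : (Set.pi s t : Set (Sample n)) = Set.pi (Finset.range (N + 1) : Finset ℕ) t' := by
    ext ω
    simp only [Set.mem_pi, Finset.mem_coe, ht', Finset.mem_range]
    constructor
    · intro h k _
      by_cases hk : k ∈ s
      · simpa [hk] using h k hk
      · simp [hk]
    · intro h k hk
      simpa [hk] using h k (hN k hk)
  have hpre : (fun p : (Fin n → Fin n × ℝ) × Sample n =>
      (fun k => Nat.casesOn k p.1 p.2 : Sample n)) ⁻¹' (Set.pi (Finset.range (N + 1) : Finset ℕ) t')
      = t' 0 ×ˢ Set.pi (Finset.range N : Finset ℕ) fun k => t' (k + 1) := by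
    ext ⟨x, ω⟩
    simp only [Set.mem_preimage, Set.mem_pi, Finset.mem_coe, Finset.mem_range, Set.mem_prod]
    constructor
    · intro h
      exact ⟨h 0 (Nat.succ_pos N), fun k hk => h (k + 1) (Nat.succ_lt_succ hk)⟩
    · rintro ⟨h0, h⟩ k hk
      cases k with
      | zero => exact h0
      | succ k => exact h k (Nat.lt_of_succ_lt_succ hk)
  have hprod : ∏ k ∈ s, (Measure.pi fun i => M.stepLaw i) (t k)
      = ∏ k ∈ Finset.range (N + 1), (Measure.pi fun i => M.stepLaw i) (t' k) := by
    have h1 : ∏ k ∈ s, (Measure.pi fun i => M.stepLaw i) (t k)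
        = ∏ k ∈ s, (Measure.pi fun i => M.stepLaw i) (t' k) :=
      Finset.prod_congr rfl fun k hk => by simp [ht', hk]
    rw [h1]
    refine Finset.prod_subset (fun k hk => Finset.mem_range.2 (hN k hk)) fun k _ hk => ?_
    simp [ht', hk]
  rw [hprod, hpi, Measure.map_apply measurable_cons (MeasurableSet.pi (Finset.countable_toSet _)
    fun k _ => ht'm k), hpre, Measure.prod_prod, prob,
    Measure.infinitePi_pi _ (fun k _ => ht'm (k + 1)), Finset.prod_range_succ', mul_comm]

/-- Integration over the first step in phase `i` and, independently, over the path after it. -/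
theorem lintegral_firstStep (M : FluidModel n) (i : Fin n) {f : Fin n × ℝ → Sample n → ℝ≥0∞}
    (hf : Measurable (Function.uncurry f)) :
    ∫⁻ ω, f (ω 0 i) (shift ω) ∂M.prob = ∫⁻ p, ∫⁻ ω, f p ω ∂M.prob ∂M.stepLaw i := by
  have hg : Measurable fun ω : Sample n => f (ω 0 i) (shift ω) :=
    hf.comp (((measurable_pi_apply i).comp (measurable_pi_apply 0)).prodMk measurable_shift)
  have hg2 : Measurable fun p : (Fin n → Fin n × ℝ) × Sample n => f (p.1 i) p.2 :=
    hf.comp (f := fun p : (Fin n → Fin n × ℝ) × Sample n => (p.1 i, p.2))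
      (((measurable_pi_apply i).comp measurable_fst).prodMk measurable_snd)
  conv_lhs => rw [← M.map_cons_prob]
  rw [lintegral_map hg measurable_cons]
  change ∫⁻ p : (Fin n → Fin n × ℝ) × Sample n, f (p.1 i) p.2 ∂_ = _
  rw [lintegral_prod (fun p : (Fin n → Fin n × ℝ) × Sample n => f (p.1 i) p.2)
    hg2.aemeasurable]
  have hk : Measurable fun p => ∫⁻ ω, f p ω ∂M.prob := hf.lintegral_prod_right'
  exact (measurePreserving_eval (fun i => M.stepLaw i) i).lintegral_comp hk

theorem ae_firstStep (M : FluidModel n) (i : Fin n) {p : Fin n × ℝ → Sample n → Prop}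
    (hp : MeasurableSet {q : (Fin n × ℝ) × Sample n | p q.1 q.2})
    (h : ∀ᵐ q ∂M.stepLaw i, ∀ᵐ ω ∂M.prob, p q ω) : ∀ᵐ ω ∂M.prob, p (ω 0 i) (shift ω) := by
  classical
  have hm : Measurable (Function.uncurry fun (q : Fin n × ℝ) (ω : Sample n) =>
      if p q ω then (0 : ℝ≥0∞) else 1) :=
    Measurable.ite hp measurable_const measurable_const
  have key := M.lintegral_firstStep i hm
  have h0 : ∫⁻ q, ∫⁻ ω, (if p q ω then (0 : ℝ≥0∞) else 1) ∂M.prob ∂M.stepLaw i = 0 := by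
    refine (lintegral_eq_zero_iff hm.lintegral_prod_right').2 ?_
    filter_upwards [h] with q hq
    refine (lintegral_congr_ae ?_).trans lintegral_zero
    filter_upwards [hq] with ω hω
    simp [hω]
  have hm' : Measurable fun ω : Sample n => if p (ω 0 i) (shift ω) then (0 : ℝ≥0∞) else 1 :=
    hm.comp (f := fun ω : Sample n => (ω 0 i, shift ω))
      (((measurable_pi_apply i).comp (measurable_pi_apply 0)).prodMk measurable_shift)
  rw [h0] at key
  filter_upwards [(lintegral_eq_zero_iff hm').1 key] with ω hω
  by_contra hc
  simp [hc] at hω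

theorem expMeasure_eq {r : ℝ} :
    expMeasure r = (volume.restrict (Set.Ici (0 : ℝ))).withDensity
      fun t => ENNReal.ofReal (r * Real.exp (-(r * t))) := by
  rw [expMeasure, gammaMeasure, ← withDensity_indicator measurableSet_Ici]
  congr 1
  ext t
  by_cases h : 0 ≤ t
  · rw [Set.indicator_of_mem (Set.mem_Ici.2 h), gammaPDF_of_nonneg h]
    simp
  · rw [Set.indicator_of_notMem (by simpa using h), gammaPDF_of_neg (not_le.1 h)]

/-- In terms of the generator, a sojourn in `i` of length `t` that ends with a jump to `l` has the
density `exp(T i i t) T i l`. -/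
theorem lintegral_stepLaw (M : FluidModel n) {i : Fin n} (hi : M.T i i ≠ 0)
    {f : Fin n × ℝ → ℝ≥0∞} (hf : Measurable f) :
    ∫⁻ p, f p ∂M.stepLaw i = ∫⁻ t in Set.Ioi (0 : ℝ),
      ENNReal.ofReal (Real.exp (M.T i i * t)) * ∑ l, ENNReal.ofReal (M.rate i l) * f (l, t) := by
  have := ProbabilityTheory.isProbabilityMeasure_expMeasure (M.holdRate_pos i)
  have hr : M.holdRate i = -M.T i i := if_neg hi
  have hfl : ∀ l, Measurable fun t => f (l, t) := fun l => hf.comp measurable_prodMk_left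
  rw [stepLaw, lintegral_prod _ hf.aemeasurable, lintegral_fintype]
  have hl : ∀ l, (∫⁻ t, f (l, t) ∂expMeasure (M.holdRate i)) * (M.jumpPMF i).toMeasure {l}
      = ∫⁻ t in Set.Ioi (0 : ℝ), ENNReal.ofReal (Real.exp (M.T i i * t)) *
        (ENNReal.ofReal (M.rate i l) * f (l, t)) := by
    intro l
    rw [PMF.toMeasure_apply_singleton _ _ (measurableSet_singleton l), expMeasure_eq,
      lintegral_withDensity_eq_lintegral_mul _ (by fun_prop) (hfl l), mul_comm,
      ← lintegral_const_mul _ (by fun_prop), setLIntegral_congr Ioi_ae_eq_Ici]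
    refine lintegral_congr fun t => ?_
    have h1 : M.jumpPMF i l = ENNReal.ofReal (M.jumpProb i l) := rfl
    have h2 : M.jumpProb i l * M.holdRate i = M.rate i l := by
      rw [hr, jumpProb, rate, if_neg hi]
      split_ifs
      · simp
      · exact div_mul_cancel₀ _ (neg_ne_zero.2 hi)
    rw [h1, Pi.mul_apply, ← mul_assoc, ← mul_assoc, ← ENNReal.ofReal_mul (M.jumpProb_nonneg i l),
      ← ENNReal.ofReal_mul (Real.exp_pos _).le, ← mul_assoc, h2, hr, neg_mul, neg_neg,
      mul_comm (M.rate i l)]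
  simp only [hl, Finset.mul_sum]
  rw [lintegral_finsetSum]
  intro l _
  exact (by fun_prop : Measurable fun t => ENNReal.ofReal (Real.exp (M.T i i * t))).mul
    ((hfl l).const_mul _)

theorem ae_stepLaw_pos (M : FluidModel n) (i : Fin n) : ∀ᵐ p ∂M.stepLaw i, 0 < p.2 := by
  have := ProbabilityTheory.isProbabilityMeasure_expMeasure (M.holdRate_pos i)
  have h : ∀ᵐ t ∂expMeasure (M.holdRate i), 0 < t := by
    rw [expMeasure_eq]
    refine (withDensity_absolutelyContinuous _ _).ae_le ?_
    rw [← restrict_Ioi_eq_restrict_Ici]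
    exact ae_restrict_mem measurableSet_Ioi
  exact (Measure.quasiMeasurePreserving_snd (μ := (M.jumpPMF i).toMeasure)).ae h

theorem ae_stepLaw_ne (M : FluidModel n) (i : Fin n) (a : ℝ) : ∀ᵐ p ∂M.stepLaw i, p.2 ≠ a := by
  have := ProbabilityTheory.isProbabilityMeasure_expMeasure (M.holdRate_pos i)
  have h : ∀ᵐ t ∂expMeasure (M.holdRate i), t ≠ a := by
    refine (withDensity_absolutelyContinuous _ _).ae_le ?_
    exact Measure.ae_ne volume a
  exact (Measure.quasiMeasurePreserving_snd (μ := (M.jumpPMF i).toMeasure)).ae h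

end FluidModel

namespace FluidModel
variable {n : ℕ}
open MeasureTheory ProbabilityTheory

/-! ### First passage to level zero -/

/-- `M.hits k i x j ω`: the level that starts from `x` in phase `i`, and is not stopped at zero,
becomes negative within the first `k` sojourns, for the first time in phase `j`. -/
def hits (M : FluidModel n) : ℕ → Fin n → ℝ → Fin n → Sample n → Prop
  | 0, _, _, _, _ => False
  | k + 1, i, x, j, ω =>
    if x + M.c i * (ω 0 i).2 < 0 then i = j
    else M.hits k (ω 0 i).1 (x + M.c i * (ω 0 i).2) j (shift ω)

/-- The time at which the level of `hits` crosses zero, if it does so within the first `k`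
sojourns. -/
noncomputable def hitTime (M : FluidModel n) : ℕ → Fin n → ℝ → Sample n → ℝ
  | 0, _, _, _ => 0
  | k + 1, i, x, ω =>
    if x + M.c i * (ω 0 i).2 < 0 then x / -M.c i
    else (ω 0 i).2 + M.hitTime k (ω 0 i).1 (x + M.c i * (ω 0 i).2) (shift ω)

theorem measurable_hold_zero (i : Fin n) :
    Measurable fun q : ℝ × Sample n => (q.2 0 i).2 :=
  measurable_snd.comp ((measurable_pi_apply i).comp
    ((measurable_pi_apply 0).comp measurable_snd))

theorem measurable_firstStep (M : FluidModel n) (i : Fin n) :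
    Measurable fun q : ℝ × Sample n =>
      ((q.2 0 i).1, q.1 + M.c i * (q.2 0 i).2, shift q.2) := by
  have h1 : Measurable fun q : ℝ × Sample n => q.2 0 i :=
    (measurable_pi_apply i).comp ((measurable_pi_apply 0).comp measurable_snd)
  exact (measurable_fst.comp h1).prodMk
    ((measurable_fst.add ((measurable_hold_zero i).const_mul _)).prodMk
      (measurable_shift.comp measurable_snd))

theorem measurableSet_firstStep_neg (M : FluidModel n) (i : Fin n) :
    MeasurableSet {q : ℝ × Sample n | q.1 + M.c i * (q.2 0 i).2 < 0} :=
  measurableSet_lt (measurable_fst.add ((measurable_hold_zero i).const_mul _)) measurable_const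

theorem measurable_hits (M : FluidModel n) (k : ℕ) (j : Fin n) :
    Measurable fun q : Fin n × ℝ × Sample n => M.hits k q.1 q.2.1 j q.2.2 := by
  induction k with
  | zero => exact measurable_const
  | succ k ih =>
    refine measurable_from_prod_countable_right fun i => ?_
    exact Measurable.ite (M.measurableSet_firstStep_neg i)
      (show Measurable fun _ : ℝ × Sample n => i = j from measurable_const)
      (ih.comp (M.measurable_firstStep i))

theorem measurable_hitTime (M : FluidModel n) (k : ℕ) :
    Measurable fun q : Fin n × ℝ × Sample n => M.hitTime k q.1 q.2.1 q.2.2 := by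
  induction k with
  | zero => exact measurable_const
  | succ k ih =>
    refine measurable_from_prod_countable_right fun i => ?_
    exact Measurable.ite (M.measurableSet_firstStep_neg i)
      (show Measurable fun q : ℝ × Sample n => q.1 / -M.c i from measurable_fst.div_const _)
      ((measurable_hold_zero i).add (ih.comp (M.measurable_firstStep i)))

theorem hits_succ_of_hits (M : FluidModel n) (k : ℕ) (i : Fin n) (x : ℝ) (j : Fin n)
    (ω : Sample n) (h : M.hits k i x j ω) : M.hits (k + 1) i x j ω := by
  induction k generalizing i x ω with
  | zero => exact h.elim
  | succ k ih =>
    rw [hits] at h ⊢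
    split_ifs at h ⊢
    · exact h
    · exact ih _ _ _ h

theorem hitTime_succ_of_hits (M : FluidModel n) (k : ℕ) (i : Fin n) (x : ℝ) (j : Fin n)
    (ω : Sample n) (h : M.hits k i x j ω) : M.hitTime (k + 1) i x ω = M.hitTime k i x ω := by
  induction k generalizing i x ω with
  | zero => exact h.elim
  | succ k ih =>
    have e : ∀ m, M.hitTime (m + 1) i x ω = if x + M.c i * (ω 0 i).2 < 0 then x / -M.c i
      else (ω 0 i).2 + M.hitTime m (ω 0 i).1 (x + M.c i * (ω 0 i).2) (shift ω) := fun _ => rfl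
    rw [hits] at h
    rw [e (k + 1), e k]
    split_ifs at h ⊢
    · rfl
    · rw [ih _ _ _ h]

theorem hits_mono (M : FluidModel n) {k l : ℕ} (hkl : k ≤ l) {i : Fin n} {x : ℝ} {j : Fin n}
    {ω : Sample n} (h : M.hits k i x j ω) :
    M.hits l i x j ω ∧ M.hitTime l i x ω = M.hitTime k i x ω := by
  induction l, hkl using Nat.le_induction with
  | base => exact ⟨h, rfl⟩
  | succ l _ ih =>
    exact ⟨M.hits_succ_of_hits _ _ _ _ _ ih.1, (M.hitTime_succ_of_hits _ _ _ _ _ ih.1).trans ih.2⟩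

/-- The event that the level becomes negative at all, for the first time in phase `j`. -/
def hitSet (M : FluidModel n) (i : Fin n) (x : ℝ) (j : Fin n) : Set (Sample n) :=
  {ω | ∃ k, M.hits k i x j ω}

open Classical in
/-- The time at which the level crosses zero, on the event `hitSet`. -/
noncomputable def passTime (M : FluidModel n) (i : Fin n) (x : ℝ) (j : Fin n) (ω : Sample n) :
    ℝ :=
  if h : ∃ k, M.hits k i x j ω then M.hitTime (Nat.find h) i x ω else 0

theorem passTime_eq (M : FluidModel n) {k : ℕ} {i : Fin n} {x : ℝ} {j : Fin n} {ω : Sample n}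
    (h : M.hits k i x j ω) : M.passTime i x j ω = M.hitTime k i x ω := by
  classical
  have hex : ∃ k, M.hits k i x j ω := ⟨k, h⟩
  rw [passTime, dif_pos hex]
  exact (M.hits_mono (Nat.find_min' hex h) (Nat.find_spec hex)).2.symm

theorem measurable_prodMk_sample (i : Fin n) (x : ℝ) :
    Measurable fun ω : Sample n => (i, x, ω) :=
  measurable_const.prodMk (measurable_const.prodMk measurable_id)

theorem measurableSet_hits (M : FluidModel n) (k : ℕ) (i : Fin n) (x : ℝ) (j : Fin n) :
    MeasurableSet {ω | M.hits k i x j ω} :=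
  measurableSet_setOfPred.2 ((M.measurable_hits k j).comp (measurable_prodMk_sample i x))

theorem measurableSet_hitSet (M : FluidModel n) (i : Fin n) (x : ℝ) (j : Fin n) :
    MeasurableSet (M.hitSet i x j) := by
  have : M.hitSet i x j = ⋃ k, {ω | M.hits k i x j ω} := by
    ext ω
    simp [hitSet]
  rw [this]
  exact MeasurableSet.iUnion fun k => M.measurableSet_hits k i x j

theorem measurable_passTime (M : FluidModel n) (i : Fin n) (x : ℝ) (j : Fin n) :
    Measurable (M.passTime i x j) := by
  classical
  have hm : ∀ k, Measurable fun ω => if M.hits k i x j ω then M.hitTime k i x ω else 0 := fun k =>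
    Measurable.ite (M.measurableSet_hits k i x j)
      ((M.measurable_hitTime k).comp (measurable_prodMk_sample i x)) measurable_const
  refine measurable_of_tendsto_metrizable hm (tendsto_pi_nhds.2 fun ω => ?_)
  by_cases h : ∃ k, M.hits k i x j ω
  · obtain ⟨k, hk⟩ := h
    refine tendsto_const_nhds.congr' ?_
    filter_upwards [Filter.eventually_ge_atTop k] with l hl
    rw [if_pos (M.hits_mono hl hk).1, (M.hits_mono hl hk).2, M.passTime_eq hk]
  · rw [passTime, dif_neg h]
    simp only [not_exists] at h
    simp [h]

/-- The durations of a sojourn in phase `i` after which the level started from `x` has not become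
negative. -/
def staySet (M : FluidModel n) (i : Fin n) (x : ℝ) : Set ℝ := {t | 0 < t ∧ 0 ≤ x + M.c i * t}

/-- The operator of the first-step analysis of first passage to level zero. -/
noncomputable def passStep (M : FluidModel n) (s : ℝ) (f : Fin n → ℝ → Fin n → ℝ≥0∞)
    (i : Fin n) (x : ℝ) (j : Fin n) : ℝ≥0∞ :=
  (if M.c i < 0 ∧ i = j then ENNReal.ofReal (Real.exp ((M.T i i - s) * (x / -M.c i))) else 0) +
  ∫⁻ t in M.staySet i x, ENNReal.ofReal (Real.exp ((M.T i i - s) * t)) *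
    ∑ l, ENNReal.ofReal (M.rate i l) * f l (x + M.c i * t) j

/-- The part of `F` that is due to a passage within the first `k` sojourns, computed by first-step
analysis. -/
noncomputable def FK (M : FluidModel n) (s : ℝ) : ℕ → Fin n → ℝ → Fin n → ℝ≥0∞
  | 0 => fun _ _ _ => 0
  | k + 1 => M.passStep s (M.FK s k)

/-- `F s i x j = E(exp(-s τ); φ(τ) = j)`, where `τ` is the first passage time to level zero for
the level started from `x ≥ 0` in phase `i`; see `F_eq_lintegral`. For `x = 0` a passage requires
that the level becomes negative. -/
noncomputable def F (M : FluidModel n) (s : ℝ) (i : Fin n) (x : ℝ) (j : Fin n) : ℝ≥0∞ :=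
  ⨆ k, M.FK s k i x j

theorem measurableSet_staySet (M : FluidModel n) (i : Fin n) (x : ℝ) :
    MeasurableSet (M.staySet i x) :=
  measurableSet_Ioi.inter
    (measurableSet_le measurable_const (measurable_const.add (measurable_id.const_mul _)))

theorem sum_ofReal_rate (M : FluidModel n) (i : Fin n) :
    ∑ l, ENNReal.ofReal (M.rate i l) = ENNReal.ofReal (-M.T i i) := by
  rw [← ENNReal.ofReal_sum_of_nonneg fun l _ => M.rate_nonneg i l]
  have h1 := M.sum_T_mul i fun _ => 1
  have h2 := M.row_sum i
  simp only [mul_one] at h1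
  congr 1
  linarith

theorem lintegral_exp_Ioi {b : ℝ} (hb : b < 0) (a : ℝ) :
    ∫⁻ t in Set.Ioi a, ENNReal.ofReal (Real.exp (b * t))
      = ENNReal.ofReal (Real.exp (b * a) / -b) := by
  rw [← ofReal_integral_eq_lintegral_ofReal (integrableOn_exp_mul_Ioi hb a)
    (Filter.Eventually.of_forall fun t => (Real.exp_pos _).le), integral_exp_mul_Ioi hb, neg_div,
    div_neg]

open Classical in
/-- The iterates `FK` of the first-step operator are the transforms of the passages within `k`
sojourns. -/
theorem lintegral_hits (M : FluidModel n) (hT : ∀ i, M.T i i ≠ 0) (s : ℝ) (k : ℕ) (i : Fin n)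
    {x : ℝ} (hx : 0 ≤ x) (j : Fin n) :
    ∫⁻ ω, (if M.hits k i x j ω then ENNReal.ofReal (Real.exp (-s * M.hitTime k i x ω)) else 0)
      ∂M.prob = M.FK s k i x j := by
  induction k generalizing i x with
  | zero => simp [hits, FK]
  | succ k ih =>
    have hTi : M.T i i < 0 := lt_of_le_of_ne (by linarith [M.neg_diag_nonneg i]) (hT i)
    -- the integrand as a function of the first step and of the path after it
    set G : Fin n × ℝ → Sample n → ℝ≥0∞ := fun p ω =>
      if x + M.c i * p.2 < 0 then
        (if i = j then ENNReal.ofReal (Real.exp (-s * (x / -M.c i))) else 0)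
      else ENNReal.ofReal (Real.exp (-s * p.2)) * (if M.hits k p.1 (x + M.c i * p.2) j ω then
        ENNReal.ofReal (Real.exp (-s * M.hitTime k p.1 (x + M.c i * p.2) ω)) else 0) with hG
    have hstep : ∀ ω : Sample n, (if M.hits (k + 1) i x j ω then
        ENNReal.ofReal (Real.exp (-s * M.hitTime (k + 1) i x ω)) else 0)
        = G (ω 0 i) (shift ω) := by
      intro ω
      simp only [hG, hits, hitTime]
      by_cases h1 : x + M.c i * (ω 0 i).2 < 0
      · simp only [h1, if_true]
      · simp only [h1, if_false]
        by_cases h2 : M.hits k (ω 0 i).1 (x + M.c i * (ω 0 i).2) j (shift ω)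
        · rw [if_pos h2, if_pos h2, ← ENNReal.ofReal_mul (Real.exp_pos _).le, ← Real.exp_add,
            mul_add]
        · rw [if_neg h2, if_neg h2, mul_zero]
    have hmq : Measurable fun q : (Fin n × ℝ) × Sample n => (q.1.1, x + M.c i * q.1.2, q.2) :=
      (measurable_fst.comp measurable_fst).prodMk
        ((measurable_const.add ((measurable_snd.comp measurable_fst).const_mul _)).prodMk
          measurable_snd)
    have hGm : Measurable (Function.uncurry G) := by
      refine Measurable.ite ?_ measurable_const (Measurable.mul ?_ (Measurable.ite ?_ ?_
        measurable_const))
      · exact measurableSet_lt (measurable_const.add ((measurable_snd.comp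
          measurable_fst).const_mul _)) measurable_const
      · exact ENNReal.measurable_ofReal.comp (Real.measurable_exp.comp ((measurable_snd.comp
          measurable_fst).const_mul _))
      · exact measurableSet_setOfPred.2 ((M.measurable_hits k j).comp hmq)
      · exact ENNReal.measurable_ofReal.comp (Real.measurable_exp.comp
          (((M.measurable_hitTime k).comp hmq).const_mul _))
    simp only [hstep]
    have hGi : Measurable fun p => ∫⁻ ω, G p ω ∂M.prob := hGm.lintegral_prod_right'
    rw [M.lintegral_firstStep i hGm, M.lintegral_stepLaw (hT i) hGi,
      FK, passStep]
    have hIoi : Set.Ioi (0 : ℝ) = {t | 0 < t ∧ x + M.c i * t < 0} ∪ M.staySet i x := by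
      ext t
      simp only [Set.mem_Ioi, Set.mem_union, Set.mem_ofPred_eq, staySet]
      constructor
      · intro ht
        rcases lt_or_ge (x + M.c i * t) 0 with h | h
        · exact Or.inl ⟨ht, h⟩
        · exact Or.inr ⟨ht, h⟩
      · rintro (h | h) <;> exact h.1
    have hms : MeasurableSet {t | 0 < t ∧ x + M.c i * t < 0} :=
      measurableSet_Ioi.inter
        (measurableSet_lt (measurable_const.add (measurable_id.const_mul _)) measurable_const)
    rw [hIoi, lintegral_union (M.measurableSet_staySet i x)
      (Set.disjoint_left.2 fun t h1 h2 => not_lt.2 h2.2 h1.2)]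
    -- sojourns that end the passage contribute the first term of `passStep`, the others the
    -- integral
    congr 1
    · rw [setLIntegral_congr_fun hms (g := fun t => ENNReal.ofReal (Real.exp (M.T i i * t)) *
        (ENNReal.ofReal (-M.T i i) *
          (if i = j then ENNReal.ofReal (Real.exp (-s * (x / -M.c i))) else 0)))]
      · by_cases hc : M.c i < 0
        · have hset : {t | 0 < t ∧ x + M.c i * t < 0} = Set.Ioi (x / -M.c i) := by
            ext t
            simp only [Set.mem_ofPred_eq, Set.mem_Ioi, div_lt_iff₀ (neg_pos.2 hc)]
            constructor
            · rintro ⟨_, h⟩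
              linarith
            · intro h
              refine ⟨?_, by linarith⟩
              by_contra ht
              nlinarith
          by_cases hij : i = j
          · rw [hset, if_pos hij, if_pos ⟨hc, hij⟩, lintegral_mul_const _ (by fun_prop),
              lintegral_exp_Ioi hTi, ← ENNReal.ofReal_mul (by linarith),
              ← ENNReal.ofReal_mul (by
                exact div_nonneg (Real.exp_pos _).le (by linarith)), ← mul_assoc,
              div_mul_cancel₀ _ (by linarith), ← Real.exp_add]
            congr 2
            ring
          · simp [hij]
        · have hset : {t | 0 < t ∧ x + M.c i * t < 0} = ∅ := by
            ext t
            simp only [Set.mem_ofPred_eq, Set.mem_empty_iff_false, iff_false, not_and, not_lt]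
            intro ht
            have := mul_nonneg (not_lt.1 hc) ht.le
            linarith
          simp [hset, hc]
      · intro t ht
        have h2 : x + M.c i * t < 0 := ht.2
        simp only [hG, h2, if_true, lintegral_const, measure_univ, mul_one]
        rw [← Finset.sum_mul, sum_ofReal_rate]
    · refine setLIntegral_congr_fun (M.measurableSet_staySet i x) fun t ht => ?_
      have h2 : ¬ x + M.c i * t < 0 := not_lt.2 ht.2
      have h3 : ∀ l, ∫⁻ ω, G (l, t) ω ∂M.prob
          = ENNReal.ofReal (Real.exp (-s * t)) * M.FK s k l (x + M.c i * t) j := by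
        intro l
        simp only [hG, h2, if_false]
        rw [lintegral_const_mul, ih l ht.2]
        exact Measurable.ite (M.measurableSet_hits k l _ j) (ENNReal.measurable_ofReal.comp
          (Real.measurable_exp.comp (((M.measurable_hitTime k).comp
            (measurable_prodMk_sample l _)).const_mul _))) measurable_const
      change _ * ∑ l, ENNReal.ofReal (M.rate i l) * ∫⁻ ω, G (l, t) ω ∂M.prob = _
      simp only [h3]
      have h4 : Real.exp ((M.T i i - s) * t) = Real.exp (M.T i i * t) * Real.exp (-s * t) := by
        rw [← Real.exp_add]
        congr 1
        ring
      rw [h4, ENNReal.ofReal_mul (Real.exp_pos _).le, mul_assoc, Finset.mul_sum, Finset.mul_sum,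
        Finset.mul_sum]
      refine Finset.sum_congr rfl fun l _ => ?_
      ring

theorem F_eq_lintegral (M : FluidModel n) (hT : ∀ i, M.T i i ≠ 0) (s : ℝ) (i : Fin n)
    {x : ℝ} (hx : 0 ≤ x) (j : Fin n) : M.F s i x j =
      ∫⁻ ω in M.hitSet i x j, ENNReal.ofReal (Real.exp (-s * M.passTime i x j ω)) ∂M.prob := by
  classical
  simp only [F, ← M.lintegral_hits hT s _ i hx j]
  rw [← lintegral_iSup, ← lintegral_indicator (M.measurableSet_hitSet i x j)]
  · refine lintegral_congr fun ω => Eq.symm ?_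
    by_cases h : ω ∈ M.hitSet i x j
    · rw [Set.indicator_of_mem h]
      obtain ⟨k, hk⟩ := h
      refine le_antisymm ?_ (iSup_le fun l => ?_)
      · refine le_iSup_of_le k ?_
        rw [if_pos hk, M.passTime_eq hk]
      · split_ifs with hl
        · rw [M.passTime_eq hl]
        · exact zero_le
    · rw [Set.indicator_of_notMem h]
      have h' : ∀ k, ¬ M.hits k i x j ω := fun k hk => h ⟨k, hk⟩
      simp [h']
  · intro k
    exact Measurable.ite (M.measurableSet_hits k i x j) (ENNReal.measurable_ofReal.comp
      (Real.measurable_exp.comp (((M.measurable_hitTime k).comp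
        (measurable_prodMk_sample i x)).const_mul _))) measurable_const
  · intro k l hkl ω
    by_cases hk : M.hits k i x j ω
    · simp only [if_pos hk, if_pos (M.hits_mono hkl hk).1, (M.hits_mono hkl hk).2]
      exact le_rfl
    · simp [hk]

end FluidModel

namespace FluidModel
variable {n : ℕ}
open MeasureTheory ProbabilityTheory

/-! ### The return time as a first passage time -/

/-- The level at the `k`-th jump, for the level that is not stopped at zero. -/
def rawLevel (M : FluidModel n) (i : Fin n) (x : ℝ) (ω : Sample n) : ℕ → ℝ
  | 0 => x
  | k + 1 => rawLevel M i x ω k + M.c (chain i ω k) * hold i ω k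

theorem chain_succ_eq (i : Fin n) (ω : Sample n) (k : ℕ) :
    chain i ω (k + 1) = chain (ω 0 i).1 (shift ω) k := by
  induction k with
  | zero => rfl
  | succ k ih => rw [chain, ih, chain, shift]

theorem hold_succ_eq (i : Fin n) (ω : Sample n) (k : ℕ) :
    hold i ω (k + 1) = hold (ω 0 i).1 (shift ω) k := by
  rw [hold, hold, chain_succ_eq, shift]

theorem jumpTime_succ_eq (i : Fin n) (ω : Sample n) (k : ℕ) :
    jumpTime i ω (k + 1) = (ω 0 i).2 + jumpTime (ω 0 i).1 (shift ω) k := by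
  rw [jumpTime, Finset.sum_range_succ', add_comm, jumpTime]
  simp only [hold_succ_eq]
  rfl

theorem rawLevel_succ_eq (M : FluidModel n) (i : Fin n) (x : ℝ) (ω : Sample n) (k : ℕ) :
    M.rawLevel i x ω (k + 1)
      = M.rawLevel (ω 0 i).1 (x + M.c i * (ω 0 i).2) (shift ω) k := by
  induction k with
  | zero => rfl
  | succ k ih => rw [rawLevel, ih, rawLevel, chain_succ_eq, hold_succ_eq]

/-- The recursive event `hits` in terms of the path: sojourn `m` is the first one at the end of
which the unstopped level is negative. -/
theorem hits_iff (M : FluidModel n) (k : ℕ) (i : Fin n) (x : ℝ) (j : Fin n) (ω : Sample n) :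
    M.hits k i x j ω ↔ ∃ m < k, (∀ l < m, 0 ≤ M.rawLevel i x ω (l + 1)) ∧
      M.rawLevel i x ω (m + 1) < 0 ∧ chain i ω m = j := by
  induction k generalizing i x ω with
  | zero => simp [hits]
  | succ k ih =>
    have h1 : M.rawLevel i x ω 1 = x + M.c i * (ω 0 i).2 := rfl
    rw [hits]
    split_ifs with h
    · constructor
      · intro hij
        exact ⟨0, Nat.succ_pos k, fun l hl => absurd hl (Nat.not_lt_zero l), h1 ▸ h, hij⟩
      · rintro ⟨m, _, hm, _, hj⟩
        cases m with
        | zero => exact hj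
        | succ m => exact absurd (hm 0 (Nat.succ_pos m)) (not_le.2 (h1 ▸ h))
    · rw [ih]
      constructor
      · rintro ⟨m, hmk, hm, hneg, hj⟩
        refine ⟨m + 1, Nat.succ_lt_succ hmk, fun l hl => ?_, ?_, ?_⟩
        · cases l with
          | zero => exact h1 ▸ not_lt.1 h
          | succ l =>
            rw [rawLevel_succ_eq]
            exact hm l (Nat.lt_of_succ_lt_succ hl)
        · rw [rawLevel_succ_eq]
          exact hneg
        · rw [chain_succ_eq]
          exact hj
      · rintro ⟨m, hmk, hm, hneg, hj⟩
        cases m with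
        | zero => exact absurd (h1 ▸ hneg) h
        | succ m =>
          refine ⟨m, Nat.lt_of_succ_lt_succ hmk, fun l hl => ?_, ?_, ?_⟩
          · rw [← rawLevel_succ_eq]
            exact hm (l + 1) (Nat.succ_lt_succ hl)
          · rw [← rawLevel_succ_eq]
            exact hneg
          · rw [← chain_succ_eq]
            exact hj

theorem hitTime_eq (M : FluidModel n) {k m : ℕ} (hmk : m < k) {i : Fin n} {x : ℝ} {ω : Sample n}
    (hm : ∀ l < m, 0 ≤ M.rawLevel i x ω (l + 1)) (hneg : M.rawLevel i x ω (m + 1) < 0) :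
    M.hitTime k i x ω
      = jumpTime i ω m + M.rawLevel i x ω m / -M.c (chain i ω m) := by
  induction k generalizing i x ω m with
  | zero => exact absurd hmk (Nat.not_lt_zero m)
  | succ k ih =>
    have h1 : M.rawLevel i x ω 1 = x + M.c i * (ω 0 i).2 := rfl
    rw [hitTime]
    cases m with
    | zero =>
      rw [if_pos (h1 ▸ hneg)]
      simp [jumpTime, rawLevel, chain]
    | succ m =>
      rw [if_neg (not_lt.2 (h1 ▸ hm 0 (Nat.succ_pos m))), ih (m := m), jumpTime_succ_eq,
        rawLevel_succ_eq, chain_succ_eq, add_assoc]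
      · exact Nat.lt_of_succ_lt_succ hmk
      · intro l hl
        rw [← rawLevel_succ_eq]
        exact hm (l + 1) (Nat.succ_lt_succ hl)
      · rw [← rawLevel_succ_eq]
        exact hneg

theorem measurable_rawLevel (M : FluidModel n) (k : ℕ) :
    Measurable fun q : Fin n × ℝ × Sample n => M.rawLevel q.1 q.2.1 q.2.2 k := by
  induction k with
  | zero => exact measurable_fst.comp measurable_snd
  | succ k ih =>
    refine measurable_from_prod_countable_right fun i => ?_
    simp only [rawLevel_succ_eq]
    exact ih.comp (M.measurable_firstStep i)

theorem ae_stepLaw_add_ne_zero (M : FluidModel n) (i : Fin n) {x : ℝ} (h : x ≠ 0 ∨ M.c i ≠ 0) :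
    ∀ᵐ p ∂M.stepLaw i, x + M.c i * p.2 ≠ 0 := by
  by_cases hc : M.c i = 0
  · refine Filter.Eventually.of_forall fun p => ?_
    simpa [hc] using h
  · filter_upwards [M.ae_stepLaw_ne i (-x / M.c i)] with p hp h0
    refine hp ?_
    rw [eq_div_iff hc]
    linarith

theorem ae_rawLevel_ne_zero (M : FluidModel n) (k : ℕ) (i : Fin n) {x : ℝ} (hx : x ≠ 0) :
    ∀ᵐ ω ∂M.prob, M.rawLevel i x ω k ≠ 0 := by
  induction k generalizing i x with
  | zero => exact Filter.Eventually.of_forall fun _ => hx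
  | succ k ih =>
    simp only [rawLevel_succ_eq]
    have hmq : Measurable fun q : (Fin n × ℝ) × Sample n => (q.1.1, x + M.c i * q.1.2, q.2) :=
      (measurable_fst.comp measurable_fst).prodMk
        ((measurable_const.add ((measurable_snd.comp measurable_fst).const_mul _)).prodMk
          measurable_snd)
    refine M.ae_firstStep i (p := fun q ω => M.rawLevel q.1 (x + M.c i * q.2) ω k ≠ 0)
      (((M.measurable_rawLevel k).comp hmq) (measurableSet_singleton (0 : ℝ)).compl) ?_
    filter_upwards [M.ae_stepLaw_add_ne_zero i (Or.inl hx)] with q hq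
    exact ih q.1 hq

/-- Started from zero in a phase of positive rate, the level is almost surely nonzero at all the
jumps. -/
theorem ae_rawLevel_succ_ne_zero (M : FluidModel n) (i : Fin n) (hi : 0 < M.c i) :
    ∀ᵐ ω ∂M.prob, ∀ k, M.rawLevel i 0 ω (k + 1) ≠ 0 := by
  refine ae_all_iff.2 fun k => ?_
  simp only [rawLevel_succ_eq]
  have hmq : Measurable fun q : (Fin n × ℝ) × Sample n => (q.1.1, (0 : ℝ) + M.c i * q.1.2, q.2) :=
    (measurable_fst.comp measurable_fst).prodMk
      ((measurable_const.add ((measurable_snd.comp measurable_fst).const_mul _)).prodMk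
        measurable_snd)
  refine M.ae_firstStep i (p := fun q ω => M.rawLevel q.1 (0 + M.c i * q.2) ω k ≠ 0)
    (((M.measurable_rawLevel k).comp hmq) (measurableSet_singleton (0 : ℝ)).compl) ?_
  filter_upwards [M.ae_stepLaw_add_ne_zero i (Or.inr hi.ne')] with q hq
  exact M.ae_rawLevel_ne_zero k q.1 hq

theorem ae_sample_pos (M : FluidModel n) : ∀ᵐ ω ∂M.prob, ∀ k l, 0 < (ω k l).2 := by
  refine ae_all_iff.2 fun k => ae_all_iff.2 fun l => ?_
  have h1 := (measurePreserving_eval (fun i => M.stepLaw i) l).quasiMeasurePreserving.ae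
    (M.ae_stepLaw_pos l)
  exact (measurePreserving_eval_infinitePi
    (fun _ : ℕ => Measure.pi fun i => M.stepLaw i) k).quasiMeasurePreserving.ae h1

theorem ae_hold_pos (M : FluidModel n) (i : Fin n) : ∀ᵐ ω ∂M.prob, ∀ k, 0 < hold i ω k := by
  filter_upwards [M.ae_sample_pos] with ω hω k
  exact hω k _

theorem hitTime_nonneg (M : FluidModel n) (k : ℕ) (i : Fin n) {x : ℝ} (hx : 0 ≤ x)
    {ω : Sample n} (hω : ∀ k l, 0 < (ω k l).2) : 0 ≤ M.hitTime k i x ω := by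
  induction k generalizing i x ω with
  | zero => exact le_rfl
  | succ k ih =>
    rw [hitTime]
    split_ifs with h
    · have hc : M.c i ≤ 0 := by
        by_contra hc
        have := mul_pos (not_le.1 hc) (hω 0 i)
        linarith
      exact div_nonneg hx (by linarith)
    · exact add_nonneg (hω 0 i).le (ih _ (not_lt.1 h) fun k l => hω (k + 1) l)

theorem ae_passTime_nonneg (M : FluidModel n) (i : Fin n) {x : ℝ} (hx : 0 ≤ x) (j : Fin n) :
    ∀ᵐ ω ∂M.prob, 0 ≤ M.passTime i x j ω := by
  filter_upwards [M.ae_sample_pos] with ω hω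
  rw [passTime]
  split_ifs
  · exact M.hitTime_nonneg _ i hx hω
  · exact le_rfl

/-! In the next lemmas the sample point is such that all holding times are positive. -/

theorem jumpTime_mono {i : Fin n} {ω : Sample n} (hpos : ∀ k, 0 < hold i ω k) :
    Monotone (jumpTime i ω) := by
  refine monotone_nat_of_le_succ fun k => ?_
  rw [jumpTime, jumpTime, Finset.sum_range_succ]
  linarith [hpos k]

theorem jumpTime_succ (i : Fin n) (ω : Sample n) (k : ℕ) :
    jumpTime i ω (k + 1) = jumpTime i ω k + hold i ω k :=
  Finset.sum_range_succ _ _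

theorem jumpCount_eq {i : Fin n} {ω : Sample n} (hpos : ∀ k, 0 < hold i ω k) {t : ℝ} {k : ℕ}
    (h1 : jumpTime i ω k ≤ t) (h2 : t < jumpTime i ω (k + 1)) : jumpCount i ω t = k := by
  refine le_antisymm (Nat.sInf_le h2) ?_
  by_contra h
  have hmem := Nat.sInf_mem (s := {k | t < jumpTime i ω (k + 1)}) ⟨k, h2⟩
  have : jumpTime i ω (jumpCount i ω t + 1) ≤ jumpTime i ω k := jumpTime_mono hpos (by omega)
  exact absurd (lt_of_lt_of_le hmem (this.trans h1)) (lt_irrefl t)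

theorem levelAtJump_eq_rawLevel (M : FluidModel n) {i : Fin n} {ω : Sample n} {m : ℕ}
    (hm : ∀ l < m, 0 ≤ M.rawLevel i 0 ω (l + 1)) {k : ℕ} (hk : k ≤ m) :
    M.levelAtJump i 0 ω k = M.rawLevel i 0 ω k := by
  induction k with
  | zero => rfl
  | succ k ih =>
    rw [levelAtJump, ih (by omega)]
    exact max_eq_right (hm k (by omega))

/-- Let the unstopped level be positive at the jumps up to the beginning of the sojourn `m`. Then the
level is positive at a time `t` in an earlier sojourn, and at a time `t` in the sojourn `m` as long
as the unstopped level is still positive. -/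
theorem level_pos (M : FluidModel n) {i : Fin n} (hi : 0 < M.c i) {ω : Sample n}
    {m : ℕ} (hm : ∀ l < m, 0 < M.rawLevel i 0 ω (l + 1)) {t : ℝ} (ht : 0 < t)
    (hlt : ∀ k, k = jumpCount i ω t → jumpTime i ω k ≤ t → t < jumpTime i ω (k + 1) →
      k < m ∨ (k = m ∧ 0 < M.rawLevel i 0 ω m + M.c (chain i ω m) * (t - jumpTime i ω m))) :
    0 < M.level i 0 ω t := by
  rw [level, phase]
  refine lt_max_of_lt_right ?_
  by_cases hne : ∃ k, t < jumpTime i ω (k + 1)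
  · have hmem : t < jumpTime i ω (jumpCount i ω t + 1) :=
      Nat.sInf_mem (s := {k | t < jumpTime i ω (k + 1)}) hne
    have hle : jumpTime i ω (jumpCount i ω t) ≤ t := by
      rcases Nat.eq_zero_or_pos (jumpCount i ω t) with h0 | h0
      · rw [h0]
        simpa [jumpTime] using ht.le
      · have := Nat.notMem_of_lt_sInf (s := {k | t < jumpTime i ω (k + 1)})
          (m := jumpCount i ω t - 1) (Nat.sub_lt h0 one_pos)
        rw [Set.mem_ofPred_eq, not_lt, Nat.sub_one_add_one h0.ne'] at this
        exact this
    generalize hk : jumpCount i ω t = k at hmem hle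
    rcases hlt k hk.symm hle hmem with h | ⟨rfl, h⟩
    · rw [M.levelAtJump_eq_rawLevel (m := m) (fun l hl => (hm l hl).le) h.le]
      rcases lt_or_ge (M.c (chain i ω k)) 0 with hc | hc
      · -- a decreasing level stays above its value at the end of the sojourn
        have h1 := hm k h
        rw [rawLevel] at h1
        rw [jumpTime_succ] at hmem
        nlinarith
      · cases k with
        | zero =>
          simp only [chain, jumpTime, Finset.range_zero, Finset.sum_empty, sub_zero, rawLevel,
            zero_add]
          exact mul_pos hi ht
        | succ k =>
          have h1 := hm k (by omega)
          have := mul_nonneg hc (sub_nonneg.2 hle)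
          linarith
    · rw [M.levelAtJump_eq_rawLevel (m := k) (fun l hl => (hm l hl).le) le_rfl]
      exact h
  · -- an exploding path has `jumpCount = 0` after the explosion
    have h0 : jumpCount i ω t = 0 := by
      rw [jumpCount, Set.eq_empty_of_forall_notMem (s := {k | t < jumpTime i ω (k + 1)})
        (fun k hk => hne ⟨k, hk⟩), Nat.sInf_empty]
    rw [h0]
    simp only [levelAtJump, chain, jumpTime, Finset.range_zero, Finset.sum_empty, sub_zero,
      zero_add]
    exact mul_pos hi ht

open Classical in
/-- The transform in the definition of `Ψ(s)` is the one given by first-step analysis. Almost surely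
the unstopped level is nonzero at the jumps, and then the return time is the time at which it
becomes negative. -/
theorem psiENN_eq_F (M : FluidModel n) (hT : ∀ i, M.T i i ≠ 0) (s : ℝ) (i : M.Up) (j : M.Down) :
    M.psiENN s i j = M.F s i.1 0 j.1 := by
  rw [psiENN, M.F_eq_lintegral hT s _ le_rfl, ← lintegral_indicator (M.measurableSet_hitSet _ _ _)]
  refine lintegral_congr_ae ?_
  filter_upwards [M.ae_hold_pos i.1, M.ae_rawLevel_succ_ne_zero i.1 i.2] with ω hpos hne
  obtain ⟨i, hi⟩ := i
  by_cases hex : ∃ m, M.rawLevel i 0 ω (m + 1) < 0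
  · set m := Nat.find hex with hmdef
    have hneg : M.rawLevel i 0 ω (m + 1) < 0 := Nat.find_spec hex
    -- `m` is the sojourn in which the level returns to zero, at the time `τ`
    have hbefore : ∀ l < m, 0 < M.rawLevel i 0 ω (l + 1) := fun l hl =>
      lt_of_le_of_ne (not_lt.1 (Nat.find_min hex hl)) (hne l).symm
    have hbefore' : ∀ l < m, 0 ≤ M.rawLevel i 0 ω (l + 1) := fun l hl => (hbefore l hl).le
    have hm0 : 0 < M.rawLevel i 0 ω m := by
      rcases Nat.eq_zero_or_pos m with h0 | h0
      · rw [h0] at hneg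
        have h1 : M.rawLevel i 0 ω (0 + 1) = 0 + M.c i * hold i ω 0 := rfl
        rw [h1] at hneg
        have := mul_pos hi (hpos 0)
        linarith
      · have := hbefore (m - 1) (Nat.sub_lt h0 one_pos)
        rwa [Nat.sub_one_add_one h0.ne'] at this
    have hc : M.c (chain i ω m) < 0 := by
      rw [rawLevel] at hneg
      by_contra h
      have := mul_nonneg (not_lt.1 h) (hpos m).le
      linarith
    set τ := jumpTime i ω m + M.rawLevel i 0 ω m / -M.c (chain i ω m) with hτ
    have hq : 0 < M.rawLevel i 0 ω m / -M.c (chain i ω m) := div_pos hm0 (neg_pos.2 hc)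
    have hτ1 : jumpTime i ω m ≤ τ := by linarith
    have hτ2 : τ < jumpTime i ω (m + 1) := by
      rw [hτ, jumpTime_succ]
      rw [rawLevel] at hneg
      have : M.rawLevel i 0 ω m / -M.c (chain i ω m) < hold i ω m := by
        rw [div_lt_iff₀ (neg_pos.2 hc)]
        linarith
      linarith
    have hJ : 0 ≤ jumpTime i ω m := by
      have := jumpTime_mono hpos (Nat.zero_le m)
      simpa [jumpTime] using this
    have hcount : jumpCount i ω τ = m := jumpCount_eq hpos hτ1 hτ2
    have hmul : M.c (chain i ω m) * (M.rawLevel i 0 ω m / -M.c (chain i ω m))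
        = -M.rawLevel i 0 ω m := by
      rw [div_neg, mul_neg, mul_div_cancel₀ _ hc.ne]
    have hleast : IsLeast (M.zeroTimes i ω) τ := by
      refine ⟨⟨by linarith, ?_⟩, fun t ht => ?_⟩
      · rw [level, phase, hcount, M.levelAtJump_eq_rawLevel hbefore' le_rfl]
        have : τ - jumpTime i ω m = M.rawLevel i 0 ω m / -M.c (chain i ω m) := by
          rw [hτ]
          ring
        rw [this, hmul, add_neg_cancel, max_self]
      · by_contra hlt
        rw [not_le] at hlt
        refine absurd ht.2 (M.level_pos hi hbefore ht.1 fun k _ hk1 _ => ?_).ne'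
        rcases lt_trichotomy k m with h | h | h
        · exact Or.inl h
        · refine Or.inr ⟨h, ?_⟩
          have h2 : t - jumpTime i ω m < M.rawLevel i 0 ω m / -M.c (chain i ω m) := by linarith
          have h3 := mul_lt_mul_of_neg_left h2 hc
          linarith
        · have : jumpTime i ω (m + 1) ≤ jumpTime i ω k := jumpTime_mono hpos h
          linarith
    have hret : M.returnTime i ω = τ := hleast.csInf_eq
    have hph : phase i ω (M.returnTime i ω) = chain i ω m := by rw [hret, phase, hcount]
    by_cases hj : chain i ω m = j.1
    · have hh : M.hits (m + 1) i 0 j.1 ω :=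
        (M.hits_iff _ _ _ _ _).2 ⟨m, Nat.lt_succ_self m, hbefore', hneg, hj⟩
      rw [if_pos ⟨⟨τ, hleast.1⟩, hph.trans hj⟩, Set.indicator_of_mem (show ω ∈ M.hitSet i 0 j.1 from
        ⟨_, hh⟩), M.passTime_eq hh, M.hitTime_eq (Nat.lt_succ_self m) hbefore' hneg, hret]
    · rw [if_neg (fun h => hj (hph.symm.trans h.2)), Set.indicator_of_notMem]
      rintro ⟨k, hk⟩
      obtain ⟨m', _, hm', hneg', hj'⟩ := (M.hits_iff _ _ _ _ _).1 hk
      rcases lt_trichotomy m m' with h | h | h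
      · exact absurd (hm' m h) (not_le.2 hneg)
      · exact hj (h ▸ hj')
      · exact absurd (hbefore' m' h) (not_le.2 hneg')
  · have hbefore : ∀ l, 0 < M.rawLevel i 0 ω (l + 1) := fun l =>
      lt_of_le_of_ne (not_lt.1 fun h => hex ⟨l, h⟩) (hne l).symm
    rw [if_neg, Set.indicator_of_notMem]
    · rintro ⟨k, hk⟩
      obtain ⟨m, _, _, hneg, _⟩ := (M.hits_iff _ _ _ _ _).1 hk
      exact hex ⟨m, hneg⟩
    · rintro ⟨⟨t, ht⟩, _⟩
      refine absurd ht.2 (M.level_pos (m := jumpCount i ω t + 1) hi (fun l _ => hbefore l)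
        ht.1 fun k hk _ _ => Or.inl ?_).ne'
      omega

end FluidModel

namespace FluidModel
variable {n : ℕ}
open MeasureTheory

/-! ### First-step analysis of the first passage -/

theorem staySet_of_nonneg (M : FluidModel n) {i : Fin n} (hc : 0 ≤ M.c i) {x : ℝ} (hx : 0 ≤ x) :
    M.staySet i x = Set.Ioi 0 := by
  ext t
  exact ⟨fun h => h.1, fun h => ⟨h, add_nonneg hx (mul_nonneg hc (Set.mem_Ioi.1 h).le)⟩⟩

theorem staySet_of_neg (M : FluidModel n) {i : Fin n} (hc : M.c i < 0) (x : ℝ) :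
    M.staySet i x = Set.Ioc 0 (x / -M.c i) := by
  ext t
  simp only [staySet, Set.mem_ofPred_eq, Set.mem_Ioc, le_div_iff₀ (neg_pos.2 hc)]
  constructor <;> rintro ⟨h1, h2⟩ <;> exact ⟨h1, by linarith⟩

theorem measurable_passStep (M : FluidModel n) (s : ℝ) {f : Fin n → ℝ → Fin n → ℝ≥0∞}
    (hf : ∀ i j, Measurable fun x => f i x j) (i j : Fin n) :
    Measurable fun x => M.passStep s f i x j := by
  refine Measurable.add (Measurable.ite (by simp) (by fun_prop) measurable_const) ?_
  have hset : MeasurableSet {p : ℝ × ℝ | 0 < p.2 ∧ 0 ≤ p.1 + M.c i * p.2} :=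
    (measurableSet_lt measurable_const measurable_snd).inter
      (measurableSet_le measurable_const (measurable_fst.add (measurable_snd.const_mul _)))
  have hm : Measurable fun p : ℝ × ℝ => ENNReal.ofReal (Real.exp ((M.T i i - s) * p.2)) *
      ∑ l, ENNReal.ofReal (M.rate i l) * f l (p.1 + M.c i * p.2) j := by
    refine Measurable.mul (by fun_prop) (Finset.measurable_sum _ fun l _ =>
      Measurable.const_mul ((hf l j).comp (g := fun x => f l x j)
        (measurable_fst.add (measurable_snd.const_mul _))) _)
  have h := (hm.indicator hset).lintegral_prod_right' (ν := volume)
  simp only [← lintegral_indicator (M.measurableSet_staySet i _)]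
  exact h

theorem measurable_FK (M : FluidModel n) (s : ℝ) (k : ℕ) (i j : Fin n) :
    Measurable fun x => M.FK s k i x j := by
  induction k generalizing i j with
  | zero => exact measurable_const
  | succ k ih => exact M.measurable_passStep s ih i j

theorem measurable_F (M : FluidModel n) (s : ℝ) (i j : Fin n) :
    Measurable fun x => M.F s i x j :=
  Measurable.iSup fun k => M.measurable_FK s k i j

theorem passStep_mono (M : FluidModel n) (s : ℝ) {f g : Fin n → ℝ → Fin n → ℝ≥0∞}
    (h : ∀ i x j, f i x j ≤ g i x j) (i : Fin n) (x : ℝ) (j : Fin n) :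
    M.passStep s f i x j ≤ M.passStep s g i x j := by
  refine add_le_add le_rfl (lintegral_mono fun t => ?_)
  exact mul_le_mul_right (Finset.sum_le_sum fun l _ => mul_le_mul_right (h _ _ _) _) _

theorem FK_le_succ (M : FluidModel n) (s : ℝ) (k : ℕ) (i : Fin n) (x : ℝ) (j : Fin n) :
    M.FK s k i x j ≤ M.FK s (k + 1) i x j := by
  induction k generalizing i x j with
  | zero => exact zero_le
  | succ k ih => exact M.passStep_mono s ih i x j

theorem FK_mono (M : FluidModel n) (s : ℝ) (i : Fin n) (x : ℝ) (j : Fin n) :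
    Monotone fun k => M.FK s k i x j :=
  monotone_nat_of_le_succ fun k => M.FK_le_succ s k i x j

theorem FK_le_F (M : FluidModel n) (s : ℝ) (k : ℕ) (i : Fin n) (x : ℝ) (j : Fin n) :
    M.FK s k i x j ≤ M.F s i x j :=
  le_iSup (fun k => M.FK s k i x j) k

theorem measurable_sum_rate (M : FluidModel n) {f : Fin n → ℝ → Fin n → ℝ≥0∞}
    (hf : ∀ i j, Measurable fun x => f i x j) (s : ℝ) (i j : Fin n) (x : ℝ) :
    Measurable fun t => ENNReal.ofReal (Real.exp ((M.T i i - s) * t)) *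
      ∑ l, ENNReal.ofReal (M.rate i l) * f l (x + M.c i * t) j :=
  Measurable.mul (by fun_prop) (Finset.measurable_sum _ fun l _ =>
      Measurable.const_mul ((hf l j).comp (g := fun x => f l x j)
        (measurable_const.add (measurable_id.const_mul _))) _)

/-- The equation of first-step analysis. -/
theorem F_eq_passStep (M : FluidModel n) (s : ℝ) (i : Fin n) (x : ℝ) (j : Fin n) :
    M.F s i x j = M.passStep s (M.F s) i x j := by
  have h1 : M.F s i x j = ⨆ k, M.FK s (k + 1) i x j :=
    (Monotone.iSup_nat_add (M.FK_mono s i x j) 1).symm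
  rw [h1]
  simp only [FK, passStep]
  rw [← ENNReal.add_iSup, ← lintegral_iSup]
  · congr 1
    refine lintegral_congr fun t => ?_
    rw [← ENNReal.mul_iSup]
    congr 1
    simp only [F, ENNReal.mul_iSup]
    exact (ENNReal.finsetSum_iSup_of_monotone
      (f := fun l k => ENNReal.ofReal (M.rate i l) * M.FK s k l (x + M.c i * t) j)
      fun l k m hkm => mul_le_mul_right (M.FK_mono s _ _ _ hkm) _).symm
  · exact fun k => M.measurable_sum_rate (M.measurable_FK s k) s i j x
  · intro k m hkm t
    exact mul_le_mul_right (Finset.sum_le_sum fun l _ =>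
      mul_le_mul_right (M.FK_mono s _ _ _ hkm) _) _

/-- First-step analysis up to a fixed time: a sojourn longer than `N` starts anew at time `N`, since
the holding times are memoryless. -/
theorem passStep_eq_add (M : FluidModel n) (s : ℝ) (f : Fin n → ℝ → Fin n → ℝ≥0∞)
    (i j : Fin n) {x N : ℝ} (hx : 0 ≤ x) (hN : 0 ≤ N) (h : 0 ≤ x + M.c i * N) :
    M.passStep s f i x j = (∫⁻ t in Set.Ioc 0 N, ENNReal.ofReal (Real.exp ((M.T i i - s) * t)) *
        ∑ l, ENNReal.ofReal (M.rate i l) * f l (x + M.c i * t) j) +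
      ENNReal.ofReal (Real.exp ((M.T i i - s) * N)) * M.passStep s f i (x + M.c i * N) j := by
  have hset : M.staySet i x = Set.Ioc 0 N ∪ (fun t => t - N) ⁻¹' M.staySet i (x + M.c i * N) := by
    ext t
    simp only [staySet, Set.mem_ofPred_eq, Set.mem_union, Set.mem_Ioc, Set.mem_preimage]
    have e : x + M.c i * N + M.c i * (t - N) = x + M.c i * t := by ring
    rw [e]
    constructor
    · rintro ⟨h1, h2⟩
      rcases le_or_gt t N with h3 | h3
      · exact Or.inl ⟨h1, h3⟩
      · exact Or.inr ⟨by linarith, h2⟩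
    · rintro (⟨h1, h2⟩ | ⟨h1, h2⟩)
      · refine ⟨h1, ?_⟩
        rcases le_or_gt 0 (M.c i) with hc | hc
        · exact add_nonneg hx (mul_nonneg hc h1.le)
        · nlinarith
      · exact ⟨by linarith, h2⟩
  have hms : MeasurableSet ((fun t : ℝ => t - N) ⁻¹' M.staySet i (x + M.c i * N)) :=
    (measurable_id.sub_const N) (M.measurableSet_staySet i _)
  have hdisj : Disjoint (Set.Ioc 0 N) ((fun t : ℝ => t - N) ⁻¹' M.staySet i (x + M.c i * N)) :=
    Set.disjoint_left.2 fun t h1 h2 => by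
      have := h2.1
      have := h1.2
      linarith
  have hshift : ∀ g : ℝ → ℝ≥0∞,
      ∫⁻ t in (fun t : ℝ => t - N) ⁻¹' M.staySet i (x + M.c i * N), g t
        = ∫⁻ u in M.staySet i (x + M.c i * N), g (u + N) := by
    intro g
    have := (measurePreserving_sub_right volume N).setLIntegral_comp_preimage_emb
      (measurableEmbedding_subRight N) (fun u => g (u + N)) (M.staySet i (x + M.c i * N))
    simpa using this
  rw [passStep, hset, lintegral_union hms hdisj, hshift, passStep, mul_add, ← add_assoc,
    add_comm (ite _ _ _), add_assoc]
  congr 2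
  · split_ifs with h1
    · rw [← ENNReal.ofReal_mul (Real.exp_pos _).le, ← Real.exp_add]
      congr 2
      have := h1.1.ne
      field_simp
      ring
    · simp
  · rw [← lintegral_const_mul' _ _ ENNReal.ofReal_ne_top]
    refine lintegral_congr fun u => ?_
    have e : x + M.c i * (u + N) = x + M.c i * N + M.c i * u := by ring
    rw [← mul_assoc, ← ENNReal.ofReal_mul (Real.exp_pos _).le, ← Real.exp_add, e]
    congr 3
    ring_nf

/-- First-step analysis up to the passage of level `y` for the level started from `x + y`. -/
theorem passStep_add (M : FluidModel n) (s : ℝ) (f : Fin n → ℝ → Fin n → ℝ≥0∞)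
    (i j : Fin n) {x y : ℝ} (hx : 0 ≤ x) (hy : 0 ≤ y) :
    M.passStep s f i (x + y) j = (if M.c i < 0 then
        ENNReal.ofReal (Real.exp ((M.T i i - s) * (x / -M.c i))) * M.passStep s f i y j else 0) +
      ∫⁻ t in M.staySet i x, ENNReal.ofReal (Real.exp ((M.T i i - s) * t)) *
        ∑ l, ENNReal.ofReal (M.rate i l) * f l (x + M.c i * t + y) j := by
  have e : ∀ t, x + y + M.c i * t = x + M.c i * t + y := fun t => by ring
  split_ifs with hc
  · have h1 : x + y + M.c i * (x / -M.c i) = y := by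
      have := hc.ne
      field_simp
      ring
    rw [M.passStep_eq_add s f i j (N := x / -M.c i) (add_nonneg hx hy)
      (div_nonneg hx (by linarith)) (by rw [h1]; exact hy), h1, M.staySet_of_neg hc, add_comm]
    simp only [e]
  · rw [passStep, M.staySet_of_nonneg (not_lt.1 hc) (add_nonneg hx hy),
      M.staySet_of_nonneg (not_lt.1 hc) hx, if_neg fun h => hc h.1]
    simp only [e]

theorem sum_passStep_mul (M : FluidModel n) (s : ℝ) {f : Fin n → ℝ → Fin n → ℝ≥0∞}
    (hf : ∀ i j, Measurable fun x => f i x j) (i : Fin n) (x : ℝ) (h : Fin n → ℝ≥0∞) :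
    ∑ r, M.passStep s f i x r * h r = (if M.c i < 0 then
        ENNReal.ofReal (Real.exp ((M.T i i - s) * (x / -M.c i))) * h i else 0) +
      ∫⁻ t in M.staySet i x, ENNReal.ofReal (Real.exp ((M.T i i - s) * t)) *
        ∑ l, ENNReal.ofReal (M.rate i l) * ∑ r, f l (x + M.c i * t) r * h r := by
  simp only [passStep, add_mul]
  rw [Finset.sum_add_distrib]
  congr 1
  · by_cases hc : M.c i < 0 <;> simp [hc]
  · simp only [← fun r => lintegral_mul_const (μ := volume.restrict (M.staySet i x)) (h r)
      (M.measurable_sum_rate hf s i r x)]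
    rw [← lintegral_finsetSum]
    · refine lintegral_congr fun t => ?_
      simp only [Finset.mul_sum, Finset.sum_mul]
      rw [Finset.sum_comm]
      simp only [mul_assoc]
    · intro r _
      exact (M.measurable_sum_rate hf s i r x).mul_const _

/-- To fall from `x + y` to zero, the level has to fall to `y` and then to zero. Thus the matrices
of the `F s k x j` form a semigroup in `x`. Either inequality is proved by induction on the number
of sojourns that are taken into account for the fall from `x + y` or from `x`. -/
theorem F_add (M : FluidModel n) (s : ℝ) (i j : Fin n) {x y : ℝ} (hx : 0 ≤ x) (hy : 0 ≤ y) :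
    M.F s i (x + y) j = ∑ r, M.F s i x r * M.F s r y j := by
  refine le_antisymm (iSup_le fun k => ?_) ?_
  · induction k generalizing i x with
    | zero => exact zero_le
    | succ k ih =>
      rw [FK, M.passStep_add s _ i j hx hy]
      simp only [M.F_eq_passStep s i x]
      rw [M.sum_passStep_mul s (M.measurable_F s)]
      refine add_le_add ?_ (setLIntegral_mono' (M.measurableSet_staySet i x) fun t ht => ?_)
      · split_ifs
        · exact mul_le_mul_right (M.FK_le_F s (k + 1) i y j) _
        · exact le_rfl
      · exact mul_le_mul_right (Finset.sum_le_sum fun l _ => mul_le_mul_right (ih l ht.2) _) _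
  · simp only [F.eq_1 M s i x, ENNReal.iSup_mul]
    rw [ENNReal.finsetSum_iSup_of_monotone (f := fun r k => M.FK s k i x r * M.F s r y j)
      fun r k m hkm => mul_le_mul_left (M.FK_mono s i x r hkm) _]
    refine iSup_le fun k => ?_
    induction k generalizing i x with
    | zero => simp [FK]
    | succ k ih =>
      rw [M.F_eq_passStep, M.passStep_add s _ i j hx hy, FK,
        M.sum_passStep_mul s (M.measurable_FK s k), ← M.F_eq_passStep]
      refine add_le_add le_rfl (setLIntegral_mono' (M.measurableSet_staySet i x) fun t ht => ?_)
      exact mul_le_mul_right (Finset.sum_le_sum fun l _ => mul_le_mul_right (ih l ht.2) _) _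

theorem F_zero_of_neg (M : FluidModel n) (s : ℝ) {i : Fin n} (hi : M.c i < 0) (j : Fin n) :
    M.F s i 0 j = if i = j then 1 else 0 := by
  rw [F_eq_passStep, passStep, M.staySet_of_neg hi]
  simp [hi]

/-- A passage happens in a phase of negative rate. -/
theorem F_of_nonneg (M : FluidModel n) (s : ℝ) (i : Fin n) (x : ℝ) {j : Fin n} (hj : 0 ≤ M.c j) :
    M.F s i x j = 0 := by
  refine le_antisymm (iSup_le fun k => ?_) zero_le
  induction k generalizing i x with
  | zero => exact le_rfl
  | succ k ih =>
    have h : ∀ l y, M.FK s k l y j = 0 := fun l y => le_antisymm (ih l y) zero_le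
    rw [FK, passStep, if_neg]
    · simp [h]
    · rintro ⟨h1, rfl⟩
      exact absurd h1 (not_lt.2 hj)

/-- A lower bound for `F` by the paths that jump from `i` to `l` first. -/
theorem lintegral_le_F (M : FluidModel n) (s : ℝ) (i l : Fin n) (x : ℝ) (j : Fin n) :
    ∫⁻ t in M.staySet i x, ENNReal.ofReal (Real.exp ((M.T i i - s) * t)) *
      (ENNReal.ofReal (M.rate i l) * M.F s l (x + M.c i * t) j) ≤ M.F s i x j := by
  rw [M.F_eq_passStep s i x j, passStep]
  refine le_add_left (lintegral_mono fun t => mul_le_mul_right ?_ _)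
  exact Finset.single_le_sum (f := fun l => ENNReal.ofReal (M.rate i l) *
    M.F s l (x + M.c i * t) j) (fun _ _ => zero_le) (Finset.mem_univ l)

theorem exists_Ioo_of_ae {S : Set ℝ} {a b : ℝ} (hab : a < b) (hS : Set.Ioo a b ⊆ S)
    {p : ℝ → Prop} (h : ∀ᵐ t ∂volume.restrict S, p t) : ∃ t ∈ Set.Ioo a b, p t := by
  have h1 : ∀ᵐ t ∂volume.restrict (Set.Ioo a b), p t := ae_restrict_of_ae_restrict_of_subset hS h
  rw [ae_restrict_iff' measurableSet_Ioo] at h1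
  by_contra hc
  push Not at hc
  have h2 : ∀ᵐ t ∂(volume : Measure ℝ), t ∉ Set.Ioo a b := by
    filter_upwards [h1] with t ht hmem
    exact hc t hmem (ht hmem)
  have h3 : volume (Set.Ioo a b) = 0 := by
    have := measure_eq_zero_iff_ae_notMem.2 h2
    exact this
  rw [Real.volume_Ioo, ENNReal.ofReal_eq_zero] at h3
  linarith

/-- A short sojourn neither ends the first passage nor changes the level much. -/
theorem exists_short (M : FluidModel n) (i : Fin n) {x y : ℝ} (hy : 0 ≤ y) (hxy : y < x) :
    ∃ δ > 0, Set.Ioo 0 δ ⊆ M.staySet i x ∧ ∀ t ∈ Set.Ioo 0 δ, y < x + M.c i * t := by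
  have hc : 0 < |M.c i| + 1 := by positivity
  have key : ∀ t ∈ Set.Ioo 0 ((x - y) / (|M.c i| + 1)), y < x + M.c i * t := by
    rintro t ⟨h1, h2⟩
    rw [lt_div_iff₀ hc] at h2
    have := neg_abs_le (M.c i)
    nlinarith
  exact ⟨_, div_pos (sub_pos.2 hxy) hc, fun t ht => ⟨ht.1, (hy.trans_lt (key t ht)).le⟩, key⟩

theorem measurable_rate_mul_F (M : FluidModel n) (s : ℝ) (i l j : Fin n) (x : ℝ) :
    Measurable fun t => ENNReal.ofReal (Real.exp ((M.T i i - s) * t)) *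
      (ENNReal.ofReal (M.rate i l) * M.F s l (x + M.c i * t) j) :=
  Measurable.mul (by fun_prop) (Measurable.const_mul ((M.measurable_F s l j).comp
    (g := fun x => M.F s l x j) (measurable_const.add (measurable_id.const_mul _))) _)

/-- Positivity of `F` passes from a phase `l` to the phases `i` with a transition to `l`. -/
theorem F_pos_step (M : FluidModel n) (s : ℝ) {i l j : Fin n} (hil : 0 < M.rate i l) {x : ℝ}
    (hl : ∀ y, 0 < y → 0 < M.F s l y j) (hx : 0 < x ∨ (0 ≤ x ∧ 0 < M.c i)) :
    0 < M.F s i x j := by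
  obtain ⟨δ, hδ, hsub, hpos⟩ : ∃ δ > 0, Set.Ioo 0 δ ⊆ M.staySet i x ∧
      ∀ t ∈ Set.Ioo 0 δ, 0 < x + M.c i * t := by
    rcases hx with hx | ⟨hx, hc⟩
    · exact M.exists_short i le_rfl hx
    · have h : ∀ t ∈ Set.Ioo (0 : ℝ) 1, 0 < x + M.c i * t := fun t ht =>
        add_pos_of_nonneg_of_pos hx (mul_pos hc ht.1)
      exact ⟨1, one_pos, fun t ht => ⟨ht.1, (h t ht).le⟩, h⟩
  by_contra h0
  have h1 := M.lintegral_le_F s i l x j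
  rw [nonpos_iff_eq_zero.1 (not_lt.1 h0), nonpos_iff_eq_zero,
    lintegral_eq_zero_iff (M.measurable_rate_mul_F s i l j x)] at h1
  obtain ⟨t, ht, h2⟩ := exists_Ioo_of_ae hδ hsub h1
  have h3 := hl _ (hpos t ht)
  simp only [Pi.zero_apply, mul_eq_zero, ENNReal.ofReal_eq_zero] at h2
  rcases h2 with h2 | h2 | h2
  · exact absurd h2 (not_le.2 (Real.exp_pos _))
  · linarith
  · exact h3.ne' h2

/-- Almost every continuation of a first passage with finite transform has a finite transform. -/
theorem ae_F_lt_top (M : FluidModel n) (s : ℝ) {i l j : Fin n} (hil : 0 < M.rate i l) {x : ℝ}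
    (h : M.F s i x j < ∞) : ∀ᵐ t ∂volume.restrict (M.staySet i x),
      M.F s l (x + M.c i * t) j < ∞ := by
  have h1 := (M.lintegral_le_F s i l x j).trans_lt h
  filter_upwards [ae_lt_top (M.measurable_rate_mul_F s i l j x) h1.ne] with t ht
  by_contra hc
  rw [not_lt, top_le_iff] at hc
  rw [hc, ENNReal.mul_top (by simpa using hil), ENNReal.mul_top (by simpa using Real.exp_pos _)]
    at ht
  exact lt_irrefl _ ht

theorem Irreducible.induction_head {M : FluidModel n} (hirr : M.Irreducible) {p : Fin n → Prop}
    {j : Fin n} (hj : p j) (hstep : ∀ k l, k ≠ l → 0 < M.T k l → p l → p k) (i : Fin n) : p i :=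
  Relation.ReflTransGen.head_induction_on (hirr i j) hj fun {k l} h _ hl => hstep k l h.1 h.2 hl

theorem Irreducible.induction_tail {M : FluidModel n} (hirr : M.Irreducible) {p : Fin n → Prop}
    {i : Fin n} (hi : p i) (hstep : ∀ k l, k ≠ l → 0 < M.T k l → p k → p l) (j : Fin n) : p j := by
  have h := hirr i j
  induction h with
  | refl => exact hi
  | tail _ h ih => exact hstep _ _ h.1 h.2 ih

theorem Irreducible.exists_rate_pos {M : FluidModel n} (hirr : M.Irreducible) {i j : Fin n}
    (hij : i ≠ j) : ∃ l, i ≠ l ∧ 0 < M.T i l := by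
  obtain h | ⟨l, h, _⟩ := (hirr i j).cases_head
  · exact absurd h hij
  · exact ⟨l, h⟩

theorem rate_pos (M : FluidModel n) {i l : Fin n} (hne : i ≠ l) (h : 0 < M.T i l) :
    0 < M.rate i l := by
  rwa [M.rate_of_ne hne]

theorem Irreducible.diag_ne_zero {M : FluidModel n} (hirr : M.Irreducible) {i₀ j₀ : Fin n}
    (hne : i₀ ≠ j₀) (i : Fin n) : M.T i i ≠ 0 := by
  obtain ⟨j, hij⟩ : ∃ j, i ≠ j := by
    by_cases h : i = i₀
    · exact ⟨j₀, h ▸ hne⟩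
    · exact ⟨i₀, h⟩
  obtain ⟨l, hl, hpos⟩ := hirr.exists_rate_pos hij
  have h1 := M.diag_eq i
  have h2 : M.T i l ≤ ∑ j ∈ Finset.univ.erase i, M.T i j :=
    Finset.single_le_sum (f := fun j => M.T i j)
      (fun j hj => M.offDiag_nonneg i j (Finset.ne_of_mem_erase hj).symm)
      (Finset.mem_erase.2 ⟨hl.symm, Finset.mem_univ l⟩)
  intro h0
  linarith

/-- A lower bound for `F` by the paths without a jump. -/
theorem F_self_ge (M : FluidModel n) (s : ℝ) {j : Fin n} (hj : M.c j < 0) (x : ℝ) :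
    ENNReal.ofReal (Real.exp ((M.T j j - s) * (x / -M.c j))) ≤ M.F s j x j := by
  rw [F_eq_passStep, passStep, if_pos ⟨hj, rfl⟩]
  exact le_self_add

theorem F_pos_of_pos (M : FluidModel n) (hirr : M.Irreducible) (s : ℝ) (i : Fin n) {j : Fin n}
    (hj : M.c j < 0) {x : ℝ} (hx : 0 < x) : 0 < M.F s i x j := by
  revert x
  refine hirr.induction_head (p := fun i => ∀ {x : ℝ}, 0 < x → 0 < M.F s i x j) (j := j) ?_ ?_ i
  · intro x _
    exact lt_of_lt_of_le (by simpa using Real.exp_pos _) (M.F_self_ge s hj x)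
  · intro k l hkl hpos hl x hx
    exact M.F_pos_step s (M.rate_pos hkl hpos) (fun y hy => hl hy) (Or.inl hx)

theorem F_zero_pos_of_up (M : FluidModel n) (hirr : M.Irreducible) (s : ℝ) {i j : Fin n}
    (hi : 0 < M.c i) (hj : M.c j < 0) : 0 < M.F s i 0 j := by
  obtain ⟨l, hl, hpos⟩ := hirr.exists_rate_pos (i := i) (j := j) (by
    rintro rfl
    linarith)
  exact M.F_pos_step s (M.rate_pos hl hpos) (fun y hy => M.F_pos_of_pos hirr s l hj hy)
    (Or.inr ⟨le_rfl, hi⟩)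

/-- Finiteness of `F` for one level and one final phase yields finiteness for all lower levels and
all final phases. -/
theorem F_lt_top_of_lt (M : FluidModel n) (hirr : M.Irreducible) (s : ℝ) {l j : Fin n}
    (hj : M.c j < 0) {x y : ℝ} (hx : 0 ≤ x) (hxy : x < y) (h : M.F s l y j < ∞) (r : Fin n) :
    M.F s l x r < ∞ := by
  have e : y = x + (y - x) := by ring
  rw [e, M.F_add s l j hx (by linarith)] at h
  have h1 := (ENNReal.sum_lt_top.1 h) r (Finset.mem_univ r)
  rcases lt_or_ge (M.c r) 0 with hr | hr
  · by_contra hc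
    rw [not_lt, top_le_iff] at hc
    rw [hc, ENNReal.top_mul (M.F_pos_of_pos hirr s r hj (by linarith)).ne'] at h1
    exact lt_irrefl _ h1
  · rw [M.F_of_nonneg s l x hr]
    exact ENNReal.zero_lt_top

/-- Finiteness of `F` passes from a phase to those with a transition from it. -/
theorem F_lt_top_step (M : FluidModel n) (hirr : M.Irreducible) (s : ℝ) {j : Fin n}
    (hj : M.c j < 0) {i l : Fin n} (hil : 0 < M.rate i l)
    (h : ∀ x, 0 < x → M.F s i x j < ∞) {y : ℝ} (hy : 0 ≤ y) (r : Fin n) : M.F s l y r < ∞ := by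
  obtain ⟨δ, hδ, hsub, hlt⟩ := M.exists_short i hy (lt_add_one y)
  obtain ⟨t, ht, h1⟩ := exists_Ioo_of_ae hδ hsub
    (M.ae_F_lt_top s hil (h (y + 1) (by linarith)))
  exact M.F_lt_top_of_lt hirr s hj hy (hlt t ht) h1 r

/-- A single finite entry of `Ψ(s)` makes `F s` finite altogether. -/
theorem F_lt_top_of_entry (M : FluidModel n) (hirr : M.Irreducible) (s : ℝ) {i j : Fin n}
    (hi : 0 < M.c i) (hj : M.c j < 0) (h : M.F s i 0 j < ∞) (k : Fin n) {x : ℝ} (hx : 0 ≤ x)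
    (r : Fin n) : M.F s k x r < ∞ := by
  obtain ⟨l, hl, hpos⟩ := hirr.exists_rate_pos (i := i) (j := j) (by
    rintro rfl
    linarith)
  -- after a long sojourn in the phase `i` of positive rate the level is arbitrarily high
  have h0 : ∀ y, 0 ≤ y → ∀ r, M.F s l y r < ∞ := by
    intro y hy r
    have hsub : Set.Ioo (y / M.c i) (y / M.c i + 1) ⊆ M.staySet i 0 := by
      rw [M.staySet_of_nonneg hi.le le_rfl]
      exact fun t ht => (div_nonneg hy hi.le).trans_lt ht.1
    obtain ⟨t, ht, h1⟩ := exists_Ioo_of_ae (lt_add_one _) hsub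
      (M.ae_F_lt_top s (M.rate_pos hl hpos) h)
    refine M.F_lt_top_of_lt hirr s hj hy ?_ h1 r
    have h2 := (div_lt_iff₀ hi).1 ht.1
    linarith
  revert x r
  refine hirr.induction_tail (i := l) (p := fun k => ∀ {x : ℝ}, 0 ≤ x → ∀ r, M.F s k x r < ∞)
    (fun {x} hx r => h0 x hx r) ?_ k
  intro k m hkm hpos' hk x hx r
  exact M.F_lt_top_step hirr s hj (M.rate_pos hkm hpos') (fun x hx => hk hx.le j) hx r

/-- From every phase the level zero is passed with positive probability, also for the level that
starts from zero in a phase of rate zero. -/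
theorem exists_F_zero_pos (M : FluidModel n) (hirr : M.Irreducible) (s : ℝ) {j₀ : Fin n}
    (hj₀ : M.c j₀ < 0) (k : Fin n) : ∃ j, M.c j < 0 ∧ 0 < M.F s k 0 j := by
  refine hirr.induction_head (p := fun k => ∃ j, M.c j < 0 ∧ 0 < M.F s k 0 j) (j := j₀) ?_ ?_ k
  · refine ⟨j₀, hj₀, ?_⟩
    rw [M.F_zero_of_neg s hj₀, if_pos rfl]
    exact one_pos
  · rintro k l hkl hpos ⟨j, hj, hl⟩
    rcases lt_trichotomy (M.c k) 0 with hk | hk | hk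
    · refine ⟨k, hk, ?_⟩
      rw [M.F_zero_of_neg s hk, if_pos rfl]
      exact one_pos
    · refine ⟨j, hj, ?_⟩
      have h1 := M.lintegral_le_F s k l 0 j
      refine lt_of_lt_of_le ?_ h1
      simp only [hk, zero_mul, add_zero]
      rw [lintegral_mul_const _ (by fun_prop), M.staySet_of_nonneg hk.ge le_rfl]
      refine ENNReal.mul_pos ?_ (ENNReal.mul_pos (by simpa using M.rate_pos hkl hpos) hl.ne').ne'
      rw [← pos_iff_ne_zero, lintegral_pos_iff_support (by fun_prop)]
      have : (Function.support fun t => ENNReal.ofReal (Real.exp ((M.T k k - s) * t)))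
          = Set.univ := by
        ext t
        simpa using Real.exp_pos _
      rw [this]
      simp
    · exact ⟨j, hj, M.F_zero_pos_of_up hirr s hk hj⟩

end FluidModel

namespace FluidModel
variable {n : ℕ}
open MeasureTheory

/-! ### The matrix equation -/

/-- `F s` is finite on nonnegative levels. -/
def PassFinite (M : FluidModel n) (s : ℝ) : Prop :=
  ∀ k x, 0 ≤ x → ∀ j, M.F s k x j < ∞

/-- The transforms of the first passage from level zero, as a matrix over all pairs of phases. It
extends `Ψ(s)` by the identity in the rows of the phases with negative rate, and the columns of
the phases with nonnegative rate vanish. -/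
noncomputable def W (M : FluidModel n) (s : ℝ) : Matrix (Fin n) (Fin n) ℝ :=
  Matrix.of fun k j => (M.F s k 0 j).toReal

/-- The matrix `|C|⁻¹ (T - s I) A`, restricted to the rows of the phases with negative rate. For
`A = W s` it is the generator of the semigroup formed by the `F s r x j` for phases `r` and `j` of
negative rate; see `hasDerivWithinAt_F_of_neg`. -/
noncomputable def downGen (M : FluidModel n) (s : ℝ) (A : Matrix (Fin n) (Fin n) ℝ) :
    Matrix (Fin n) (Fin n) ℝ :=
  Matrix.of fun r j => if M.c r < 0 then ((M.T * A) r j - s * A r j) / -M.c r else 0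

/-- The left-hand side `(T - s I) A + C A (downGen A)` of the equation for `W s`, where
`C = diag (c i)`. Elimination of the phases of rate zero turns it into the Riccati equation for
`Ψ(s)`. -/
noncomputable def residual (M : FluidModel n) (s : ℝ) (A : Matrix (Fin n) (Fin n) ℝ)
    (k j : Fin n) : ℝ :=
  (M.T * A) k j - s * A k j + M.c k * (A * M.downGen s A) k j

theorem W_nonneg (M : FluidModel n) (s : ℝ) (k j : Fin n) : 0 ≤ M.W s k j :=
  ENNReal.toReal_nonneg

theorem W_of_neg (M : FluidModel n) (s : ℝ) {k : Fin n} (hk : M.c k < 0) (j : Fin n) :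
    M.W s k j = if k = j then 1 else 0 := by
  rw [W, Matrix.of_apply, M.F_zero_of_neg s hk]
  split_ifs <;> simp

theorem W_of_nonneg (M : FluidModel n) (s : ℝ) (k : Fin n) {j : Fin n} (hj : 0 ≤ M.c j) :
    M.W s k j = 0 := by
  rw [W, Matrix.of_apply, M.F_of_nonneg s k 0 hj, ENNReal.toReal_zero]

theorem T_mul_apply (M : FluidModel n) (A : Matrix (Fin n) (Fin n) ℝ) (k j : Fin n) :
    (M.T * A) k j = M.T k k * A k j + ∑ l, M.rate k l * A l j := by
  rw [Matrix.mul_apply, M.sum_T_mul k fun l => A l j]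

theorem residual_of_neg (M : FluidModel n) (s : ℝ) {A : Matrix (Fin n) (Fin n) ℝ} {k : Fin n}
    (hk : M.c k < 0) (hA : ∀ j, A k j = if k = j then 1 else 0) (j : Fin n) :
    M.residual s A k j = 0 := by
  have h1 : (A * M.downGen s A) k j = M.downGen s A k j := by
    rw [Matrix.mul_apply]
    simp [hA]
  have := hk.ne
  rw [residual, h1, downGen, Matrix.of_apply, if_pos hk]
  field_simp
  ring

/-- The total of the transforms after a jump from phase `k` at level `y`. -/
noncomputable def jumpSum (M : FluidModel n) (s : ℝ) (k j : Fin n) (y : ℝ) : ℝ :=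
  ∑ l, M.rate k l * (M.F s l y j).toReal

theorem measurable_jumpSum (M : FluidModel n) (s : ℝ) (k j : Fin n) :
    Measurable (M.jumpSum s k j) :=
  Finset.measurable_sum _ fun l _ =>
    (ENNReal.measurable_toReal.comp (M.measurable_F s l j)).const_mul _

theorem toReal_lintegral_jump (M : FluidModel n) {s : ℝ} (hs : M.PassFinite s) (k j : Fin n)
    {x N : ℝ} (hx : 0 ≤ x) (hN : 0 ≤ N) (h : 0 ≤ x + M.c k * N) :
    (∫⁻ t in Set.Ioc 0 N, ENNReal.ofReal (Real.exp ((M.T k k - s) * t)) *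
        ∑ l, ENNReal.ofReal (M.rate k l) * M.F s l (x + M.c k * t) j).toReal
      = ∫ t in (0 : ℝ)..N, Real.exp ((M.T k k - s) * t) * M.jumpSum s k j (x + M.c k * t) := by
  have hlt : ∀ t ∈ Set.Ioc 0 N, ∀ l, M.F s l (x + M.c k * t) j < ∞ := by
    rintro t ⟨h1, h2⟩ l
    refine hs l _ ?_ j
    rcases le_or_gt 0 (M.c k) with hc | hc
    · exact add_nonneg hx (mul_nonneg hc h1.le)
    · nlinarith
  rw [intervalIntegral.integral_of_le hN, ← integral_toReal
    (M.measurable_sum_rate (M.measurable_F s) s k j x).aemeasurable]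
  · refine setIntegral_congr_fun measurableSet_Ioc fun t ht => ?_
    rw [ENNReal.toReal_mul, ENNReal.toReal_ofReal (Real.exp_pos _).le, ENNReal.toReal_sum]
    · rw [jumpSum]
      simp only [ENNReal.toReal_mul, ENNReal.toReal_ofReal (M.rate_nonneg k _)]
    · intro l _
      exact ENNReal.mul_ne_top ENNReal.ofReal_ne_top (hlt t ht l).ne
  · filter_upwards [ae_restrict_mem measurableSet_Ioc] with t ht
    refine ENNReal.mul_lt_top ENNReal.ofReal_lt_top (ENNReal.sum_lt_top.2 fun l _ => ?_)
    exact ENNReal.mul_lt_top ENNReal.ofReal_lt_top (hlt t ht l)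

theorem toReal_F_eq (M : FluidModel n) {s : ℝ} (hs : M.PassFinite s) (k j : Fin n)
    {x N : ℝ} (hx : 0 ≤ x) (hN : 0 ≤ N) (h : 0 ≤ x + M.c k * N) :
    (M.F s k x j).toReal
      = (∫ t in (0 : ℝ)..N, Real.exp ((M.T k k - s) * t) * M.jumpSum s k j (x + M.c k * t))
        + Real.exp ((M.T k k - s) * N) * (M.F s k (x + M.c k * N) j).toReal := by
  have h1 := M.passStep_eq_add s (M.F s) k j hx hN h
  rw [← M.F_eq_passStep, ← M.F_eq_passStep] at h1
  have h2 := hs k x hx j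
  rw [h1] at h2 ⊢
  rw [ENNReal.toReal_add (ENNReal.add_lt_top.1 h2).1.ne (ENNReal.add_lt_top.1 h2).2.ne,
    M.toReal_lintegral_jump hs k j hx hN h, ENNReal.toReal_mul,
    ENNReal.toReal_ofReal (Real.exp_pos _).le]

theorem toReal_F_add (M : FluidModel n) {s : ℝ} (hs : M.PassFinite s) (k j : Fin n)
    {x y : ℝ} (hx : 0 ≤ x) (hy : 0 ≤ y) :
    (M.F s k (x + y) j).toReal = ∑ r, (M.F s k x r).toReal * (M.F s r y j).toReal := by
  rw [M.F_add s k j hx hy, ENNReal.toReal_sum]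
  · simp only [ENNReal.toReal_mul]
  · exact fun r _ => ENNReal.mul_ne_top (hs k x hx r).ne (hs r y hy j).ne

theorem toReal_F_eq_sum_W (M : FluidModel n) {s : ℝ} (hs : M.PassFinite s) (k j : Fin n)
    {y : ℝ} (hy : 0 ≤ y) :
    (M.F s k y j).toReal = ∑ r, M.W s k r * (M.F s r y j).toReal := by
  have := M.toReal_F_add hs k j le_rfl hy
  rwa [zero_add] at this

/-- `F s k y j` is bounded near `y = 0`: it is at most `F s k 1 j` divided by the
transform of a passage from `1 - y` in phase `j` without jumps. -/
theorem toReal_F_bounded (M : FluidModel n) {s : ℝ} (hs : M.PassFinite s) (k j : Fin n) :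
    ∃ B, ∀ y ∈ Set.Icc (0 : ℝ) 1, (M.F s k y j).toReal ≤ B := by
  rcases lt_or_ge (M.c j) 0 with hj | hj
  · set b := |M.T j j - s| / -M.c j with hb
    refine ⟨(M.F s k 1 j).toReal * Real.exp b, fun y hy => ?_⟩
    have h1 := M.toReal_F_add hs k j hy.1 (sub_nonneg.2 hy.2)
    rw [add_sub_cancel] at h1
    have h2 : Real.exp (-b) ≤ (M.F s j (1 - y) j).toReal := by
      have h3 := ENNReal.toReal_mono (hs j _ (sub_nonneg.2 hy.2) j).ne
        (M.F_self_ge s hj (1 - y))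
      rw [ENNReal.toReal_ofReal (Real.exp_pos _).le] at h3
      refine le_trans (Real.exp_le_exp.2 ?_) h3
      rw [hb, ← mul_div_assoc, ← neg_div]
      refine div_le_div_of_nonneg_right ?_ (neg_pos.2 hj).le
      have h4 := neg_abs_le (M.T j j - s)
      have h5 := abs_nonneg (M.T j j - s)
      nlinarith [hy.1, hy.2, le_abs_self (M.T j j - s)]
    have h3 : (M.F s k y j).toReal * (M.F s j (1 - y) j).toReal ≤ (M.F s k 1 j).toReal := by
      rw [h1]
      exact Finset.single_le_sum
        (f := fun r => (M.F s k y r).toReal * (M.F s r (1 - y) j).toReal)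
        (fun r _ => mul_nonneg ENNReal.toReal_nonneg ENNReal.toReal_nonneg) (Finset.mem_univ j)
    have h4 : (M.F s k y j).toReal * Real.exp (-b) ≤ (M.F s k 1 j).toReal :=
      (mul_le_mul_of_nonneg_left h2 ENNReal.toReal_nonneg).trans h3
    have h5 : Real.exp (-b) * Real.exp b = 1 := by rw [← Real.exp_add]; simp
    calc (M.F s k y j).toReal = (M.F s k y j).toReal * Real.exp (-b) * Real.exp b := by
          rw [mul_assoc, h5, mul_one]
      _ ≤ _ := mul_le_mul_of_nonneg_right h4 (Real.exp_pos b).le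
  · exact ⟨0, fun y _ => by rw [M.F_of_nonneg s k y hj]; simp⟩

theorem jumpSum_bounded (M : FluidModel n) {s : ℝ} (hs : M.PassFinite s) (k j : Fin n) :
    ∃ B, ∀ y ∈ Set.Icc (0 : ℝ) 1, |M.jumpSum s k j y| ≤ B := by
  choose B hB using fun l => M.toReal_F_bounded hs l j
  refine ⟨∑ l, M.rate k l * B l, fun y hy => ?_⟩
  rw [jumpSum, abs_of_nonneg (Finset.sum_nonneg fun l _ => mul_nonneg (M.rate_nonneg k l)
    ENNReal.toReal_nonneg)]
  exact Finset.sum_le_sum fun l _ => mul_le_mul_of_nonneg_left (hB l y hy) (M.rate_nonneg k l)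

/-- In a phase of negative rate, the passage from a level `-c N` as a function of `N`. -/
theorem toReal_F_of_neg (M : FluidModel n) {s : ℝ} (hs : M.PassFinite s) {r : Fin n}
    (hr : M.c r < 0) (j : Fin n) {N : ℝ} (hN : 0 ≤ N) :
    (M.F s r (-M.c r * N) j).toReal = Real.exp ((M.T r r - s) * N) * ((if r = j then 1 else 0) +
      ∫ t in (0 : ℝ)..N, Real.exp (-(M.T r r - s) * t) * M.jumpSum s r j (-M.c r * t)) := by
  have h0 : -M.c r * N + M.c r * N = 0 := by ring
  rw [M.toReal_F_eq hs r j (mul_nonneg (by linarith) hN) hN h0.ge, h0, M.F_zero_of_neg s hr]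
  have h1 := intervalIntegral.integral_comp_sub_left (a := 0) (b := N)
    (fun u => Real.exp ((M.T r r - s) * (N - u)) * M.jumpSum s r j (-M.c r * u)) N
  rw [sub_self, sub_zero] at h1
  have h2 : ∀ t, -M.c r * (N - t) = -M.c r * N + M.c r * t := fun t => by ring
  simp only [sub_sub_cancel, h2] at h1
  rw [h1, mul_add, ← intervalIntegral.integral_const_mul, add_comm]
  congr 1
  · split_ifs <;> simp
  · refine intervalIntegral.integral_congr fun t _ => ?_
    rw [← mul_assoc, ← Real.exp_add]
    congr 2
    ring

theorem tendsto_toReal_F_of_neg (M : FluidModel n) {s : ℝ} (hs : M.PassFinite s) {r : Fin n}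
    (hr : M.c r < 0) (j : Fin n) :
    Filter.Tendsto (fun y => (M.F s r y j).toReal) (𝓝[≥] 0) (𝓝 (if r = j then 1 else 0)) := by
  obtain ⟨B, hB⟩ := M.jumpSum_bounded hs r j
  set a := M.T r r - s with ha
  set C := Real.exp |a / M.c r| * B with hC
  -- the integral is of the order of `y` as `y → 0`
  have hI : Filter.Tendsto (fun y => ∫ t in (0 : ℝ)..(y / -M.c r),
      Real.exp (-a * t) * M.jumpSum s r j (-M.c r * t)) (𝓝[≥] 0) (𝓝 0) := by
    refine squeeze_zero_norm' (a := fun y => C * |y / -M.c r - 0|) ?_ ?_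
    · filter_upwards [Icc_mem_nhdsGE one_pos] with y hy
      refine intervalIntegral.norm_integral_le_of_norm_le_const fun t ht => ?_
      rw [Set.uIoc_of_le (div_nonneg hy.1 (by linarith))] at ht
      have h1 : -M.c r * t ∈ Set.Icc (0 : ℝ) 1 := by
        have := (le_div_iff₀ (neg_pos.2 hr)).1 ht.2
        exact ⟨mul_nonneg (by linarith) ht.1.le, by nlinarith [hy.2]⟩
      rw [norm_mul, Real.norm_eq_abs, Real.norm_eq_abs, Real.abs_exp]
      refine mul_le_mul (Real.exp_le_exp.2 ?_) (hB _ h1) (abs_nonneg _) (Real.exp_pos _).le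
      have h3 : t ≤ 1 / -M.c r := by
        rw [le_div_iff₀ (neg_pos.2 hr)]
        linarith [h1.2]
      calc -a * t ≤ |a| * t := mul_le_mul_of_nonneg_right (neg_le_abs a) ht.1.le
        _ ≤ |a| * (1 / -M.c r) := mul_le_mul_of_nonneg_left h3 (abs_nonneg a)
        _ = |a / M.c r| := by rw [abs_div, abs_of_neg hr]; ring
    · have : Filter.Tendsto (fun y : ℝ => C * |y / -M.c r - 0|) (𝓝 0) (𝓝 (C * |0 / -M.c r - 0|)) :=
        Continuous.tendsto (by fun_prop) 0
      simp only [zero_div, sub_zero, abs_zero, mul_zero] at this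
      simpa using this.mono_left nhdsWithin_le_nhds
  have he : Filter.Tendsto (fun y => Real.exp (a * (y / -M.c r))) (𝓝[≥] 0) (𝓝 1) := by
    have : Filter.Tendsto (fun y => Real.exp (a * (y / -M.c r))) (𝓝 0)
      (𝓝 (Real.exp (a * (0 / -M.c r)))) := Continuous.tendsto (by fun_prop) 0
    simp only [zero_div, mul_zero, Real.exp_zero] at this
    exact this.mono_left nhdsWithin_le_nhds
  have h := he.mul ((tendsto_const_nhds (x := (if r = j then 1 else 0 : ℝ))).add hI)
  rw [one_mul, add_zero] at h
  refine h.congr' ?_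
  filter_upwards [self_mem_nhdsWithin] with y hy
  have h1 := M.toReal_F_of_neg hs hr j (N := y / -M.c r) (div_nonneg hy (by linarith))
  rw [mul_div_cancel₀ _ (neg_pos.2 hr).ne'] at h1
  rw [h1]

/-- Right continuity at level zero, from that in the phases of negative rate by `F_add`. -/
theorem tendsto_toReal_F (M : FluidModel n) {s : ℝ} (hs : M.PassFinite s) (k j : Fin n) :
    Filter.Tendsto (fun y => (M.F s k y j).toReal) (𝓝[≥] 0) (𝓝 (M.W s k j)) := by
  have h1 : ∀ r, Filter.Tendsto (fun y => M.W s k r * (M.F s r y j).toReal) (𝓝[≥] 0)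
      (𝓝 (if r = j then M.W s k r else 0)) := by
    intro r
    rcases lt_or_ge (M.c r) 0 with hr | hr
    · convert (M.tendsto_toReal_F_of_neg hs hr j).const_mul (M.W s k r) using 2
      split_ifs <;> simp
    · have : M.W s k r = 0 := M.W_of_nonneg s k hr
      simp [this]
  have h2 := tendsto_finsetSum Finset.univ fun r _ => h1 r
  rw [Finset.sum_ite_eq' Finset.univ j, if_pos (Finset.mem_univ j)] at h2
  refine h2.congr' ?_
  filter_upwards [self_mem_nhdsWithin] with y hy
  exact (M.toReal_F_eq_sum_W hs k j hy).symm

theorem hasDerivWithinAt_jump_integral (M : FluidModel n) {s : ℝ} (hs : M.PassFinite s)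
    (k j : Fin n) (a : ℝ) {γ : ℝ} (hγ : 0 ≤ γ) :
    HasDerivWithinAt (fun N => ∫ t in (0 : ℝ)..N, Real.exp (a * t) * M.jumpSum s k j (γ * t))
      (∑ l, M.rate k l * M.W s l j) (Set.Ici 0) 0 := by
  have hm : Measurable fun t => Real.exp (a * t) * M.jumpSum s k j (γ * t) :=
    Measurable.mul (by fun_prop) ((M.measurable_jumpSum s k j).comp (measurable_id.const_mul γ))
  have h0 : Real.exp (a * 0) * M.jumpSum s k j (γ * 0) = ∑ l, M.rate k l * M.W s l j := by
    simp [jumpSum, W]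
  have hc : ContinuousWithinAt (fun t => Real.exp (a * t) * M.jumpSum s k j (γ * t))
      (Set.Ioi 0) 0 := by
    have h1 : Filter.Tendsto (fun t : ℝ => γ * t) (𝓝[>] 0) (𝓝[≥] 0) := by
      refine tendsto_nhdsWithin_iff.2 ⟨?_, ?_⟩
      · have : Filter.Tendsto (fun t : ℝ => γ * t) (𝓝 0) (𝓝 (γ * 0)) :=
          Continuous.tendsto (by fun_prop) 0
        rw [mul_zero] at this
        exact this.mono_left nhdsWithin_le_nhds
      · filter_upwards [self_mem_nhdsWithin] with t ht
        exact mul_nonneg hγ (le_of_lt ht)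
    have h2 : Filter.Tendsto (M.jumpSum s k j) (𝓝[≥] 0) (𝓝 (∑ l, M.rate k l * M.W s l j)) :=
      tendsto_finsetSum _ fun l _ => (M.tendsto_toReal_F hs l j).const_mul _
    have h3 : Filter.Tendsto (fun t : ℝ => Real.exp (a * t)) (𝓝[>] 0) (𝓝 (Real.exp (a * 0))) :=
      (Continuous.tendsto (by fun_prop) 0).mono_left nhdsWithin_le_nhds
    have h4 := h3.mul (h2.comp h1)
    rw [ContinuousWithinAt, h0]
    simpa using h4
  have := intervalIntegral.integral_hasDerivWithinAt_right (a := 0) (b := (0 : ℝ))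
    (s := Set.Ici 0) (t := Set.Ioi 0) (f := fun t => Real.exp (a * t) * M.jumpSum s k j (γ * t))
    (by simp) hm.stronglyMeasurable.stronglyMeasurableAtFilter hc
  rwa [h0] at this

theorem hasDerivWithinAt_exp_mul (a : ℝ) :
    HasDerivWithinAt (fun N : ℝ => Real.exp (a * N)) a (Set.Ici 0) 0 := by
  have h := ((hasDerivAt_id (0 : ℝ)).const_mul a).exp
  simpa using h.hasDerivWithinAt

theorem hasDerivWithinAt_F_of_neg (M : FluidModel n) {s : ℝ} (hs : M.PassFinite s) {r : Fin n}
    (hr : M.c r < 0) (j : Fin n) :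
    HasDerivWithinAt (fun y => (M.F s r y j).toReal) (M.downGen s (M.W s) r j) (Set.Ici 0) 0 := by
  have h1 := (hasDerivWithinAt_exp_mul (M.T r r - s)).mul
    ((M.hasDerivWithinAt_jump_integral hs r j (-(M.T r r - s)) (γ := -M.c r)
      (by linarith)).const_add (if r = j then 1 else 0 : ℝ))
  have h2 : HasDerivWithinAt (fun N => (M.F s r (-M.c r * N) j).toReal)
      (-M.c r * M.downGen s (M.W s) r j) (Set.Ici 0) 0 := by
    refine (h1.congr_deriv ?_).congr (fun N hN => ?_) ?_
    · have hc := hr.ne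
      rw [downGen, Matrix.of_apply, if_pos hr, T_mul_apply, M.W_of_neg s hr]
      simp only [intervalIntegral.integral_same, mul_zero, Real.exp_zero, add_zero]
      field_simp
      ring
    · exact M.toReal_F_of_neg hs hr j hN
    · exact M.toReal_F_of_neg hs hr j le_rfl
  have h3 : HasDerivWithinAt (fun y : ℝ => y / -M.c r) (1 / -M.c r) (Set.Ici 0) 0 :=
    ((hasDerivAt_id (0 : ℝ)).div_const _).hasDerivWithinAt
  have h4 := HasDerivWithinAt.comp_of_eq (h := fun y : ℝ => y / -M.c r)
    (h₂ := fun N => (M.F s r (-M.c r * N) j).toReal) (s' := Set.Ici 0) (0 : ℝ) h2 h3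
    (fun y hy => div_nonneg hy (neg_pos.2 hr).le) (zero_div _).symm
  have h5 : -M.c r ≠ 0 := (neg_pos.2 hr).ne'
  refine (h4.congr_deriv ?_).congr (fun y _ => ?_) ?_
  · rw [mul_one_div, mul_div_cancel_left₀ _ h5]
  · simp only [Function.comp, mul_div_cancel₀ _ h5]
  · simp only [Function.comp, mul_div_cancel₀ _ h5]

theorem hasDerivWithinAt_F (M : FluidModel n) {s : ℝ} (hs : M.PassFinite s) (k j : Fin n) :
    HasDerivWithinAt (fun y => (M.F s k y j).toReal) ((M.W s * M.downGen s (M.W s)) k j)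
      (Set.Ici 0) 0 := by
  have h1 : ∀ r, HasDerivWithinAt (fun y => M.W s k r * (M.F s r y j).toReal)
      (M.W s k r * M.downGen s (M.W s) r j) (Set.Ici 0) 0 := by
    intro r
    rcases lt_or_ge (M.c r) 0 with hr | hr
    · exact (M.hasDerivWithinAt_F_of_neg hs hr j).const_mul _
    · have : M.W s k r = 0 := M.W_of_nonneg s k hr
      simpa [this] using hasDerivWithinAt_const (0 : ℝ) (Set.Ici 0) (0 : ℝ)
  have h2 := HasDerivWithinAt.fun_sum (u := Finset.univ) fun r _ => h1 r
  rw [Matrix.mul_apply]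
  exact h2.congr (fun y hy => M.toReal_F_eq_sum_W hs k j hy) (M.toReal_F_eq_sum_W hs k j le_rfl)

/-- The matrix equation for the transforms of the first passage: in a phase of nonnegative rate
it is the derivative at time zero of first-step analysis up to a fixed time. -/
theorem residual_W (M : FluidModel n) {s : ℝ} (hs : M.PassFinite s) (k j : Fin n) :
    M.residual s (M.W s) k j = 0 := by
  rcases lt_or_ge (M.c k) 0 with hk | hk
  · exact M.residual_of_neg s hk (M.W_of_neg s hk) j
  · have h1 := M.hasDerivWithinAt_jump_integral hs k j (M.T k k - s) hk
    have h3 : HasDerivWithinAt (fun N : ℝ => M.c k * N) (M.c k) (Set.Ici 0) 0 := by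
      simpa using ((hasDerivAt_id (0 : ℝ)).const_mul (M.c k)).hasDerivWithinAt
    have h4 := HasDerivWithinAt.comp_of_eq (h := fun N : ℝ => M.c k * N)
      (h₂ := fun y => (M.F s k y j).toReal) (s' := Set.Ici 0) (0 : ℝ) (M.hasDerivWithinAt_F hs k j)
      h3 (fun y hy => mul_nonneg hk hy) (mul_zero _).symm
    have h5 := h1.add ((hasDerivWithinAt_exp_mul (M.T k k - s)).mul h4)
    -- by `toReal_F_eq` the function differentiated in `h5` is constant
    have h6 : HasDerivWithinAt (fun _ : ℝ => M.W s k j) 0 (Set.Ici 0) 0 :=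
      hasDerivWithinAt_const _ _ _
    have h7 := (uniqueDiffWithinAt_Ici (0 : ℝ)).eq_deriv _ h6
      (h5.congr (fun N hN => M.toReal_F_eq hs k j le_rfl hN (by
        rw [zero_add]
        exact mul_nonneg hk hN) |>.trans (by simp)) ((M.toReal_F_eq hs k j le_rfl (N := 0) le_rfl
        (by simp)).trans (by simp)))
    simp only [Function.comp, mul_zero, Real.exp_zero, one_mul] at h7
    rw [residual, T_mul_apply]
    have h8 : (M.F s k 0 j).toReal = M.W s k j := rfl
    rw [h8] at h7
    linarith

end FluidModel

namespace FluidModel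
variable {n : ℕ}
open MeasureTheory

/-! ### Comparison with supersolutions of the matrix equation -/

section Exp

open scoped Matrix.Norms.Operator

theorem exp_apply_nonneg {B : Matrix (Fin n) (Fin n) ℝ} (hB : ∀ i j, 0 ≤ B i j) (i j : Fin n) :
    0 ≤ NormedSpace.exp B i j := by
  have h1 := NormedSpace.exp_series_hasSum_exp' (𝕂 := ℝ) B
  have h2 := (Matrix.entryLinearMap ℝ ℝ i j).toContinuousLinearMap.hasSum h1
  refine h2.nonneg fun k => ?_
  have h3 : ∀ i j, 0 ≤ (B ^ k) i j := by
    induction k with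
    | zero =>
      intro i j
      rw [pow_zero, Matrix.one_apply]
      split_ifs <;> norm_num
    | succ k ih =>
      intro i j
      rw [pow_succ, Matrix.mul_apply]
      exact Finset.sum_nonneg fun l _ => mul_nonneg (ih i l) (hB l j)
  exact mul_nonneg (by positivity) (h3 i j)

/-- A matrix with nonnegative off-diagonal entries generates a nonnegative semigroup. -/
theorem exists_semigroup {G : Matrix (Fin n) (Fin n) ℝ} (hG : ∀ i j, i ≠ j → 0 ≤ G i j) :
    ∃ P : ℝ → Matrix (Fin n) (Fin n) ℝ, P 0 = 1 ∧
      (∀ x i j, HasDerivAt (fun x => P x i j) ((G * P x) i j) x) ∧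
      ∀ x, 0 ≤ x → ∀ i j, 0 ≤ P x i j := by
  obtain ⟨a, ha⟩ : ∃ a : ℝ, ∀ i, 0 ≤ G i i + a := by
    refine ⟨∑ i, |G i i|, fun i => ?_⟩
    have := Finset.single_le_sum (f := fun i => |G i i|) (fun i _ => abs_nonneg _)
      (Finset.mem_univ i)
    linarith [neg_abs_le (G i i)]
  -- a multiple of the identity makes the generator nonnegative
  set B := G + a • (1 : Matrix (Fin n) (Fin n) ℝ) with hB
  refine ⟨fun x => Real.exp (-a * x) • NormedSpace.exp (x • B), by simp, fun x i j => ?_,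
    fun x hx i j => ?_⟩
  · have h1 : HasDerivAt (fun x : ℝ => NormedSpace.exp (x • B) i j)
        ((B * NormedSpace.exp (x • B)) i j) x :=
      (Matrix.entryLinearMap ℝ ℝ i j).toContinuousLinearMap.hasFDerivAt.comp_hasDerivAt x
        (hasDerivAt_exp_smul_const' (𝕂 := ℝ) B x)
    have h2 : HasDerivAt (fun x : ℝ => Real.exp (-a * x)) (Real.exp (-a * x) * -a) x := by
      simpa using ((hasDerivAt_id x).const_mul (-a)).exp
    refine (h2.mul h1).congr_deriv ?_
    have h3 : B * NormedSpace.exp (x • B) = G * NormedSpace.exp (x • B)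
        + a • NormedSpace.exp (x • B) := by
      rw [hB, add_mul, smul_mul_assoc, one_mul]
    rw [h3, mul_smul_comm, Matrix.smul_apply, Matrix.add_apply, Matrix.smul_apply, smul_eq_mul,
      smul_eq_mul]
    ring
  · refine mul_nonneg (Real.exp_pos _).le (exp_apply_nonneg (fun i j => mul_nonneg hx ?_) i j)
    rw [hB, Matrix.add_apply, Matrix.smul_apply, Matrix.one_apply]
    by_cases hij : i = j
    · subst hij
      simpa using ha i
    · simpa [hij] using hG i j hij

end Exp

theorem downGen_nonneg (M : FluidModel n) (s : ℝ) {A : Matrix (Fin n) (Fin n) ℝ}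
    (hA : ∀ k j, 0 ≤ A k j) (hdown : ∀ k, M.c k < 0 → ∀ j, A k j = if k = j then 1 else 0)
    (i j : Fin n) (hij : i ≠ j) : 0 ≤ M.downGen s A i j := by
  rw [downGen, Matrix.of_apply]
  split_ifs with h
  · rw [T_mul_apply, hdown i h j, if_neg hij]
    refine div_nonneg ?_ (by linarith)
    have := Finset.sum_nonneg fun l (_ : l ∈ Finset.univ) =>
      mul_nonneg (M.rate_nonneg i l) (hA l j)
    linarith
  · exact le_rfl

/-- A nonnegative supersolution of the matrix equation bounds the transforms of the first
passage: along the paths of the phase process, the function `(A exp(x G)) k j` of the phase and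
the level, with `G = downGen A`, decreases in the mean. -/
theorem passFinite_of_residual_nonpos (M : FluidModel n) (s : ℝ) {A : Matrix (Fin n) (Fin n) ℝ}
    (hA : ∀ k j, 0 ≤ A k j) (hdown : ∀ k, M.c k < 0 → ∀ j, A k j = if k = j then 1 else 0)
    (hres : ∀ k j, M.residual s A k j ≤ 0) : M.PassFinite s := by
  obtain ⟨P, hP0, hPd, hPn⟩ := exists_semigroup (M.downGen_nonneg s hA hdown)
  set G := M.downGen s A with hG
  set f : Fin n → Fin n → ℝ → ℝ := fun k j x => (A * P x) k j with hf
  set f' : Fin n → Fin n → ℝ → ℝ := fun k j x => (A * (G * P x)) k j with hf'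
  have hfd : ∀ k j x, HasDerivAt (f k j) (f' k j x) x := by
    intro k j x
    have h := HasDerivAt.fun_sum (u := Finset.univ) fun r _ => (hPd x r j).const_mul (A k r)
    have e1 : f k j = fun x => ∑ r, A k r * P x r j := by
      ext y
      exact Matrix.mul_apply
    have e2 : f' k j x = ∑ r, A k r * (G * P x) r j := Matrix.mul_apply
    rw [e1, e2]
    exact h
  have hfc : ∀ k j, Continuous (f k j) := fun k j =>
    continuous_iff_continuousAt.2 fun x => (hfd k j x).continuousAt
  have hfn : ∀ k j x, 0 ≤ x → 0 ≤ f k j x := by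
    intro k j x hx
    simp only [hf, Matrix.mul_apply]
    exact Finset.sum_nonneg fun r _ => mul_nonneg (hA k r) (hPn x hx r j)
  -- the generator of the phase and the level, with discount rate `s`, maps `f` to a function `≤ 0`
  have hrow : ∀ k j x, 0 ≤ x →
      (M.T k k - s) * f k j x + ∑ l, M.rate k l * f l j x + M.c k * f' k j x ≤ 0 := by
    intro k j x hx
    have h1 : (M.T k k - s) * f k j x + ∑ l, M.rate k l * f l j x + M.c k * f' k j x
        = ∑ r, M.residual s A k r * P x r j := by
      have e1 : (M.T * (A * P x)) k j = M.T k k * f k j x + ∑ l, M.rate k l * f l j x :=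
        M.T_mul_apply _ k j
      have e2 : (M.T * (A * P x)) k j = ∑ r, (M.T * A) k r * P x r j := by
        rw [← Matrix.mul_assoc, Matrix.mul_apply]
      have e3 : f k j x = ∑ r, A k r * P x r j := by simp only [hf, Matrix.mul_apply]
      have e4 : f' k j x = ∑ r, (A * G) k r * P x r j := by
        simp only [hf']
        rw [← Matrix.mul_assoc, Matrix.mul_apply]
      simp only [residual, add_mul, sub_mul, Finset.sum_add_distrib, Finset.sum_sub_distrib,
        mul_assoc, ← Finset.mul_sum]
      rw [← e2, ← e3, ← hG, ← e4, e1]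
      ring
    rw [h1]
    exact Finset.sum_nonpos fun r _ =>
      mul_nonpos_of_nonpos_of_nonneg (hres k r) (hPn x hx r j)
  -- hence `f` decreases in the mean up to the first jump or a fixed time `N`
  have hint : ∀ k j x N, 0 ≤ x → 0 ≤ N → 0 ≤ x + M.c k * N →
      (∫⁻ t in Set.Ioc 0 N, ENNReal.ofReal (Real.exp ((M.T k k - s) * t) *
        ∑ l, M.rate k l * f l j (x + M.c k * t)))
      + ENNReal.ofReal (Real.exp ((M.T k k - s) * N) * f k j (x + M.c k * N))
        ≤ ENNReal.ofReal (f k j x) := by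
    intro k j x N hx hN h
    have hpos : ∀ t ∈ Set.Icc 0 N, 0 ≤ x + M.c k * t := by
      rintro t ⟨h1, h2⟩
      rcases le_or_gt 0 (M.c k) with hc | hc
      · exact add_nonneg hx (mul_nonneg hc h1)
      · nlinarith
    have hcont : Continuous fun t => Real.exp ((M.T k k - s) * t) *
        ∑ l, M.rate k l * f l j (x + M.c k * t) :=
      Continuous.mul (by fun_prop) (continuous_finsetSum _ fun l _ =>
        continuous_const.mul ((hfc l j).comp (by fun_prop)))
    have hnn : ∀ t ∈ Set.Icc 0 N, 0 ≤ Real.exp ((M.T k k - s) * t) *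
        ∑ l, M.rate k l * f l j (x + M.c k * t) := fun t ht =>
      mul_nonneg (Real.exp_pos _).le (Finset.sum_nonneg fun l _ =>
        mul_nonneg (M.rate_nonneg k l) (hfn l j _ (hpos t ht)))
    have hd : ∀ t, HasDerivAt (fun t => -(Real.exp ((M.T k k - s) * t) * f k j (x + M.c k * t)))
        (-(Real.exp ((M.T k k - s) * t) * ((M.T k k - s) * f k j (x + M.c k * t)
          + M.c k * f' k j (x + M.c k * t)))) t := by
      intro t
      have h1 : HasDerivAt (fun t => Real.exp ((M.T k k - s) * t))
          (Real.exp ((M.T k k - s) * t) * (M.T k k - s)) t := by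
        simpa using ((hasDerivAt_id t).const_mul (M.T k k - s)).exp
      have h2 : HasDerivAt (fun t => x + M.c k * t) (M.c k) t := by
        simpa using ((hasDerivAt_id t).const_mul (M.c k)).const_add x
      have h3 := (hfd k j (x + M.c k * t)).comp t h2
      refine (h1.mul h3).neg.congr_deriv ?_
      simp only [Function.comp]
      ring
    have hle := intervalIntegral.integral_le_sub_of_hasDeriv_right_of_le hN
      (g := fun t => -(Real.exp ((M.T k k - s) * t) * f k j (x + M.c k * t)))
      (φ := fun t => Real.exp ((M.T k k - s) * t) * ∑ l, M.rate k l * f l j (x + M.c k * t))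
      (fun t _ => (hd t).continuousAt.continuousWithinAt)
      (fun t _ => (hd t).hasDerivWithinAt) hcont.integrableOn_Icc (fun t ht => by
        have := hrow k j (x + M.c k * t) (hpos t ⟨ht.1.le, ht.2.le⟩)
        have h1 := mul_le_mul_of_nonneg_left this (Real.exp_pos ((M.T k k - s) * t)).le
        linarith)
    simp only [mul_zero, Real.exp_zero, one_mul, add_zero] at hle
    rw [← ofReal_integral_eq_lintegral_ofReal, ← ENNReal.ofReal_add]
    · refine ENNReal.ofReal_le_ofReal ?_
      rw [intervalIntegral.integral_of_le hN] at hle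
      linarith
    · exact setIntegral_nonneg measurableSet_Ioc fun t ht => hnn t ⟨ht.1.le, ht.2⟩
    · exact mul_nonneg (Real.exp_pos _).le (hfn k j _ h)
    · exact hcont.integrableOn_Icc.mono_set Set.Ioc_subset_Icc_self
    · filter_upwards [ae_restrict_mem measurableSet_Ioc] with t ht
      exact hnn t ⟨ht.1.le, ht.2⟩
  -- and `f` dominates the iterates of the first-step operator
  have key : ∀ m k x j, 0 ≤ x → M.FK s m k x j ≤ ENNReal.ofReal (f k j x) := by
    intro m
    induction m with
    | zero => exact fun _ _ _ _ => zero_le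
    | succ m ih =>
      intro k x j hx
      have hle : ∫⁻ t in M.staySet k x, ENNReal.ofReal (Real.exp ((M.T k k - s) * t)) *
            ∑ l, ENNReal.ofReal (M.rate k l) * M.FK s m l (x + M.c k * t) j
          ≤ ∫⁻ t in M.staySet k x, ENNReal.ofReal (Real.exp ((M.T k k - s) * t) *
            ∑ l, M.rate k l * f l j (x + M.c k * t)) := by
        refine setLIntegral_mono' (M.measurableSet_staySet k x) fun t ht => ?_
        rw [ENNReal.ofReal_mul (Real.exp_pos _).le, ENNReal.ofReal_sum_of_nonneg fun l _ =>
          mul_nonneg (M.rate_nonneg k l) (hfn l j _ ht.2)]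
        refine mul_le_mul_right (Finset.sum_le_sum fun l _ => ?_) _
        rw [ENNReal.ofReal_mul (M.rate_nonneg k l)]
        exact mul_le_mul_right (ih l _ j ht.2) _
      rw [FK, passStep]
      refine (add_le_add le_rfl hle).trans ?_
      by_cases hc : M.c k < 0
      · have h0 : x + M.c k * (x / -M.c k) = 0 := by
          have := hc.ne
          field_simp
          ring
        have h1 := hint k j x (x / -M.c k) hx (div_nonneg hx (by linarith)) h0.ge
        rw [M.staySet_of_neg hc, add_comm]
        refine le_trans (add_le_add le_rfl ?_) h1
        have h2 : f k j 0 = if k = j then 1 else 0 := by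
          simp only [hf, hP0, Matrix.mul_one]
          exact hdown k hc j
        rw [h0, h2]
        by_cases hkj : k = j
        · subst hkj
          simp [hc]
        · simp [hkj]
      · have h0 := not_lt.1 hc
        have hU : Set.Ioi (0 : ℝ) = ⋃ N : ℕ, Set.Ioc (0 : ℝ) N := by
          ext t
          simp only [Set.mem_Ioi, Set.mem_iUnion, Set.mem_Ioc]
          exact ⟨fun h => (exists_nat_ge t).imp fun N hN => ⟨h, hN⟩, fun ⟨_, h⟩ => h.1⟩
        have hdir : Directed (· ⊆ ·) fun N : ℕ => Set.Ioc (0 : ℝ) N :=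
          Monotone.directed_le fun a b hab => Set.Ioc_subset_Ioc_right (Nat.cast_le.2 hab)
        rw [if_neg fun h => hc h.1, zero_add, M.staySet_of_nonneg h0 hx, hU,
          setLIntegral_iUnion_of_directed _ hdir]
        refine iSup_le fun N => le_trans le_self_add
          (hint k j x N hx (Nat.cast_nonneg N) (add_nonneg hx (mul_nonneg h0 (Nat.cast_nonneg N))))
  intro k x hx j
  exact lt_of_le_of_lt (iSup_le fun m => key m k x j hx) ENNReal.ofReal_lt_top

end FluidModel

namespace FluidModel
variable {n : ℕ}
open MeasureTheory ProbabilityTheory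

/-! ### The singularity `s*` -/

theorem diag_ne_zero_of_up_down (M : FluidModel n) (hirr : M.Irreducible) {i₀ j₀ : Fin n}
    (hi₀ : 0 < M.c i₀) (hj₀ : M.c j₀ < 0) (i : Fin n) : M.T i i ≠ 0 :=
  hirr.diag_ne_zero (i₀ := i₀) (j₀ := j₀) (by
    rintro rfl
    linarith) i

theorem passFinite_iff (M : FluidModel n) (hirr : M.Irreducible) {i₀ j₀ : Fin n}
    (hi₀ : 0 < M.c i₀) (hj₀ : M.c j₀ < 0) (s : ℝ) : M.PassFinite s ↔ M.F s i₀ 0 j₀ < ∞ :=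
  ⟨fun h => h i₀ 0 le_rfl j₀, fun h k _ hx j => M.F_lt_top_of_entry hirr s hi₀ hj₀ h k hx j⟩

theorem psiFinite_iff (M : FluidModel n) (hirr : M.Irreducible) {i₀ j₀ : Fin n}
    (hi₀ : 0 < M.c i₀) (hj₀ : M.c j₀ < 0) (s : ℝ) : M.PsiFinite s ↔ M.PassFinite s := by
  have hT := M.diag_ne_zero_of_up_down hirr hi₀ hj₀
  constructor
  · intro h
    rw [M.passFinite_iff hirr hi₀ hj₀, ← M.psiENN_eq_F hT s ⟨i₀, hi₀⟩ ⟨j₀, hj₀⟩]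
    exact h _ _
  · intro h i j
    rw [M.psiENN_eq_F hT]
    exact h _ _ le_rfl _

theorem F_anti (M : FluidModel n) (hT : ∀ i, M.T i i ≠ 0) {s s' : ℝ} (h : s ≤ s') (i j : Fin n)
    {x : ℝ} (hx : 0 ≤ x) : M.F s' i x j ≤ M.F s i x j := by
  rw [M.F_eq_lintegral hT s' i hx, M.F_eq_lintegral hT s i hx]
  refine lintegral_mono_ae (ae_restrict_of_ae ?_)
  filter_upwards [M.ae_passTime_nonneg i hx j] with ω hω
  exact ENNReal.ofReal_le_ofReal (Real.exp_le_exp.2 (by nlinarith))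

theorem PassFinite.mono {M : FluidModel n} (hT : ∀ i, M.T i i ≠ 0) {s s' : ℝ}
    (hs : M.PassFinite s) (h : s ≤ s') : M.PassFinite s' :=
  fun k _ hx j => (M.F_anti hT h k j hx).trans_lt (hs k _ hx j)

theorem passFinite_zero (M : FluidModel n) (hT : ∀ i, M.T i i ≠ 0) : M.PassFinite 0 := by
  intro k x hx j
  rw [M.F_eq_lintegral hT 0 k hx]
  simp only [neg_zero, zero_mul, Real.exp_zero, ENNReal.ofReal_one, lintegral_const, one_mul]
  exact measure_lt_top _ _

/-- By Fatou's lemma, a bound for the transforms passes to the limit. -/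
theorem F_le_of_tendsto (M : FluidModel n) (hT : ∀ i, M.T i i ≠ 0) {u : ℕ → ℝ} {s : ℝ}
    (hu : Filter.Tendsto u Filter.atTop (𝓝 s)) (i j : Fin n) {x : ℝ} (hx : 0 ≤ x) {B : ℝ≥0∞}
    (hB : ∀ m, M.F (u m) i x j ≤ B) : M.F s i x j ≤ B := by
  have hm : ∀ a, Measurable fun ω => ENNReal.ofReal (Real.exp (-a * M.passTime i x j ω)) :=
    fun a => ENNReal.measurable_ofReal.comp
      (Real.measurable_exp.comp ((M.measurable_passTime i x j).const_mul _))
  have h1 := lintegral_liminf_le (μ := M.prob.restrict (M.hitSet i x j)) (u := Filter.atTop)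
    (fun m => hm (u m))
  have h2 : ∀ ω, Filter.liminf (fun m => ENNReal.ofReal (Real.exp (-u m * M.passTime i x j ω)))
      Filter.atTop = ENNReal.ofReal (Real.exp (-s * M.passTime i x j ω)) := fun ω =>
    (ENNReal.tendsto_ofReal ((Real.continuous_exp.tendsto _).comp
      (hu.neg.mul_const _))).liminf_eq
  simp only [h2, ← M.F_eq_lintegral hT _ i hx] at h1
  refine h1.trans ?_
  exact Filter.liminf_le_of_le (by isBoundedDefault) fun b hb => by
    obtain ⟨m, hm⟩ := hb.exists
    exact hm.trans (hB m)

theorem W_mul_downGen_nonneg_of_ne (M : FluidModel n) (s : ℝ) {r j : Fin n} (hrj : r ≠ j) :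
    0 ≤ M.downGen s (M.W s) r j :=
  M.downGen_nonneg s (M.W_nonneg s) (fun _ hk => M.W_of_neg s hk) r j hrj

theorem W_pos_of_up (M : FluidModel n) (hirr : M.Irreducible) {s : ℝ} (hs : M.PassFinite s)
    {i j : Fin n} (hi : 0 < M.c i) (hj : M.c j < 0) : 0 < M.W s i j :=
  ENNReal.toReal_pos (M.F_zero_pos_of_up hirr s hi hj).ne' (hs i 0 le_rfl j).ne

/-- Since the level returns to zero from `i` at a finite mean rate, the diagonal entries of the
generator `downGen` are bounded. This bounds the transforms after a jump from a phase `r` of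
negative rate. -/
theorem sum_rate_mul_W_le (M : FluidModel n) (hirr : M.Irreducible) {s : ℝ} (hs : M.PassFinite s)
    {i r : Fin n} (hi : 0 < M.c i) (hr : M.c r < 0) :
    ∑ l, M.rate r l * M.W s l r ≤ -M.c r * ((s - M.T i i) / M.c i) + (s - M.T r r) := by
  have hW := M.W_pos_of_up hirr hs hi hr
  have h1 := M.residual_W hs i r
  rw [residual, T_mul_apply, Matrix.mul_apply, ← Finset.add_sum_erase Finset.univ
    (fun q => M.W s i q * M.downGen s (M.W s) q r) (Finset.mem_univ r)] at h1
  have h2 : 0 ≤ ∑ q ∈ Finset.univ.erase r, M.W s i q * M.downGen s (M.W s) q r :=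
    Finset.sum_nonneg fun q hq => mul_nonneg (M.W_nonneg s i q)
      (M.W_mul_downGen_nonneg_of_ne s (Finset.ne_of_mem_erase hq))
  have h3 : 0 ≤ ∑ l, M.rate i l * M.W s l r :=
    Finset.sum_nonneg fun l _ => mul_nonneg (M.rate_nonneg i l) (M.W_nonneg s l r)
  have h4 : M.c i * M.downGen s (M.W s) r r ≤ s - M.T i i := by
    have h5 := mul_nonneg hi.le h2
    have h6 : M.W s i r * (M.c i * M.downGen s (M.W s) r r) ≤ M.W s i r * (s - M.T i i) := by
      nlinarith
    exact le_of_mul_le_mul_left h6 hW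
  have h5 : M.downGen s (M.W s) r r ≤ (s - M.T i i) / M.c i := by
    rw [le_div_iff₀ hi]
    linarith
  rw [downGen, Matrix.of_apply, if_pos hr, T_mul_apply, M.W_of_neg s hr, if_pos rfl,
    div_le_iff₀ (neg_pos.2 hr)] at h5
  linarith

/-- At the infimum of the arguments with finite transforms the transforms are finite: otherwise
the phases of nonnegative rate from which they are infinite could not be reached at all from the
phases of negative rate, by `sum_rate_mul_W_le`. -/
theorem passFinite_sInf (M : FluidModel n) (hirr : M.Irreducible) {i₀ j₀ : Fin n}
    (hi₀ : 0 < M.c i₀) (hj₀ : M.c j₀ < 0) {s : ℝ} (hs : ∀ z, s < z → M.PassFinite z) :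
    M.PassFinite s := by
  have hT := M.diag_ne_zero_of_up_down hirr hi₀ hj₀
  by_contra hcon
  have hB : ∀ k, 0 ≤ M.c k ∧ ∀ j, M.c j < 0 → M.F s k 0 j = ∞ := by
    have hup : ∀ i, 0 < M.c i → ∀ j, M.c j < 0 → M.F s i 0 j = ∞ := by
      intro i hi j hj
      by_contra h
      exact hcon ((M.passFinite_iff hirr hi hj s).2 (lt_top_iff_ne_top.2 h))
    refine hirr.induction_head (j := i₀) ⟨hi₀.le, hup i₀ hi₀⟩ ?_
    rintro k l hkl hpos ⟨_, hl⟩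
    rcases lt_trichotomy (M.c k) 0 with hk | hk | hk
    · exfalso
      have hrate := M.rate_pos hkl hpos
      set C := -M.c k * (((s + 1) - M.T i₀ i₀) / M.c i₀) + ((s + 1) - M.T k k) with hC
      have hb : ∀ z, s < z → z ≤ s + 1 → M.F z l 0 k ≤ ENNReal.ofReal (C / M.rate k l) := by
        intro z hz hz1
        have h1 := M.sum_rate_mul_W_le hirr (hs z hz) hi₀ hk
        have h2 : M.rate k l * M.W z l k ≤ ∑ m, M.rate k m * M.W z m k :=
          Finset.single_le_sum (f := fun m => M.rate k m * M.W z m k)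
            (fun m _ => mul_nonneg (M.rate_nonneg k m) (M.W_nonneg z m k)) (Finset.mem_univ l)
        have h3 : -M.c k * ((z - M.T i₀ i₀) / M.c i₀) ≤ -M.c k * (((s + 1) - M.T i₀ i₀) / M.c i₀) :=
          mul_le_mul_of_nonneg_left (div_le_div_of_nonneg_right (by linarith) hi₀.le) (by linarith)
        have h4 : M.W z l k ≤ C / M.rate k l := by
          rw [le_div_iff₀ hrate]
          linarith
        rw [← ENNReal.ofReal_toReal (hs z hz l 0 le_rfl k).ne]
        exact ENNReal.ofReal_le_ofReal h4
      have hlim : Filter.Tendsto (fun m : ℕ => s + 1 / ((m : ℝ) + 1)) Filter.atTop (𝓝 s) := by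
        simpa using tendsto_const_nhds.add (tendsto_one_div_add_atTop_nhds_zero_nat (𝕜 := ℝ))
      have h1 := M.F_le_of_tendsto hT hlim l k le_rfl (B := ENNReal.ofReal (C / M.rate k l))
        fun m => hb _ (by linarith [Nat.one_div_pos_of_nat (α := ℝ) (n := m)]) (by
          have : 1 / ((m : ℝ) + 1) ≤ 1 := by
            rw [div_le_one (by positivity)]
            linarith [Nat.cast_nonneg (α := ℝ) m]
          linarith)
      rw [hl k hk, top_le_iff] at h1
      exact ENNReal.ofReal_ne_top h1
    · refine ⟨hk.ge, fun j hj => ?_⟩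
      by_contra h
      have h1 := M.ae_F_lt_top s (M.rate_pos hkl hpos) (lt_top_iff_ne_top.2 h)
      have hsub : Set.Ioo (0 : ℝ) 1 ⊆ M.staySet k 0 := by
        rw [M.staySet_of_nonneg hk.ge le_rfl]
        exact fun t ht => ht.1
      obtain ⟨t, _, h2⟩ := exists_Ioo_of_ae one_pos hsub h1
      rw [hk, zero_mul, add_zero, hl j hj] at h2
      exact lt_irrefl _ h2
    · exact ⟨hk.le, hup k hk⟩
  exact absurd hj₀ (not_lt.2 (hB j₀).1)

theorem exists_sing (M : FluidModel n) (hirr : M.Irreducible) {i₀ j₀ : Fin n}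
    (hi₀ : 0 < M.c i₀) (hj₀ : M.c j₀ < 0) :
    IsGreatest M.singSet M.sStar ∧ ∀ s, M.PassFinite s ↔ M.sStar ≤ s := by
  have hT := M.diag_ne_zero_of_up_down hirr hi₀ hj₀
  have hbdd : BddBelow {s | M.PassFinite s} := by
    set a := -M.c j₀ / M.c i₀ with ha
    have ha0 : 0 < a := div_pos (neg_pos.2 hj₀) hi₀
    refine ⟨(a * M.T i₀ i₀ + M.T j₀ j₀) / (a + 1), fun s hs => ?_⟩
    have h1 := M.sum_rate_mul_W_le hirr hs hi₀ hj₀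
    have h2 : 0 ≤ ∑ l, M.rate j₀ l * M.W s l j₀ :=
      Finset.sum_nonneg fun l _ => mul_nonneg (M.rate_nonneg _ l) (M.W_nonneg s l _)
    have h3 : -M.c j₀ * ((s - M.T i₀ i₀) / M.c i₀) = a * (s - M.T i₀ i₀) := by
      rw [ha]
      ring
    rw [div_le_iff₀ (by linarith)]
    linarith
  have hne : {s | M.PassFinite s}.Nonempty := ⟨0, M.passFinite_zero hT⟩
  set σ := sInf {s | M.PassFinite s} with hσ
  have hgt : ∀ z, σ < z → M.PassFinite z := by
    intro z hz
    obtain ⟨y, hy, hyz⟩ := (csInf_lt_iff hbdd hne).1 hz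
    exact PassFinite.mono hT hy hyz.le
  have hfin := M.passFinite_sInf hirr hi₀ hj₀ hgt
  have hiff : ∀ s, M.PassFinite s ↔ σ ≤ s :=
    fun s => ⟨fun h => csInf_le hbdd h, fun h => PassFinite.mono hT hfin h⟩
  have hgreat : IsGreatest M.singSet σ := by
    refine ⟨⟨(hiff 0).1 (M.passFinite_zero hT), (M.psiFinite_iff hirr hi₀ hj₀ σ).2 hfin,
      fun z hz h => ?_⟩, fun s hs => ?_⟩
    · exact absurd ((hiff z).1 ((M.psiFinite_iff hirr hi₀ hj₀ z).1 h)) (not_le.2 hz)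
    · by_contra h
      exact hs.2.2 σ (not_le.1 h) ((M.psiFinite_iff hirr hi₀ hj₀ σ).2 hfin)
  have hstar : M.sStar = σ := hgreat.csSup_eq
  rw [hstar]
  exact ⟨hgreat, hiff⟩

/-! ### The derivative of the transforms -/

/-- The negative derivative of `W s`, `E(τ exp(-s τ); φ(τ) = j)` for the first passage time `τ`. -/
noncomputable def V (M : FluidModel n) (s : ℝ) : Matrix (Fin n) (Fin n) ℝ :=
  Matrix.of fun k j => ∫ ω in M.hitSet k 0 j,
    M.passTime k 0 j ω * Real.exp (-s * M.passTime k 0 j ω) ∂M.prob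

theorem V_nonneg (M : FluidModel n) (s : ℝ) (k j : Fin n) : 0 ≤ M.V s k j := by
  refine integral_nonneg_of_ae (ae_restrict_of_ae ?_)
  filter_upwards [M.ae_passTime_nonneg k le_rfl j] with ω hω
  exact mul_nonneg hω (Real.exp_pos _).le

theorem W_eq_mgf (M : FluidModel n) (hT : ∀ i, M.T i i ≠ 0) (s : ℝ) (k j : Fin n) :
    M.W s k j
      = mgf (fun ω => -M.passTime k 0 j ω) (M.prob.restrict (M.hitSet k 0 j)) s := by
  rw [W, Matrix.of_apply, M.F_eq_lintegral hT s k le_rfl, mgf, integral_eq_lintegral_of_nonneg_ae]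
  · simp only [mul_neg, neg_mul]
  · exact Filter.Eventually.of_forall fun ω => (Real.exp_pos _).le
  · exact (Real.measurable_exp.comp
      ((M.measurable_passTime k 0 j).neg.const_mul s)).aestronglyMeasurable

theorem integrableExpSet_of_passFinite (M : FluidModel n) (hT : ∀ i, M.T i i ≠ 0) {s : ℝ}
    (hs : M.PassFinite s) (k j : Fin n) :
    s ∈ integrableExpSet (fun ω => -M.passTime k 0 j ω)
      (M.prob.restrict (M.hitSet k 0 j)) := by
  have h := hs k 0 le_rfl j
  rw [M.F_eq_lintegral hT s k le_rfl] at h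
  refine ⟨(Real.measurable_exp.comp
      ((M.measurable_passTime k 0 j).neg.const_mul s)).aestronglyMeasurable, ?_⟩
  rw [hasFiniteIntegral_iff_ofReal (Filter.Eventually.of_forall fun ω => (Real.exp_pos _).le)]
  simpa only [mul_neg, neg_mul] using h

theorem mem_interior_integrableExpSet (M : FluidModel n) (hT : ∀ i, M.T i i ≠ 0) {σ s : ℝ}
    (hσ : ∀ z, σ < z → M.PassFinite z) (hs : σ < s) (k j : Fin n) :
    s ∈ interior (integrableExpSet (fun ω => -M.passTime k 0 j ω)
      (M.prob.restrict (M.hitSet k 0 j))) :=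
  mem_interior.2 ⟨Set.Ioi σ, fun z hz => M.integrableExpSet_of_passFinite hT (hσ z hz) k j,
    isOpen_Ioi, hs⟩

theorem hasDerivAt_W (M : FluidModel n) (hT : ∀ i, M.T i i ≠ 0) {σ s : ℝ}
    (hσ : ∀ z, σ < z → M.PassFinite z) (hs : σ < s) (k j : Fin n) :
    HasDerivAt (fun z => M.W z k j) (-M.V s k j) s := by
  have h := hasDerivAt_mgf (M.mem_interior_integrableExpSet hT hσ hs k j)
  have e : (fun z => M.W z k j) = mgf (fun ω => -M.passTime k 0 j ω)
      (M.prob.restrict (M.hitSet k 0 j)) := by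
    ext z
    exact M.W_eq_mgf hT z k j
  rw [e]
  refine h.congr_deriv ?_
  rw [V, Matrix.of_apply, ← integral_neg]
  simp only [mul_neg, neg_mul]

theorem V_anti (M : FluidModel n) (hT : ∀ i, M.T i i ≠ 0) {σ s s' : ℝ}
    (hσ : ∀ z, σ < z → M.PassFinite z) (hs : σ < s) (hss' : s ≤ s') (k j : Fin n) :
    M.V s' k j ≤ M.V s k j := by
  have hint : ∀ z, σ < z → Integrable (fun ω => M.passTime k 0 j ω *
      Real.exp (-z * M.passTime k 0 j ω)) (M.prob.restrict (M.hitSet k 0 j)) := by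
    intro z hz
    have h := (integrable_pow_mul_exp_of_mem_interior_integrableExpSet
      (M.mem_interior_integrableExpSet hT hσ hz k j) 1).neg
    refine h.congr (Filter.Eventually.of_forall fun ω => ?_)
    simp
  refine integral_mono_ae (hint s' (hs.trans_le hss')) (hint s hs) (ae_restrict_of_ae ?_)
  filter_upwards [M.ae_passTime_nonneg k le_rfl j] with ω hω
  exact mul_le_mul_of_nonneg_left (Real.exp_le_exp.2 (by nlinarith)) hω

theorem W_anti (M : FluidModel n) (hT : ∀ i, M.T i i ≠ 0) {s s' : ℝ} (hs : M.PassFinite s)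
    (hss' : s ≤ s') (k j : Fin n) : M.W s' k j ≤ M.W s k j :=
  ENNReal.toReal_mono (hs k 0 le_rfl j).ne (M.F_anti hT hss' k j le_rfl)

/-- If the passage from `k` to `j` has probability zero, then `W` and its derivative vanish. -/
theorem W_V_eq_zero (M : FluidModel n) (hT : ∀ i, M.T i i ≠ 0) {s : ℝ} (hs : M.PassFinite s)
    {k j : Fin n} (h : M.W s k j = 0) (s' : ℝ) : M.W s' k j = 0 ∧ M.V s' k j = 0 := by
  have hμ : M.prob.restrict (M.hitSet k 0 j) = 0 := by
    by_contra hne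
    rw [M.W_eq_mgf hT] at h
    exact (mgf_pos' hne (M.integrableExpSet_of_passFinite hT hs k j)).ne' h
  rw [M.W_eq_mgf hT, V, Matrix.of_apply, hμ]
  simp

theorem V_of_neg (M : FluidModel n) (hT : ∀ i, M.T i i ≠ 0) {σ s : ℝ}
    (hσ : ∀ z, σ < z → M.PassFinite z) (hs : σ < s) {k : Fin n} (hk : M.c k < 0) (j : Fin n) :
    M.V s k j = 0 := by
  have h := M.hasDerivAt_W hT hσ hs k j
  simp only [M.W_of_neg _ hk] at h
  have := h.unique (hasDerivAt_const s _)
  linarith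

/-- The negative derivative of `downGen s (W s)`. -/
noncomputable def downGen' (M : FluidModel n) (s : ℝ) : Matrix (Fin n) (Fin n) ℝ :=
  Matrix.of fun r j => if M.c r < 0 then ((M.T * M.V s) r j + M.W s r j) / -M.c r else 0

theorem hasDerivAt_T_mul_W (M : FluidModel n) (hT : ∀ i, M.T i i ≠ 0) {σ s : ℝ}
    (hσ : ∀ z, σ < z → M.PassFinite z) (hs : σ < s) (k j : Fin n) :
    HasDerivAt (fun z => (M.T * M.W z) k j - z * M.W z k j)
      (-(M.T * M.V s) k j - M.W s k j + s * M.V s k j) s := by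
  have h1 := HasDerivAt.fun_sum (u := Finset.univ) fun l _ =>
    (M.hasDerivAt_W hT hσ hs l j).const_mul (M.T k l)
  have h2 := (hasDerivAt_id s).mul (M.hasDerivAt_W hT hσ hs k j)
  refine ((h1.sub h2).congr_deriv ?_).congr_of_eventuallyEq
    (Filter.Eventually.of_forall fun z => ?_)
  · simp only [mul_neg, Finset.sum_neg_distrib, Matrix.mul_apply, id, one_mul]
    ring
  · simp only [Matrix.mul_apply, Pi.sub_apply, Pi.mul_apply, id]

theorem hasDerivAt_downGen (M : FluidModel n) (hT : ∀ i, M.T i i ≠ 0) {σ s : ℝ}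
    (hσ : ∀ z, σ < z → M.PassFinite z) (hs : σ < s) (r j : Fin n) :
    HasDerivAt (fun z => M.downGen z (M.W z) r j) (-M.downGen' s r j) s := by
  by_cases hr : M.c r < 0
  · have h := (M.hasDerivAt_T_mul_W hT hσ hs r j).div_const (-M.c r)
    simp only [downGen, downGen', Matrix.of_apply, if_pos hr]
    refine h.congr_deriv ?_
    rw [M.V_of_neg hT hσ hs hr]
    ring
  · simp only [downGen, downGen', Matrix.of_apply, if_neg hr, neg_zero]
    exact hasDerivAt_const s _

theorem downGen'_nonneg (M : FluidModel n) (hT : ∀ i, M.T i i ≠ 0) {σ s : ℝ}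
    (hσ : ∀ z, σ < z → M.PassFinite z) (hs : σ < s) (r j : Fin n) : 0 ≤ M.downGen' s r j := by
  rw [downGen', Matrix.of_apply]
  split_ifs with hr
  · rw [T_mul_apply, M.V_of_neg hT hσ hs hr, mul_zero, zero_add]
    exact div_nonneg (add_nonneg (Finset.sum_nonneg fun l _ => mul_nonneg (M.rate_nonneg r l)
      (M.V_nonneg s l j)) (M.W_nonneg s r j)) (by linarith)
  · exact le_rfl

/-- The differentiated matrix equation. -/
theorem deriv_equation (M : FluidModel n) (hT : ∀ i, M.T i i ≠ 0) {σ s : ℝ}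
    (hσ : ∀ z, σ < z → M.PassFinite z) (hs : σ < s) (k j : Fin n) :
    (M.T * M.V s) k j - s * M.V s k j + W M s k j + M.c k *
      ((M.V s * M.downGen s (M.W s)) k j + (M.W s * M.downGen' s) k j) = 0 := by
  have h1 := HasDerivAt.fun_sum (u := Finset.univ) fun q _ =>
    (M.hasDerivAt_W hT hσ hs k q).mul (M.hasDerivAt_downGen hT hσ hs q j)
  have h2 := (M.hasDerivAt_T_mul_W hT hσ hs k j).add (h1.const_mul (M.c k))
  have h3 : HasDerivAt (fun z => M.residual z (M.W z) k j) 0 s := by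
    refine (hasDerivAt_const s (0 : ℝ)).congr_of_eventuallyEq ?_
    filter_upwards [Ioi_mem_nhds hs] with z hz
    exact M.residual_W (hσ z hz) k j
  have h4 := h2.unique (h3.congr_of_eventuallyEq (Filter.Eventually.of_forall fun z => by
    simp only [residual, Matrix.mul_apply, Pi.add_apply, Pi.mul_apply]))
  simp only [Finset.sum_add_distrib, neg_mul, mul_neg, Finset.sum_neg_distrib,
    ← Matrix.mul_apply] at h4
  linarith

end FluidModel

namespace FluidModel
variable {n : ℕ}
open MeasureTheory

/-! ### Divergence of the derivative at the singularity -/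

/-- The `(k, j)` entry of the derivative of `W` stays bounded to the right of `σ`. -/
def BddV (M : FluidModel n) (σ : ℝ) (k j : Fin n) : Prop :=
  ∃ b, ∀ s ∈ Set.Ioc σ (σ + 1), M.V s k j ≤ b

theorem BddV.of_mul_le {M : FluidModel n} {σ a : ℝ} {l j : Fin n} (ha : 0 < a) {b : ℝ}
    (h : ∀ s ∈ Set.Ioc σ (σ + 1), a * M.V s l j ≤ b) : M.BddV σ l j :=
  ⟨b / a, fun s hs => by
    rw [le_div_iff₀ ha, mul_comm]
    exact h s hs⟩

section

variable {M : FluidModel n} {σ : ℝ}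

/-- The nonnegative terms of the differentiated equation are bounded by a multiple of the entry of
the derivative. -/
theorem deriv_terms_le (hT : ∀ i, M.T i i ≠ 0) (hσ : ∀ z, σ < z → M.PassFinite z) {i j : Fin n}
    (hi : 0 < M.c i) (hj : M.c j < 0) {s : ℝ} (hs : s ∈ Set.Ioc σ (σ + 1)) :
    ∑ l, M.rate i l * M.V s l j
      + M.c i * ∑ q ∈ Finset.univ.erase j, M.V s i q * M.downGen s (M.W s) q j
      + M.c i * ∑ q, M.W s i q * M.downGen' s q j
    ≤ ((σ + 1 - M.T i i) + M.c i * ((σ + 1 - M.T j j) / -M.c j)) * M.V s i j := by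
  have h1 := deriv_equation M hT hσ hs.1 i j
  rw [T_mul_apply, Matrix.mul_apply, Matrix.mul_apply, ← Finset.add_sum_erase Finset.univ
    (fun q => M.V s i q * M.downGen s (M.W s) q j) (Finset.mem_univ j)] at h1
  have hV := M.V_nonneg s i j
  have h2 : -((σ + 1 - M.T j j) / -M.c j) ≤ M.downGen s (M.W s) j j := by
    rw [downGen, Matrix.of_apply, if_pos hj, T_mul_apply, M.W_of_neg s hj, if_pos rfl, ← neg_div]
    refine div_le_div_of_nonneg_right ?_ (by linarith)
    have := Finset.sum_nonneg fun l (_ : l ∈ Finset.univ) =>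
      mul_nonneg (M.rate_nonneg j l) (M.W_nonneg s l j)
    linarith [hs.2]
  have h3 : M.V s i j * -((σ + 1 - M.T j j) / -M.c j)
      ≤ M.V s i j * M.downGen s (M.W s) j j := mul_le_mul_of_nonneg_left h2 hV
  have h4 := mul_le_mul_of_nonneg_left h3 hi.le
  have h5 := mul_le_mul_of_nonneg_right hs.2 hV
  have h6 := M.W_nonneg s i j
  linarith

theorem exists_deriv_terms_bound (hT : ∀ i, M.T i i ≠ 0) (hσ : ∀ z, σ < z → M.PassFinite z)
    {i j : Fin n} (hi : 0 < M.c i) (hj : M.c j < 0) (h : M.BddV σ i j) :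
    ∃ B, ∀ s ∈ Set.Ioc σ (σ + 1), ∑ l, M.rate i l * M.V s l j
      + M.c i * ∑ q ∈ Finset.univ.erase j, M.V s i q * M.downGen s (M.W s) q j
      + M.c i * ∑ q, M.W s i q * M.downGen' s q j ≤ B := by
  obtain ⟨b, hb⟩ := h
  refine ⟨|(σ + 1 - M.T i i) + M.c i * ((σ + 1 - M.T j j) / -M.c j)| * b, fun s hs => ?_⟩
  refine (deriv_terms_le hT hσ hi hj hs).trans ?_
  exact mul_le_mul (le_abs_self _) (hb s hs) (M.V_nonneg s i j) (abs_nonneg _)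

theorem rate_terms_nonneg (s : ℝ) (i j : Fin n) : 0 ≤ ∑ l, M.rate i l * M.V s l j :=
  Finset.sum_nonneg fun l _ => mul_nonneg (M.rate_nonneg i l) (M.V_nonneg s l j)

theorem V_downGen_terms_nonneg (s : ℝ) (i j : Fin n) :
    0 ≤ ∑ q ∈ Finset.univ.erase j, M.V s i q * M.downGen s (M.W s) q j :=
  Finset.sum_nonneg fun q hq => mul_nonneg (M.V_nonneg s i q)
    (M.W_mul_downGen_nonneg_of_ne s (Finset.ne_of_mem_erase hq))

theorem W_downGen'_terms_nonneg (hT : ∀ i, M.T i i ≠ 0) (hσ : ∀ z, σ < z → M.PassFinite z)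
    {s : ℝ} (hs : σ < s) (i j : Fin n) : 0 ≤ ∑ q, M.W s i q * M.downGen' s q j :=
  Finset.sum_nonneg fun q _ => mul_nonneg (M.W_nonneg s i q) (M.downGen'_nonneg hT hσ hs q j)

theorem rate_mul_V_le (s : ℝ) (i l j : Fin n) :
    M.rate i l * M.V s l j ≤ ∑ l, M.rate i l * M.V s l j :=
  Finset.single_le_sum (f := fun l => M.rate i l * M.V s l j)
    (fun l _ => mul_nonneg (M.rate_nonneg i l) (M.V_nonneg s l j)) (Finset.mem_univ l)

/-- Boundedness within a column passes along the transitions from a phase of positive rate. -/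
theorem BddV.step_up (hT : ∀ i, M.T i i ≠ 0) (hσ : ∀ z, σ < z → M.PassFinite z)
    {i j l : Fin n} (hi : 0 < M.c i) (hj : M.c j < 0) (h : M.BddV σ i j) (hil : 0 < M.rate i l) :
    M.BddV σ l j := by
  obtain ⟨B, hB⟩ := exists_deriv_terms_bound hT hσ hi hj h
  refine BddV.of_mul_le hil (b := B) fun s hs => ?_
  have h1 := hB s hs
  have h2 := mul_nonneg hi.le (V_downGen_terms_nonneg (M := M) s i j)
  have h3 := mul_nonneg hi.le (W_downGen'_terms_nonneg hT hσ hs.1 i j)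
  linarith [rate_mul_V_le (M := M) s i l j]

theorem BddV.downGen'_bounded (hirr : M.Irreducible) (hT : ∀ i, M.T i i ≠ 0)
    (hσ : ∀ z, σ < z → M.PassFinite z) {i j r : Fin n} (hi : 0 < M.c i) (hj : M.c j < 0)
    (h : M.BddV σ i j) (hr : M.c r < 0) :
    ∃ B, ∀ s ∈ Set.Ioc σ (σ + 1), M.downGen' s r j ≤ B := by
  obtain ⟨B, hB⟩ := exists_deriv_terms_bound hT hσ hi hj h
  have hw := M.W_pos_of_up hirr (hσ (σ + 1) (by linarith)) hi hr
  refine ⟨B / (M.c i * M.W (σ + 1) i r), fun s hs => ?_⟩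
  rw [le_div_iff₀ (mul_pos hi hw)]
  have h1 := hB s hs
  have h2 := mul_nonneg hi.le (V_downGen_terms_nonneg (M := M) s i j)
  have h3 : M.W s i r * M.downGen' s r j ≤ ∑ q, M.W s i q * M.downGen' s q j :=
    Finset.single_le_sum (f := fun q => M.W s i q * M.downGen' s q j)
      (fun q _ => mul_nonneg (M.W_nonneg s i q) (M.downGen'_nonneg hT hσ hs.1 q j))
      (Finset.mem_univ r)
  have h4 := mul_le_mul_of_nonneg_right (M.W_anti hT (hσ s hs.1) hs.2 i r)
    (M.downGen'_nonneg hT hσ hs.1 r j)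
  have h5 := mul_le_mul_of_nonneg_left (h4.trans h3) hi.le
  have h6 := rate_terms_nonneg (M := M) s i j
  linarith

/-- Boundedness of an entry in a row of positive rate passes, within the column, to the phases with
a transition from any phase of negative rate. -/
theorem BddV.step_down (hirr : M.Irreducible) (hT : ∀ i, M.T i i ≠ 0)
    (hσ : ∀ z, σ < z → M.PassFinite z) {i j r l : Fin n} (hi : 0 < M.c i) (hj : M.c j < 0)
    (h : M.BddV σ i j) (hr : M.c r < 0) (hrl : 0 < M.rate r l) : M.BddV σ l j := by
  obtain ⟨B, hB⟩ := h.downGen'_bounded hirr hT hσ hi hj hr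
  refine BddV.of_mul_le hrl (b := -M.c r * B) fun s hs => ?_
  have h1 := hB s hs
  rw [downGen', Matrix.of_apply, if_pos hr, div_le_iff₀ (neg_pos.2 hr), T_mul_apply,
    M.V_of_neg hT hσ hs.1 hr] at h1
  have h2 := M.W_nonneg s r j
  linarith [rate_mul_V_le (M := M) s r l j]

/-- Boundedness within a column passes along the transitions from a phase of rate zero. -/
theorem BddV.step_flat (hT : ∀ i, M.T i i ≠ 0) (hσ : ∀ z, σ < z → M.PassFinite z)
    {k j l : Fin n} (hk : M.c k = 0) (h : M.BddV σ k j) (hkl : 0 < M.rate k l) :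
    M.BddV σ l j := by
  obtain ⟨b, hb⟩ := h
  refine BddV.of_mul_le hkl (b := |σ + 1 - M.T k k| * b) fun s hs => ?_
  have h1 := deriv_equation M hT hσ hs.1 k j
  rw [hk, zero_mul, T_mul_apply] at h1
  have h2 := M.W_nonneg s k j
  have h3 := mul_le_mul_of_nonneg_right hs.2 (M.V_nonneg s k j)
  have h4 : (σ + 1 - M.T k k) * M.V s k j ≤ |σ + 1 - M.T k k| * b :=
    mul_le_mul (le_abs_self _) (hb s hs) (M.V_nonneg s k j) (abs_nonneg _)
  linarith [rate_mul_V_le (M := M) s k l j]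

theorem W_mul_downGen_anti (hT : ∀ i, M.T i i ≠ 0) {s s' : ℝ} (hs : M.PassFinite s)
    (hss' : s ≤ s') {r j : Fin n} (hrj : r ≠ j) :
    M.downGen s' (M.W s') r j ≤ M.downGen s (M.W s) r j := by
  rw [downGen, downGen, Matrix.of_apply, Matrix.of_apply]
  split_ifs with hr
  · rw [T_mul_apply, T_mul_apply, M.W_of_neg _ hr, M.W_of_neg _ hr, if_neg hrj]
    simp only [mul_zero, sub_zero, zero_add]
    exact div_le_div_of_nonneg_right (Finset.sum_le_sum fun l _ =>
      mul_le_mul_of_nonneg_left (M.W_anti hT hs hss' l j) (M.rate_nonneg r l)) (by linarith)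
  · exact le_rfl

/-- Boundedness within a row of positive rate passes from a column `j` to the columns from which the
semigroup of passages leads directly to `j`. -/
theorem BddV.step_column (hT : ∀ i, M.T i i ≠ 0)
    (hσ : ∀ z, σ < z → M.PassFinite z) {i j r : Fin n} (hi : 0 < M.c i) (hj : M.c j < 0)
    (h : M.BddV σ i j) (hrj : r ≠ j) (hD : 0 < M.downGen (σ + 1) (M.W (σ + 1)) r j) :
    M.BddV σ i r := by
  obtain ⟨B, hB⟩ := exists_deriv_terms_bound hT hσ hi hj h
  refine BddV.of_mul_le (mul_pos hi hD) (b := B) fun s hs => ?_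
  have h1 := hB s hs
  have h3 := mul_nonneg hi.le (W_downGen'_terms_nonneg hT hσ hs.1 i j)
  have h4 : M.V s i r * M.downGen s (M.W s) r j
      ≤ ∑ q ∈ Finset.univ.erase j, M.V s i q * M.downGen s (M.W s) q j :=
    Finset.single_le_sum (f := fun q => M.V s i q * M.downGen s (M.W s) q j)
      (fun q hq => mul_nonneg (M.V_nonneg s i q)
        (M.W_mul_downGen_nonneg_of_ne s (Finset.ne_of_mem_erase hq)))
      (Finset.mem_erase.2 ⟨hrj, Finset.mem_univ r⟩)
  have h5 := mul_le_mul_of_nonneg_left (W_mul_downGen_anti hT (hσ s hs.1) hs.2 hrj)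
    (M.V_nonneg s i r)
  have h6 := mul_le_mul_of_nonneg_left (h5.trans h4) hi.le
  linarith [rate_terms_nonneg (M := M) s i j]

/-- By irreducibility, a single bounded entry of the derivative of `Ψ` makes its row bounded. -/
theorem BddV.row (hirr : M.Irreducible) (hT : ∀ i, M.T i i ≠ 0)
    (hσ : ∀ z, σ < z → M.PassFinite z) {i j : Fin n} (hi : 0 < M.c i) (hj : M.c j < 0)
    (h : M.BddV σ i j) {r : Fin n} (hr : M.c r < 0) : M.BddV σ i r := by
  by_contra hcon
  have hfin := hσ (σ + 1) (by linarith)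
  -- the phases from which no phase of a bounded column can be reached at level zero
  have key : ∀ k, ∀ q, M.c q < 0 → M.BddV σ i q → M.W (σ + 1) k q = 0 := by
    refine hirr.induction_tail (i := r) ?_ ?_
    · intro q _ hbdd
      rw [M.W_of_neg _ hr, if_neg]
      rintro rfl
      exact hcon hbdd
    · intro k l hkl hpos hk q hq hbdd
      have hrate := M.rate_pos hkl hpos
      have hk0 := hk q hq hbdd
      have hsum : ∑ m, M.rate k m * M.W (σ + 1) m q = 0 → M.W (σ + 1) l q = 0 := by
        intro h0
        have h1 := (Finset.sum_eq_zero_iff_of_nonneg fun m _ =>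
          mul_nonneg (M.rate_nonneg k m) (M.W_nonneg (σ + 1) m q)).1 h0 l (Finset.mem_univ l)
        exact (mul_eq_zero.1 h1).resolve_left hrate.ne'
      rcases lt_trichotomy (M.c k) 0 with hc | hc | hc
      · have hkq : k ≠ q := by
          rintro rfl
          rw [M.W_of_neg _ hc, if_pos rfl] at hk0
          exact one_ne_zero hk0
        have hkb : ¬ M.BddV σ i k := by
          intro hb
          have := hk k hc hb
          rw [M.W_of_neg _ hc, if_pos rfl] at this
          exact one_ne_zero this
        have hD : M.downGen (σ + 1) (M.W (σ + 1)) k q = 0 :=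
          le_antisymm (not_lt.1 fun hD => hkb (hbdd.step_column hT hσ hi hq hkq hD))
            (M.W_mul_downGen_nonneg_of_ne _ hkq)
        rw [downGen, Matrix.of_apply, if_pos hc, T_mul_apply, hk0, div_eq_zero_iff] at hD
        refine hsum ?_
        have := hD.resolve_right (by linarith)
        linarith
      · have h1 := M.residual_W hfin k q
        rw [residual, T_mul_apply, hc, hk0] at h1
        refine hsum ?_
        linarith
      · exact absurd hk0 (M.W_pos_of_up hirr hfin hc hq).ne'
  exact (M.W_pos_of_up hirr hfin hi hj).ne' (key i j hj h)

/-- By irreducibility, a single bounded entry of the derivative of `Ψ` makes all the entries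
bounded. -/
theorem BddV.all (hirr : M.Irreducible) (hT : ∀ i, M.T i i ≠ 0)
    (hσ : ∀ z, σ < z → M.PassFinite z) {i j : Fin n} (hi : 0 < M.c i) (hj : M.c j < 0)
    (h : M.BddV σ i j) (k : Fin n) {r : Fin n} (hr : M.c r < 0) : M.BddV σ k r := by
  have hir := h.row hirr hT hσ hi hj hr
  refine hirr.induction_tail (p := fun k => M.BddV σ k r) hir ?_ k
  intro k l hkl hpos hk
  have hrate := M.rate_pos hkl hpos
  rcases lt_trichotomy (M.c k) 0 with hc | hc | hc
  · exact hir.step_down hirr hT hσ hi hr hc hrate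
  · exact hk.step_flat hT hσ hc hrate
  · exact hk.step_up hT hσ hc hr hrate

/-- If the derivative is bounded, then the terms of second order in the expansion of the residual
are dominated by `W`. -/
theorem exists_second_order_bound (hirr : M.Irreducible) (hT : ∀ i, M.T i i ≠ 0)
    (hσ : ∀ z, σ < z → M.PassFinite z) {i₀ : Fin n} (hi₀ : 0 < M.c i₀)
    (hall : ∀ k r, M.c r < 0 → M.BddV σ k r) (k j : Fin n) (hk : 0 ≤ M.c k) :
    ∃ C, ∀ s ∈ Set.Ioc σ (σ + 1),
      M.V s k j + M.c k * (M.V s * M.downGen' s) k j ≤ C * M.W s k j := by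
  have hfin := hσ (σ + 1) (by linarith)
  by_cases hW : M.W (σ + 1) k j = 0
  · refine ⟨0, fun s hs => ?_⟩
    rw [(M.W_V_eq_zero hT hfin hW s).2, zero_mul, zero_add]
    rcases hk.eq_or_lt with hc | hc
    · rw [← hc, zero_mul]
    · -- a zero entry in a row of positive rate belongs to a zero column
      have hj : 0 ≤ M.c j := by
        by_contra hj
        exact (M.W_pos_of_up hirr hfin hc (not_le.1 hj)).ne' hW
      have hcol : ∀ l, M.V s l j = 0 := fun l =>
        (M.W_V_eq_zero hT hfin (M.W_of_nonneg _ l hj) s).2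
      have hG : ∀ q, M.downGen' s q j = 0 := by
        intro q
        rw [downGen', Matrix.of_apply, Matrix.mul_apply, M.W_of_nonneg s q hj]
        simp [hcol]
      rw [Matrix.mul_apply]
      simp [hG]
  · have hj : M.c j < 0 := by
      by_contra hj
      exact hW (M.W_of_nonneg _ k (not_lt.1 hj))
    have hw : 0 < M.W (σ + 1) k j := lt_of_le_of_ne (M.W_nonneg _ k j) (Ne.symm hW)
    -- all the entries involved are bounded, and `W` is bounded below
    have hV : ∀ q, ∃ b, ∀ s ∈ Set.Ioc σ (σ + 1), M.V s k q ≤ b := by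
      intro q
      by_cases hq : M.c q < 0
      · exact hall k q hq
      · exact ⟨0, fun s _ =>
          (M.W_V_eq_zero hT hfin (M.W_of_nonneg _ k (not_lt.1 hq)) s).2.le⟩
    have hG : ∀ q, ∃ g, ∀ s ∈ Set.Ioc σ (σ + 1), M.downGen' s q j ≤ g := by
      intro q
      by_cases hq : M.c q < 0
      · exact (hall i₀ j hj).downGen'_bounded hirr hT hσ hi₀ hj hq
      · refine ⟨0, fun s _ => ?_⟩
        rw [downGen', Matrix.of_apply, if_neg hq]
    choose b hb using hV
    choose g hg using hG
    have hσ1 : σ + 1 ∈ Set.Ioc σ (σ + 1) := ⟨by linarith, le_rfl⟩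
    have hb0 : ∀ q, 0 ≤ b q := fun q => (M.V_nonneg _ k q).trans (hb q _ hσ1)
    have hg0 : ∀ q, 0 ≤ g q := fun q => (M.downGen'_nonneg hT hσ hσ1.1 q j).trans (hg q _ hσ1)
    have hB0 : 0 ≤ b j + M.c k * ∑ q, b q * g q :=
      add_nonneg (hb0 j) (mul_nonneg hk (Finset.sum_nonneg fun q _ => mul_nonneg (hb0 q) (hg0 q)))
    refine ⟨(b j + M.c k * ∑ q, b q * g q) / M.W (σ + 1) k j, fun s hs => ?_⟩
    have h1 : M.V s k j + M.c k * (M.V s * M.downGen' s) k j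
        ≤ b j + M.c k * ∑ q, b q * g q := by
      rw [Matrix.mul_apply]
      refine add_le_add (hb j s hs) (mul_le_mul_of_nonneg_left (Finset.sum_le_sum fun q _ => ?_) hk)
      exact mul_le_mul (hb q s hs) (hg q s hs) (M.downGen'_nonneg hT hσ hs.1 q j) (hb0 q)
    refine h1.trans ?_
    rw [div_mul_eq_mul_div, le_div_iff₀ hw]
    exact mul_le_mul_of_nonneg_left (M.W_anti hT (hσ s hs.1) hs.2 k j) hB0

/-- If the derivative were bounded, then `W s + ε V s` would be a supersolution of the matrix
equation at `s - ε ^ 2`, with `ε` independent of `s`, and the transforms would be finite to the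
left of the singularity. -/
theorem passFinite_of_bddV (hirr : M.Irreducible) (hT : ∀ i, M.T i i ≠ 0)
    (hσ : ∀ z, σ < z → M.PassFinite z) {i₀ : Fin n} (hi₀ : 0 < M.c i₀)
    (hall : ∀ k r, M.c r < 0 → M.BddV σ k r) : ∃ z < σ, M.PassFinite z := by
  have hC : ∀ k j, ∃ C, 0 ≤ M.c k → ∀ s ∈ Set.Ioc σ (σ + 1),
      M.V s k j + M.c k * (M.V s * M.downGen' s) k j ≤ C * M.W s k j := by
    intro k j
    by_cases hk : 0 ≤ M.c k
    · obtain ⟨C, h⟩ := exists_second_order_bound hirr hT hσ hi₀ hall k j hk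
      exact ⟨C, fun _ => h⟩
    · exact ⟨0, fun h => absurd h hk⟩
  choose C hC using hC
  -- `ε (1 + B) = 1` makes the terms of second order at most `ε W s`, which is gained in those of
  -- first order by the term `W s` of `deriv_equation`
  set B := ∑ k, ∑ j, |C k j| with hB
  have hCB : ∀ k j, C k j ≤ B := fun k j =>
    (le_abs_self _).trans ((Finset.single_le_sum (f := fun j => |C k j|)
      (fun j _ => abs_nonneg _) (Finset.mem_univ j)).trans (Finset.single_le_sum
        (f := fun k => ∑ j, |C k j|) (fun k _ => Finset.sum_nonneg fun j _ => abs_nonneg _)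
        (Finset.mem_univ k)))
  have hB0 : 0 ≤ B := Finset.sum_nonneg fun k _ => Finset.sum_nonneg fun j _ => abs_nonneg _
  set ε := 1 / (1 + B) with hε
  have hε0 : 0 < ε := by positivity
  have hε1 : ε ≤ 1 := by
    rw [hε, div_le_one (by linarith)]
    linarith
  have hεB : ε * (1 + B) = 1 := one_div_mul_cancel (by linarith)
  set s := σ + ε ^ 2 / 2 with hs_def
  have hs : s ∈ Set.Ioc σ (σ + 1) := by
    constructor
    · have : 0 < ε ^ 2 := by positivity
      linarith
    · have : ε ^ 2 ≤ 1 := pow_le_one₀ hε0.le hε1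
      linarith
  refine ⟨s - ε ^ 2, ?_, ?_⟩
  · have : 0 < ε ^ 2 := by positivity
    linarith
  set A : Matrix (Fin n) (Fin n) ℝ := M.W s + ε • M.V s with hA
  have hAapply : ∀ k j, A k j = M.W s k j + ε * M.V s k j := fun k j => rfl
  have hA0 : ∀ k j, 0 ≤ A k j := fun k j =>
    add_nonneg (M.W_nonneg s k j) (mul_nonneg hε0.le (M.V_nonneg s k j))
  have hdown : ∀ k, M.c k < 0 → ∀ j, A k j = if k = j then 1 else 0 := by
    intro k hk j
    rw [hAapply, M.V_of_neg hT hσ hs.1 hk, mul_zero, add_zero, M.W_of_neg s hk]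
  have hTA : ∀ k j, (M.T * A) k j = (M.T * M.W s) k j + ε * (M.T * M.V s) k j := by
    intro k j
    rw [hA, Matrix.mul_add, Matrix.mul_smul]
    rfl
  refine M.passFinite_of_residual_nonpos _ hA0 hdown fun k j => ?_
  rcases lt_or_ge (M.c k) 0 with hk | hk
  · exact (M.residual_of_neg _ hk (hdown k hk) j).le
  -- the expansion of `downGen` and of the product with it, up to second order in `ε`
  have hgen : ∀ q, M.downGen (s - ε ^ 2) A q j
      ≤ M.downGen s (M.W s) q j + ε * M.downGen' s q j := by
    intro q
    simp only [downGen, downGen', Matrix.of_apply]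
    split_ifs with hq
    · rw [hTA, hAapply, M.V_of_neg hT hσ hs.1 hq, mul_zero, add_zero, ← mul_div_assoc, ← add_div]
      refine div_le_div_of_nonneg_right ?_ (by linarith)
      have h1 := M.W_nonneg s q j
      have h2 : ε ^ 2 * M.W s q j ≤ ε * M.W s q j :=
        mul_le_mul_of_nonneg_right (by nlinarith) h1
      linarith
    · simp
  have hmul : (A * M.downGen (s - ε ^ 2) A) k j
      ≤ (M.W s * M.downGen s (M.W s)) k j + ε * ((M.V s * M.downGen s (M.W s)) k j
        + (M.W s * M.downGen' s) k j) + ε ^ 2 * (M.V s * M.downGen' s) k j := by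
    have h1 : (A * M.downGen (s - ε ^ 2) A) k j
        ≤ ∑ q, A k q * (M.downGen s (M.W s) q j + ε * M.downGen' s q j) := by
      rw [Matrix.mul_apply]
      exact Finset.sum_le_sum fun q _ => mul_le_mul_of_nonneg_left (hgen q) (hA0 k q)
    refine h1.trans (le_of_eq ?_)
    simp only [Matrix.mul_apply, hAapply, Finset.mul_sum, ← Finset.sum_add_distrib]
    refine Finset.sum_congr rfl fun q _ => ?_
    ring
  have h1 := M.residual_W (hσ s hs.1) k j
  have h2 := deriv_equation M hT hσ hs.1 k j
  have h3 := hC k j hk s hs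
  have hW := M.W_nonneg s k j
  have hV := M.V_nonneg s k j
  have h4 : ε * (M.W s k j + ε * M.V s k j + M.c k * (M.V s * M.downGen' s) k j)
      ≤ M.W s k j := by
    calc ε * (M.W s k j + ε * M.V s k j + M.c k * (M.V s * M.downGen' s) k j)
        ≤ ε * (M.W s k j + B * M.W s k j) := by
          refine mul_le_mul_of_nonneg_left ?_ hε0.le
          have h5 := mul_le_mul_of_nonneg_right (hCB k j) hW
          have h6 : ε * M.V s k j ≤ M.V s k j := mul_le_of_le_one_left hV hε1
          linarith
      _ = ε * (1 + B) * M.W s k j := by ring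
      _ = M.W s k j := by rw [hεB, one_mul]
  have h5 := mul_le_mul_of_nonneg_left hmul hk
  rw [residual] at h1 ⊢
  rw [hTA, hAapply]
  have h6 := mul_le_mul_of_nonneg_left h4 hε0.le
  have h7 : ε * ((M.T * M.V s) k j - s * M.V s k j + M.W s k j + M.c k *
      ((M.V s * M.downGen s (M.W s)) k j + (M.W s * M.downGen' s) k j)) = 0 := by
    rw [h2, mul_zero]
  nlinarith

/-- The derivative is monotone in `s`, so that an entry which does not diverge at the singularity is
bounded; then all the entries are bounded, which contradicts `passFinite_of_bddV`. -/
theorem tendsto_V (hirr : M.Irreducible) (hT : ∀ i, M.T i i ≠ 0)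
    (hσ : ∀ z, M.PassFinite z ↔ σ ≤ z) {i j : Fin n} (hi : 0 < M.c i) (hj : M.c j < 0) :
    Filter.Tendsto (fun s => M.V s i j) (𝓝[>] σ) Filter.atTop := by
  have hσ' : ∀ z, σ < z → M.PassFinite z := fun z hz => (hσ z).2 hz.le
  by_contra h
  rw [Filter.tendsto_atTop] at h
  push Not at h
  obtain ⟨b, hb⟩ := h
  have hbdd : M.BddV σ i j := by
    refine ⟨b, fun s hs => ?_⟩
    obtain ⟨z, hzb, hz⟩ := (hb.and_eventually (Ioo_mem_nhdsGT hs.1)).exists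
    exact (M.V_anti hT hσ' hz.1 hz.2.le i j).trans (le_of_lt hzb)
  obtain ⟨z, hz, hfin⟩ := passFinite_of_bddV hirr hT hσ' hi
    fun k r hr => hbdd.all hirr hT hσ' hi hj k hr
  exact absurd ((hσ z).1 hfin) (not_le.2 hz)

end

end FluidModel

/-! ### Quasi-positive linear maps -/

/-- The M-matrix criterion, for linear maps of matrices: if `L` is quasi-positive and maps a
nonnegative `v` to a negative matrix, then `-L` is inverse-positive. -/
theorem Matrix.nonneg_of_quasipositive {ι κ : Type*} [Finite ι] [Finite κ]
    (L : Matrix ι κ ℝ →ₗ[ℝ] Matrix ι κ ℝ)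
    (hL : ∀ x : Matrix ι κ ℝ, (∀ i j, 0 ≤ x i j) → ∀ i j, x i j = 0 → 0 ≤ L x i j)
    {v : Matrix ι κ ℝ} (hv : ∀ i j, 0 ≤ v i j) (hLv : ∀ i j, L v i j < 0)
    {x : Matrix ι κ ℝ} (hx : ∀ i j, L x i j ≤ 0) (i : ι) (j : κ) : 0 ≤ x i j := by
  have hv0 : ∀ i j, 0 < v i j := fun i j =>
    lt_of_le_of_ne (hv i j) fun h => absurd (hL v hv i j h.symm) (not_le.2 (hLv i j))
  have : Nonempty (ι × κ) := ⟨(i, j)⟩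
  -- at the minimum `m` of `x / v`, the nonnegative matrix `x - m • v` vanishes
  obtain ⟨⟨a, b⟩, hab⟩ := Finite.exists_min fun q : ι × κ => x q.1 q.2 / v q.1 q.2
  set m := x a b / v a b with hm
  have hle : ∀ i j, m * v i j ≤ x i j := fun i j => (le_div_iff₀ (hv0 i j)).1 (hab (i, j))
  have h0 := hL (x - m • v) (fun i j => sub_nonneg.2 (hle i j)) a b
    (sub_eq_zero.2 (div_mul_cancel₀ _ (hv0 a b).ne').symm)
  rw [map_sub, map_smul, Matrix.sub_apply, Matrix.smul_apply, smul_eq_mul] at h0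
  have hm0 : 0 ≤ m := by
    by_contra h
    have h1 := hx a b
    have h2 := mul_pos_of_neg_of_neg (not_le.1 h) (hLv a b)
    linarith
  exact (mul_nonneg hm0 (hv i j)).trans (hle i j)

theorem Matrix.eq_zero_of_quasipositive {ι κ : Type*} [Finite ι] [Finite κ]
    (L : Matrix ι κ ℝ →ₗ[ℝ] Matrix ι κ ℝ)
    (hL : ∀ x : Matrix ι κ ℝ, (∀ i j, 0 ≤ x i j) → ∀ i j, x i j = 0 → 0 ≤ L x i j)
    {v : Matrix ι κ ℝ} (hv : ∀ i j, 0 ≤ v i j) (hLv : ∀ i j, L v i j < 0)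
    {x : Matrix ι κ ℝ} (hx : L x = 0) : x = 0 := by
  ext i j
  have h1 := Matrix.nonneg_of_quasipositive L hL hv hLv (x := x) (by simp [hx]) i j
  have h2 := Matrix.nonneg_of_quasipositive L hL hv hLv (x := -x) (by simp [hx]) i j
  exact le_antisymm (neg_nonneg.1 h2) h1

theorem Matrix.mul_apply_nonneg {ι κ τ : Type*} [Fintype κ] {A : Matrix ι κ ℝ} {B : Matrix κ τ ℝ}
    (hA : ∀ i j, 0 ≤ A i j) (hB : ∀ i j, 0 ≤ B i j) (i : ι) (j : τ) : 0 ≤ (A * B) i j :=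
  Finset.sum_nonneg fun l _ => mul_nonneg (hA i l) (hB l j)

theorem Matrix.mul_apply_nonneg_left {ι κ : Type*} [Fintype ι] {A : Matrix ι ι ℝ}
    {X : Matrix ι κ ℝ} (hA : ∀ i j, i ≠ j → 0 ≤ A i j) (hX : ∀ i j, 0 ≤ X i j) {i : ι} {j : κ}
    (h : X i j = 0) : 0 ≤ (A * X) i j := by
  rw [Matrix.mul_apply]
  refine Finset.sum_nonneg fun l _ => ?_
  by_cases hl : i = l
  · rw [← hl, h, mul_zero]
  · exact mul_nonneg (hA i l hl) (hX l j)

theorem Matrix.mul_apply_nonneg_right {ι κ : Type*} [Fintype κ] {A : Matrix κ κ ℝ}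
    {X : Matrix ι κ ℝ} (hA : ∀ i j, i ≠ j → 0 ≤ A i j) (hX : ∀ i j, 0 ≤ X i j) {i : ι} {j : κ}
    (h : X i j = 0) : 0 ≤ (X * A) i j := by
  rw [Matrix.mul_apply]
  refine Finset.sum_nonneg fun l _ => ?_
  by_cases hl : l = j
  · rw [hl, h, zero_mul]
  · exact mul_nonneg (hX i l) (hA l j hl)

/-- The Sylvester operator `X ↦ K X + X D`. -/
def Matrix.sylvester {ι κ : Type*} [Fintype ι] [Fintype κ] (K : Matrix ι ι ℝ)
    (D : Matrix κ κ ℝ) : Matrix ι κ ℝ →ₗ[ℝ] Matrix ι κ ℝ where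
  toFun X := K * X + X * D
  map_add' X Y := by
    rw [Matrix.mul_add, Matrix.add_mul]
    abel
  map_smul' a X := by
    rw [Matrix.mul_smul, Matrix.smul_mul, ← smul_add]
    rfl

namespace FluidModel
variable {n : ℕ}

/-! ### Elimination of the phases of rate zero -/

/-- The block of `A` with rows and columns from two classes of phases. -/
abbrev part (A : Matrix (Fin n) (Fin n) ℝ) (p q : Fin n → Prop) :
    Matrix {i // p i} {j // q j} ℝ :=
  A.submatrix Subtype.val Subtype.val

theorem sum_split (M : FluidModel n) (f : Fin n → ℝ) :
    ∑ l, f l = ∑ i : M.Up, f i + ∑ j : M.Down, f j + ∑ k : M.Flat, f k := by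
  have h1 : ∑ i : M.Up, f i = ∑ l, if 0 < M.c l then f l else 0 := by
    rw [← Finset.sum_filter]
    exact (Finset.sum_subtype _ (by simp) f).symm
  have h2 : ∑ i : M.Down, f i = ∑ l, if M.c l < 0 then f l else 0 := by
    rw [← Finset.sum_filter]
    exact (Finset.sum_subtype _ (by simp) f).symm
  have h3 : ∑ i : M.Flat, f i = ∑ l, if M.c l = 0 then f l else 0 := by
    rw [← Finset.sum_filter]
    exact (Finset.sum_subtype _ (by simp) f).symm
  rw [h1, h2, h3, ← Finset.sum_add_distrib, ← Finset.sum_add_distrib]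
  refine Finset.sum_congr rfl fun l _ => ?_
  rcases lt_trichotomy (M.c l) 0 with h | h | h
  · simp [h, h.ne, h.le]
  · simp [h]
  · simp [h, h.ne', h.le]

theorem part_mul (M : FluidModel n) (A B : Matrix (Fin n) (Fin n) ℝ) (p q : Fin n → Prop) :
    part (A * B) p q = part A p (fun i => 0 < M.c i) * part B (fun i => 0 < M.c i) q
      + part A p (fun i => M.c i < 0) * part B (fun i => M.c i < 0) q
      + part A p (fun i => M.c i = 0) * part B (fun i => M.c i = 0) q := by
  ext i j
  exact M.sum_split fun l => A i l * B l j

theorem C1_inv (M : FluidModel n) : M.C1⁻¹ = Matrix.diagonal fun i : M.Up => (M.c i)⁻¹ := by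
  refine Matrix.inv_eq_right_inv ?_
  rw [C1, Matrix.diagonal_mul_diagonal, ← Matrix.diagonal_one]
  congr 1
  ext i
  exact mul_inv_cancel₀ i.2.ne'

theorem C2_inv (M : FluidModel n) : M.C2⁻¹ = Matrix.diagonal fun i : M.Down => |M.c i|⁻¹ := by
  refine Matrix.inv_eq_right_inv ?_
  rw [C2, Matrix.diagonal_mul_diagonal, ← Matrix.diagonal_one]
  congr 1
  ext i
  exact mul_inv_cancel₀ (abs_pos.2 i.2.ne).ne'

theorem C1_inv_mul_cancel (M : FluidModel n) (A : Matrix M.Up M.Down ℝ) :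
    M.C1⁻¹ * (M.C1 * A) = A := by
  ext i j
  rw [C1_inv, C1, Matrix.diagonal_mul, Matrix.diagonal_mul, inv_mul_cancel_left₀ i.2.ne']

theorem C1_inv_nonneg (M : FluidModel n) (i j : M.Up) : 0 ≤ M.C1⁻¹ i j := by
  rw [C1_inv, Matrix.diagonal_apply]
  split_ifs
  · exact inv_nonneg.2 i.2.le
  · exact le_rfl

theorem C2_inv_nonneg (M : FluidModel n) (i j : M.Down) : 0 ≤ M.C2⁻¹ i j := by
  rw [C2_inv, Matrix.diagonal_apply]
  split_ifs
  · exact inv_nonneg.2 (abs_nonneg _)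
  · exact le_rfl

/-- Between two different classes of phases the generator is nonnegative. -/
theorem block_nonneg (M : FluidModel n) {p q : Fin n → Prop} (h : ∀ i, p i → ¬ q i)
    (i : {i // p i}) (j : {j // q j}) : 0 ≤ M.block p q i j :=
  M.offDiag_nonneg _ _ fun e => h i i.2 (e ▸ j.2)

theorem R_offDiag_nonneg (M : FluidModel n) (s : ℝ) (i j : M.Flat) (hij : i ≠ j) :
    0 ≤ M.R s i j := by
  rw [R, Matrix.sub_apply, Matrix.smul_apply, Matrix.one_apply_ne hij, smul_zero, sub_zero]
  exact M.offDiag_nonneg _ _ fun e => hij (Subtype.ext e)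

section

variable {M : FluidModel n} {σ s : ℝ}

/-- The row sums of `V` are a witness that `-R s` is a nonsingular M-matrix. -/
theorem R_mul_rowSum_neg (hirr : M.Irreducible) (hT : ∀ i, M.T i i ≠ 0)
    (hσ : ∀ z, σ < z → M.PassFinite z) {j₀ : Fin n} (hj₀ : M.c j₀ < 0) (hs : σ < s)
    (k l : M.Flat) :
    (M.R s * Matrix.of fun (i _ : M.Flat) => ∑ j, M.V s i j) k l < 0 := by
  have h1 : ∑ m, M.T k m * ∑ j, M.V s m j - s * ∑ j, M.V s k j + ∑ j, M.W s k j = 0 := by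
    have h2 : ∑ j, ((M.T * M.V s) k j - s * M.V s k j + M.W s k j) = 0 := by
      refine Finset.sum_eq_zero fun j _ => ?_
      have h := deriv_equation M hT hσ hs k j
      rwa [k.2, zero_mul, add_zero] at h
    rw [Finset.sum_add_distrib, Finset.sum_sub_distrib, ← Finset.mul_sum] at h2
    simp only [Matrix.mul_apply] at h2
    rw [Finset.sum_comm] at h2
    simp only [Finset.mul_sum] at h2 ⊢
    exact h2
  have hW : 0 < ∑ j, M.W s k j := by
    obtain ⟨j, _, hpos⟩ := M.exists_F_zero_pos hirr s hj₀ k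
    exact Finset.sum_pos' (fun j _ => M.W_nonneg s k j)
      ⟨j, Finset.mem_univ j, ENNReal.toReal_pos hpos.ne' (hσ s hs k 0 le_rfl j).ne⟩
  rw [M.sum_split] at h1
  have hup : 0 ≤ ∑ i : M.Up, M.T k i * ∑ j, M.V s i j :=
    Finset.sum_nonneg fun i _ => mul_nonneg
      (M.offDiag_nonneg _ _ fun e => (e ▸ i.2 : 0 < M.c k).ne' k.2)
      (Finset.sum_nonneg fun j _ => M.V_nonneg s i j)
  have hdown : ∑ i : M.Down, M.T k i * ∑ j, M.V s i j = 0 := by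
    refine Finset.sum_eq_zero fun i _ => ?_
    rw [Finset.sum_eq_zero fun j _ => M.V_of_neg hT hσ hs i.2 j, mul_zero]
  have hR : (M.R s * Matrix.of fun (i _ : M.Flat) => ∑ j, M.V s i j) k l
      = ∑ i : M.Flat, M.T k i * ∑ j, M.V s i j - s * ∑ j, M.V s k j := by
    rw [R, Matrix.sub_mul, Matrix.smul_mul, Matrix.one_mul]
    rfl
  rw [hR]
  linarith

theorem R_mulLeft_quasipositive (M : FluidModel n) (s : ℝ) (x : Matrix M.Flat M.Flat ℝ)
    (hx : ∀ i j, 0 ≤ x i j) (i j : M.Flat) (h : x i j = 0) :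
    0 ≤ LinearMap.mulLeft ℝ (M.R s) x i j :=
  Matrix.mul_apply_nonneg_left (M.R_offDiag_nonneg s) hx h

theorem isUnit_R (hirr : M.Irreducible) (hT : ∀ i, M.T i i ≠ 0)
    (hσ : ∀ z, σ < z → M.PassFinite z) {j₀ : Fin n} (hj₀ : M.c j₀ < 0) (hs : σ < s) :
    IsUnit (M.R s) := by
  have hinj : Function.Injective (LinearMap.mulLeft ℝ (M.R s)) :=
    (injective_iff_map_eq_zero _).2 fun x hx =>
      Matrix.eq_zero_of_quasipositive (v := Matrix.of fun i _ => ∑ j, M.V s i j) _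
        (M.R_mulLeft_quasipositive s)
        (fun i j => Finset.sum_nonneg fun j _ => M.V_nonneg s i j)
        (R_mul_rowSum_neg hirr hT hσ hj₀ hs) hx
  obtain ⟨X, hX⟩ := LinearMap.surjective_of_injective hinj 1
  exact (Matrix.isUnit_iff_isUnit_det _).2 (Matrix.isUnit_det_of_right_inverse hX)

theorem neg_R_inv_nonneg (hirr : M.Irreducible) (hT : ∀ i, M.T i i ≠ 0)
    (hσ : ∀ z, σ < z → M.PassFinite z) {j₀ : Fin n} (hj₀ : M.c j₀ < 0) (hs : σ < s)
    (k l : M.Flat) : 0 ≤ (-(M.R s)⁻¹) k l := by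
  refine Matrix.nonneg_of_quasipositive (v := Matrix.of fun i _ => ∑ j, M.V s i j) _
    (M.R_mulLeft_quasipositive s)
    (fun i j => Finset.sum_nonneg fun j _ => M.V_nonneg s i j)
    (R_mul_rowSum_neg hirr hT hσ hj₀ hs) (fun i j => ?_) k l
  rw [LinearMap.mulLeft_apply, Matrix.mul_neg,
    Matrix.mul_nonsing_inv _ ((Matrix.isUnit_iff_isUnit_det _).1 (isUnit_R hirr hT hσ hj₀ hs)),
    Matrix.neg_apply, Matrix.one_apply]
  split_ifs <;> norm_num

theorem Psi_eq_W (hT : ∀ i, M.T i i ≠ 0) (s : ℝ) :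
    M.Psi s = part (M.W s) (fun i => 0 < M.c i) (fun i => M.c i < 0) := by
  ext i j
  simp only [Psi, W, Matrix.of_apply, Matrix.submatrix_apply, M.psiENN_eq_F hT]

theorem part_W_down (M : FluidModel n) (s : ℝ) :
    part (M.W s) (fun i => M.c i < 0) (fun i => M.c i < 0) = 1 := by
  ext i j
  refine (M.W_of_neg s i.2 j).trans ?_
  rw [Matrix.one_apply]
  simp only [Subtype.ext_iff]

theorem part_eq_zero {A : Matrix (Fin n) (Fin n) ℝ} {p q : Fin n → Prop}
    (h : ∀ i, p i → ∀ j, A i j = 0) : part A p q = 0 := by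
  ext i j
  exact h i i.2 j

theorem part_downGen_eq_zero (M : FluidModel n) (s : ℝ) (A : Matrix (Fin n) (Fin n) ℝ)
    {p q : Fin n → Prop} (h : ∀ i, p i → ¬ M.c i < 0) : part (M.downGen s A) p q = 0 :=
  part_eq_zero fun i hi _ => if_neg (h i hi)

theorem part_downGen'_eq_zero (M : FluidModel n) (s : ℝ) {p q : Fin n → Prop}
    (h : ∀ i, p i → ¬ M.c i < 0) : part (M.downGen' s) p q = 0 :=
  part_eq_zero fun i hi _ => if_neg (h i hi)

theorem part_V_down (hT : ∀ i, M.T i i ≠ 0) (hσ : ∀ z, σ < z → M.PassFinite z) (hs : σ < s) :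
    part (M.V s) (fun i => M.c i < 0) (fun i => M.c i < 0) = 0 :=
  part_eq_zero fun _ hi j => M.V_of_neg hT hσ hs hi j

/-- The rows of rate zero of the matrix equation, solved for the transforms from these phases. -/
theorem W_flat_eq (hT : ∀ i, M.T i i ≠ 0) (hs : M.PassFinite s) (hR : IsUnit (M.R s)) :
    part (M.W s) (fun i => M.c i = 0) (fun i => M.c i < 0)
      = -((M.R s)⁻¹ * (M.T01 * M.Psi s + M.T02)) := by
  set W0 := part (M.W s) (fun i => M.c i = 0) (fun i => M.c i < 0) with hW0
  have h1 : M.T01 * M.Psi s + M.T02 + M.R s * W0 = 0 := by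
    have h2 := M.part_mul M.T (M.W s) (fun i => M.c i = 0) (fun i => M.c i < 0)
    rw [part_W_down, ← Psi_eq_W hT, Matrix.mul_one] at h2
    have h3 : part (M.T * M.W s) (fun i => M.c i = 0) (fun i => M.c i < 0) - s • W0 = 0 := by
      ext k j
      have h := M.residual_W hs k j
      rwa [residual, k.2, zero_mul, add_zero] at h
    rw [h2] at h3
    rw [R, Matrix.sub_mul, Matrix.smul_mul, Matrix.one_mul, ← h3]
    exact (add_sub_assoc _ _ _).symm
  have hdet := (Matrix.isUnit_iff_isUnit_det _).1 hR
  rw [← Matrix.mul_neg, ← eq_neg_of_add_eq_zero_right h1,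
    Matrix.nonsing_inv_mul_cancel_left _ _ hdet]

/-- The rows of rate zero of `deriv_equation`, solved for the entries of `V` in these rows. -/
theorem V_flat_eq (hT : ∀ i, M.T i i ≠ 0) (hσ : ∀ z, σ < z → M.PassFinite z) (hs : σ < s)
    (hR : IsUnit (M.R s)) :
    part (M.V s) (fun i => M.c i = 0) (fun i => M.c i < 0)
      = -((M.R s)⁻¹ * (M.T01 * part (M.V s) (fun i => 0 < M.c i) (fun i => M.c i < 0)
        + part (M.W s) (fun i => M.c i = 0) (fun i => M.c i < 0))) := by
  set V0 := part (M.V s) (fun i => M.c i = 0) (fun i => M.c i < 0) with hV0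
  set V1 := part (M.V s) (fun i => 0 < M.c i) (fun i => M.c i < 0) with hV1
  set W0 := part (M.W s) (fun i => M.c i = 0) (fun i => M.c i < 0) with hW0
  have h1 : M.T01 * V1 + W0 + M.R s * V0 = 0 := by
    have h2 := M.part_mul M.T (M.V s) (fun i => M.c i = 0) (fun i => M.c i < 0)
    rw [part_V_down hT hσ hs, Matrix.mul_zero, add_zero] at h2
    have h3 : part (M.T * M.V s) (fun i => M.c i = 0) (fun i => M.c i < 0) - s • V0 + W0 = 0 := by
      ext k j
      have h := deriv_equation M hT hσ hs k j
      rwa [k.2, zero_mul, add_zero] at h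
    rw [h2] at h3
    rw [R, Matrix.sub_mul, Matrix.smul_mul, Matrix.one_mul, ← h3]
    change M.T01 * V1 + W0 + (M.T00 * V0 - s • V0) = M.T01 * V1 + M.T00 * V0 - s • V0 + W0
    abel
  have hdet := (Matrix.isUnit_iff_isUnit_det _).1 hR
  rw [← Matrix.mul_neg, ← eq_neg_of_add_eq_zero_right h1,
    Matrix.nonsing_inv_mul_cancel_left _ _ hdet]

theorem D_eq_downGen (hT : ∀ i, M.T i i ≠ 0) (hs : M.PassFinite s) (hR : IsUnit (M.R s)) :
    M.D s = part (M.downGen s (M.W s)) (fun i => M.c i < 0) (fun i => M.c i < 0) := by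
  have h1 : part (M.downGen s (M.W s)) (fun i => M.c i < 0) (fun i => M.c i < 0)
      = M.C2⁻¹ * (part (M.T * M.W s) (fun i => M.c i < 0) (fun i => M.c i < 0)
        - s • (1 : Matrix M.Down M.Down ℝ)) := by
    ext r j
    rw [← M.part_W_down s, C2_inv, Matrix.diagonal_mul, abs_of_neg r.2, ← div_eq_inv_mul]
    exact if_pos r.2
  rw [h1, M.part_mul, part_W_down, ← Psi_eq_W hT, W_flat_eq hT hs hR, D, Q22, Q21]
  change _ = M.C2⁻¹ * (M.T21 * M.Psi s + M.T22 * 1 + M.T20 * _ - s • 1)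
  simp only [Matrix.mul_add, Matrix.mul_sub, Matrix.sub_mul, Matrix.mul_neg, Matrix.mul_one,
    Matrix.mul_assoc]
  abel

theorem downGen'_eq (M : FluidModel n) (hT : ∀ i, M.T i i ≠ 0)
    (hσ : ∀ z, σ < z → M.PassFinite z) (hs : σ < s) :
    part (M.downGen' s) (fun i => M.c i < 0) (fun i => M.c i < 0)
      = M.C2⁻¹ * (M.T21 * part (M.V s) (fun i => 0 < M.c i) (fun i => M.c i < 0)
        + M.T20 * part (M.V s) (fun i => M.c i = 0) (fun i => M.c i < 0) + 1) := by
  have h1 : part (M.downGen' s) (fun i => M.c i < 0) (fun i => M.c i < 0)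
      = M.C2⁻¹ * (part (M.T * M.V s) (fun i => M.c i < 0) (fun i => M.c i < 0) + 1) := by
    ext r j
    rw [← M.part_W_down s, C2_inv, Matrix.diagonal_mul, abs_of_neg r.2, ← div_eq_inv_mul]
    exact if_pos r.2
  rw [h1, M.part_mul, part_V_down hT hσ hs, Matrix.mul_zero, add_zero]
  rfl

/-- The rows of positive rate of `deriv_equation`, after the rows of rate zero have been
eliminated. -/
theorem K_mul_V (hT : ∀ i, M.T i i ≠ 0) (hσ : ∀ z, σ < z → M.PassFinite z) (hs : σ < s)
    (hR : IsUnit (M.R s)) :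
    M.K s * part (M.V s) (fun i => 0 < M.c i) (fun i => M.c i < 0)
      + part (M.V s) (fun i => 0 < M.c i) (fun i => M.c i < 0) * M.D s = -M.U s := by
  have hV0 := V_flat_eq hT hσ hs hR
  rw [W_flat_eq hT (hσ s hs) hR] at hV0
  have hG' := M.downGen'_eq hT hσ hs
  have hD := D_eq_downGen hT (hσ s hs) hR
  have hTV := M.part_mul M.T (M.V s) (fun i => 0 < M.c i) (fun i => M.c i < 0)
  have hVG := M.part_mul (M.V s) (M.downGen s (M.W s)) (fun i => 0 < M.c i) (fun i => M.c i < 0)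
  have hWG := M.part_mul (M.W s) (M.downGen' s) (fun i => 0 < M.c i) (fun i => M.c i < 0)
  rw [part_V_down hT hσ hs, Matrix.mul_zero, add_zero] at hTV
  rw [M.part_downGen_eq_zero s _ (p := fun i => 0 < M.c i) fun i hi => hi.not_gt,
    M.part_downGen_eq_zero s _ (p := fun i => M.c i = 0) fun i hi => hi.not_lt,
    Matrix.mul_zero, Matrix.mul_zero, zero_add, add_zero, ← hD] at hVG
  rw [M.part_downGen'_eq_zero s (p := fun i => 0 < M.c i) fun i hi => hi.not_gt,
    M.part_downGen'_eq_zero s (p := fun i => M.c i = 0) fun i hi => hi.not_lt,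
    Matrix.mul_zero, Matrix.mul_zero, zero_add, add_zero, ← Psi_eq_W hT, hG'] at hWG
  set V0 := part (M.V s) (fun i => M.c i = 0) (fun i => M.c i < 0)
  set V1 := part (M.V s) (fun i => 0 < M.c i) (fun i => M.c i < 0)
  have h1 : M.T11 * V1 + M.T10 * V0 - s • V1 + M.Psi s + M.C1 * (V1 * M.D s
      + M.Psi s * (M.C2⁻¹ * (M.T21 * V1 + M.T20 * V0 + 1))) = 0 := by
    rw [← hVG, ← hWG, Psi_eq_W hT, C1]
    change part M.T _ _ * V1 + part M.T _ _ * V0 - _ + _ + _ = 0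
    rw [← hTV]
    ext i j
    rw [Matrix.add_apply, Matrix.diagonal_mul]
    exact deriv_equation M hT hσ hs i j
  have h2 := congrArg (fun Y => M.C1⁻¹ * Y) h1
  rw [Matrix.mul_zero, Matrix.mul_add _ _ (M.C1 * _), C1_inv_mul_cancel] at h2
  rw [eq_neg_iff_add_eq_zero, ← h2, hV0, K, Q11, Q21, U, A11, A12, A21, A22]
  simp only [Matrix.mul_add, Matrix.add_mul, Matrix.mul_sub, Matrix.sub_mul, Matrix.mul_neg,
    Matrix.mul_one, Matrix.mul_assoc, Matrix.mul_smul, Matrix.smul_mul, sq, neg_add, neg_neg]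
  abel

/-! ### Unique solvability of the Sylvester equation -/

/-- `-T_a0 (R s)⁻¹ T_0b` is nonnegative: it describes the excursions through phases of rate
zero. -/
theorem flat_excursion_nonneg (hirr : M.Irreducible) (hT : ∀ i, M.T i i ≠ 0)
    (hσ : ∀ z, σ < z → M.PassFinite z) {j₀ : Fin n} (hj₀ : M.c j₀ < 0) (hs : σ < s)
    {p q : Fin n → Prop} (hp : ∀ i, p i → ¬ M.c i = 0) (hq : ∀ i, M.c i = 0 → ¬ q i)
    (i : {i // p i}) (j : {j // q j}) :
    0 ≤ (-(M.block p (fun i => M.c i = 0) * (M.R s)⁻¹ * M.block (fun i => M.c i = 0) q)) i j := by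
  rw [← Matrix.neg_mul, ← Matrix.mul_neg]
  exact Matrix.mul_apply_nonneg (Matrix.mul_apply_nonneg (M.block_nonneg hp)
    (neg_R_inv_nonneg hirr hT hσ hj₀ hs)) (M.block_nonneg hq) i j

theorem flat_excursion_sq_nonneg (hirr : M.Irreducible) (hT : ∀ i, M.T i i ≠ 0)
    (hσ : ∀ z, σ < z → M.PassFinite z) {j₀ : Fin n} (hj₀ : M.c j₀ < 0) (hs : σ < s)
    {p q : Fin n → Prop} (hp : ∀ i, p i → ¬ M.c i = 0) (hq : ∀ i, M.c i = 0 → ¬ q i)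
    (i : {i // p i}) (j : {j // q j}) :
    0 ≤ (M.block p (fun i => M.c i = 0) * (M.R s)⁻¹ ^ 2 * M.block (fun i => M.c i = 0) q :
      Matrix {i // p i} {j // q j} ℝ) i j := by
  have h := neg_R_inv_nonneg hirr hT hσ hj₀ hs
  rw [← neg_sq, sq]
  exact Matrix.mul_apply_nonneg (Matrix.mul_apply_nonneg (M.block_nonneg hp)
    (Matrix.mul_apply_nonneg h h)) (M.block_nonneg hq) i j

theorem Psi_nonneg (M : FluidModel n) (s : ℝ) (i : M.Up) (j : M.Down) : 0 ≤ M.Psi s i j :=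
  ENNReal.toReal_nonneg

theorem K_offDiag_nonneg (hirr : M.Irreducible) (hT : ∀ i, M.T i i ≠ 0)
    (hσ : ∀ z, σ < z → M.PassFinite z) {j₀ : Fin n} (hj₀ : M.c j₀ < 0) (hs : σ < s)
    (i l : M.Up) (hil : i ≠ l) : 0 ≤ M.K s i l := by
  refine add_nonneg ?_ (Matrix.mul_apply_nonneg (M.Psi_nonneg s)
    (Matrix.mul_apply_nonneg M.C2_inv_nonneg fun a b => ?_) i l)
  · rw [Q11, C1_inv, Matrix.diagonal_mul, Matrix.sub_apply, Matrix.sub_apply, Matrix.smul_apply,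
      Matrix.one_apply_ne hil, smul_zero, sub_zero]
    have h1 := flat_excursion_nonneg hirr hT hσ hj₀ hs (p := fun i => 0 < M.c i)
      (q := fun i => 0 < M.c i) (fun _ h => h.ne') (fun _ h => h.not_gt) i l
    have h2 : 0 ≤ M.T11 i l := M.offDiag_nonneg _ _ fun e => hil (Subtype.ext e)
    exact mul_nonneg (inv_nonneg.2 i.2.le) (by rw [sub_eq_add_neg]; exact add_nonneg h2 h1)
  · rw [sub_eq_add_neg]
    exact add_nonneg (M.block_nonneg (fun _ h => h.not_gt) a b)
      (flat_excursion_nonneg hirr hT hσ hj₀ hs (fun _ h => h.ne) (fun _ h => h.not_gt) a b)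

/-- `U s` is positive because of its term `C₁⁻¹ Ψ(s)`. -/
theorem U_pos (hirr : M.Irreducible) (hT : ∀ i, M.T i i ≠ 0)
    (hσ : ∀ z, σ < z → M.PassFinite z) {j₀ : Fin n} (hj₀ : M.c j₀ < 0) (hs : σ < s)
    (i : M.Up) (j : M.Down) : 0 < M.U s i j := by
  have hup : ∀ i, 0 < M.c i → ¬ M.c i = 0 := fun _ h => h.ne'
  have hup' : ∀ i, M.c i = 0 → ¬ 0 < M.c i := fun _ h => h.not_gt
  have hdn : ∀ i, M.c i < 0 → ¬ M.c i = 0 := fun _ h => h.ne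
  have hdn' : ∀ i, M.c i = 0 → ¬ M.c i < 0 := fun _ h => h.not_lt
  have h12 : 0 ≤ M.A12 s i j := Matrix.mul_apply_nonneg M.C1_inv_nonneg
    (flat_excursion_sq_nonneg hirr hT hσ hj₀ hs hup hdn') i j
  have h11 : 0 < (M.A11 s * M.Psi s) i j := by
    rw [A11, Matrix.mul_assoc, C1_inv, Matrix.diagonal_mul, Matrix.add_mul, Matrix.one_mul]
    refine mul_pos (inv_pos.2 i.2) (add_pos_of_pos_of_nonneg ?_ (Matrix.mul_apply_nonneg
      (flat_excursion_sq_nonneg hirr hT hσ hj₀ hs hup hup') (M.Psi_nonneg s) i j))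
    rw [Psi_eq_W hT]
    exact M.W_pos_of_up hirr (hσ s hs) i.2 j.2
  have h22 : 0 ≤ (M.Psi s * M.A22 s) i j := by
    refine Matrix.mul_apply_nonneg (M.Psi_nonneg s) (Matrix.mul_apply_nonneg M.C2_inv_nonneg
      fun a b => add_nonneg ?_ (flat_excursion_sq_nonneg hirr hT hσ hj₀ hs hdn hdn' a b)) i j
    rw [Matrix.one_apply]
    split_ifs <;> norm_num
  have h21 : 0 ≤ (M.Psi s * M.A21 s * M.Psi s) i j :=
    Matrix.mul_apply_nonneg (Matrix.mul_apply_nonneg (M.Psi_nonneg s)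
      (Matrix.mul_apply_nonneg M.C2_inv_nonneg
        (flat_excursion_sq_nonneg hirr hT hσ hj₀ hs hdn hup'))) (M.Psi_nonneg s) i j
  exact add_pos_of_pos_of_nonneg (add_pos_of_pos_of_nonneg (add_pos_of_nonneg_of_pos h12 h11) h22)
    h21

/-- The Sylvester operator with coefficients `K s` and `D s` is injective, since `V` is a witness
that its negative is a nonsingular M-matrix. -/
theorem sylvester_injective (hirr : M.Irreducible) (hT : ∀ i, M.T i i ≠ 0)
    (hσ : ∀ z, σ < z → M.PassFinite z) {j₀ : Fin n} (hj₀ : M.c j₀ < 0) (hs : σ < s) :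
    Function.Injective (Matrix.sylvester (M.K s) (M.D s)) := by
  have hR := isUnit_R hirr hT hσ hj₀ hs
  refine (injective_iff_map_eq_zero _).2 fun x hx => Matrix.eq_zero_of_quasipositive
    (v := part (M.V s) (fun i => 0 < M.c i) (fun i => M.c i < 0)) _ (fun y hy i j h => ?_)
    (fun i j => M.V_nonneg s i j) (fun i j => ?_) hx
  · refine add_nonneg (Matrix.mul_apply_nonneg_left (K_offDiag_nonneg hirr hT hσ hj₀ hs) hy h)
      (Matrix.mul_apply_nonneg_right (fun a b hab => ?_) hy h)
    rw [D_eq_downGen hT (hσ s hs) hR]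
    exact M.W_mul_downGen_nonneg_of_ne s fun e => hab (Subtype.ext e)
  · have h := congrFun (congrFun (K_mul_V hT hσ hs hR) i) j
    exact h.trans_lt (neg_neg_of_pos (U_pos hirr hT hσ hj₀ hs i j))

theorem hasDerivAt_Psi (hT : ∀ i, M.T i i ≠ 0) (hσ : ∀ z, σ < z → M.PassFinite z) (hs : σ < s)
    (i : M.Up) (j : M.Down) : HasDerivAt (fun z => M.Psi z i j) (-M.V s i j) s := by
  simp only [Psi_eq_W hT]
  exact M.hasDerivAt_W hT hσ hs i j

theorem Phi_eq (hT : ∀ i, M.T i i ≠ 0) (hσ : ∀ z, σ < z → M.PassFinite z) (hs : σ < s) :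
    M.Phi s = -part (M.V s) (fun i => 0 < M.c i) (fun i => M.c i < 0) := by
  ext i j
  exact (hasDerivAt_Psi hT hσ hs i j).deriv

end

theorem exists_down (M : FluidModel n) {ξ : Fin n → ℝ} (hξ : M.IsStationary ξ)
    (hstable : ∑ i, M.c i * ξ i < 0) : ∃ j, M.c j < 0 := by
  by_contra! h
  exact absurd hstable (not_lt.2 (Finset.sum_nonneg fun i _ => mul_nonneg (h i) (hξ.1 i)))

end FluidModel

theorem mainTheorem6 {n : ℕ} (M : FluidModel n) (hirr : M.Irreducible)
    (ξ : Fin n → ℝ) (hξ : M.IsStationary ξ) (hstable : ∑ i, M.c i * ξ i < 0)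
    (hup : ∃ i, 0 < M.c i) :
    IsGreatest M.singSet M.sStar ∧
    (∀ s : ℝ, M.sStar < s →
      M.PsiFinite s ∧ IsUnit (M.R s) ∧
      (∀ i j, HasDerivAt (fun z => M.Psi z i j) (M.Phi s i j) s) ∧
      M.K s * M.Phi s + M.Phi s * M.D s = M.U s ∧
      ∀ X : Matrix M.Up M.Down ℝ, M.K s * X + X * M.D s = M.U s → X = M.Phi s) ∧
    ∀ i j, Filter.Tendsto (fun s => M.Phi s i j) (𝓝[>] M.sStar) Filter.atBot := by
  obtain ⟨i₀, hi₀⟩ := hup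
  obtain ⟨j₀, hj₀⟩ := M.exists_down hξ hstable
  have hT := M.diag_ne_zero_of_up_down hirr hi₀ hj₀
  obtain ⟨hgreat, hiff⟩ := M.exists_sing hirr hi₀ hj₀
  have hσ : ∀ z, M.sStar < z → M.PassFinite z := fun z hz => (hiff z).2 hz.le
  refine ⟨hgreat, fun s hs => ?_, fun i j => ?_⟩
  · have hR := FluidModel.isUnit_R hirr hT hσ hj₀ hs
    have hPhi := FluidModel.Phi_eq hT hσ hs
    have heq : M.K s * M.Phi s + M.Phi s * M.D s = M.U s := by
      rw [hPhi, Matrix.mul_neg, Matrix.neg_mul, ← neg_add, FluidModel.K_mul_V hT hσ hs hR, neg_neg]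
    refine ⟨(M.psiFinite_iff hirr hi₀ hj₀ s).2 (hσ s hs), hR, fun i j => ?_, heq, fun X hX => ?_⟩
    · exact (FluidModel.hasDerivAt_Psi hT hσ hs i j).differentiableAt.hasDerivAt
    · exact FluidModel.sylvester_injective hirr hT hσ hj₀ hs (hX.trans heq.symm)
  · refine (Filter.tendsto_neg_atTop_atBot.comp
      (FluidModel.tendsto_V hirr hT hiff i.2 j.2)).congr' ?_
    filter_upwards [self_mem_nhdsWithin] with s hs
    rw [FluidModel.Phi_eq hT hσ hs]
    rfl
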